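/- Let $\mathbb{K}$ be $\mathbb{R}$ or $\mathbb{C}$. A $\mathbb{K}$-Nash map is a $\mathbb{K}$-analytic map $f:U\to\mathbb{K}^m$ on an open semialgebraic set $U\subseteq\mathbb{K}^n$ (semialgebraic in $\mathbb{R}^{2n}$ if $\mathbb{K}=\mathbb{C}$) such that for each component $f_i$ there is a polynomial $P_i\in\mathbb{K}[X_1,\dots,X_n,Y]$ of positive degree in $Y$ with $P_i(u,f_i(u))=0$ for all $u\in U$. A locally $\mathbb{K}$-Nash manifold is a $\mathbb{K}$-analytic manifold $M$ with a $\mathbb{K}$-Nash atlas, i.e. a set of analytic charts covering $M$ whose images are semialgebraic and whose transition maps $\psi\phi^{-1}:\phi(U\cap V)\to\psi(U\cap V)$ are analytic diffeomorphisms and $\mathbb{K}$-Nash maps. A continuous map $f$ between such manifolds is locally $\mathbb{K}$-Nash if for every point $a$ and every chart $(V,\psi)$ of the atlas of the target with $f(a)\in V$ there are a chart $(U_0,\phi)$ of the atlas of the source and an open set $U\subseteq U_0$ with $a\in U$ and $f(U)\subseteq V$ such that $\psi f\phi^{-1}:\phi(U)\to\psi(V)$ is $\mathbb{K}$-Nash.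 A locally $\mathbb{K}$-Nash group is a locally $\mathbb{K}$-Nash manifold with a group structure whose multiplication and inversion are locally $\mathbb{K}$-Nash. A homomorphism of such groups is a group homomorphism that is locally $\mathbb{K}$-Nash; an isomorphism is a group isomorphism that is locally $\mathbb{K}$-Nash together with its inverse. Let $G$ be a locally $\mathbb{K}$-Nash group and let $\pi:\widetilde G\to G$ be an analytic universal cover, i.e. $\widetilde G$ is a simply connected $\mathbb{K}$-analytic manifold and $\pi$ is a surjective covering map that is locally an analytic diffeomorphism (so $G$ is connected). Then: 1. For every $e\in\pi^{-1}(1)$ there are a group structure on $\widetilde G$ with identity $e$ and a $\mathbb{K}$-Nash atlas of the analytic manifold $\widetilde G$ that make $\widetilde G$ a locally $\mathbb{K}$-Nash group and $\pi$ a homomorphism of locally $\mathbb{K}$-Nash groups. 2. Such a structure is unique up to isomorphism over $G$: if $\pi:\widetilde G\to G$ and $\pi':\widetilde G'\to G$ are analytic universal covers (possibly the same one), each equipped with the structure of a locally $\mathbb{K}$-Nash group for which the covering map is a homomorphism of locally $\mathbb{K}$-Nash groups, then there is an isomorphism of locally $\mathbb{K}$-Nash groups $\alpha:\widetilde G\to\widetilde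 G'$ with $\pi'\circ\alpha=\pi$. 3. For every such structure on $\widetilde G$, every open $W\subseteq G$ and every analytic section $s:W\to\widetilde G$ of $\pi$ (that is, $\pi\circ s=\mathrm{id}_W$), the map $s$ is locally $\mathbb{K}$-Nash. -/

import Mathlib

open scoped Manifold ContDiff

noncomputable section

/-- Semialgebraic subsets of `𝕜ⁿ`, where `𝕜` is `ℝ` or `ℂ`: the Boolean algebra of sets generated by
the sets `{z | 0 < p(re z, im z)}` with `p` a real polynomial. For `𝕜 = ℂ` these are the
semialgebraic subsets of `ℝ²ⁿ`; for `𝕜 = ℝ` the imaginary parts vanish and these are the usual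
semialgebraic subsets of `ℝⁿ`. -/
inductive IsSemialgebraic {𝕜 : Type*} [RCLike 𝕜] {ι : Type*} : Set (ι → 𝕜) → Prop
  | pos (p : MvPolynomial (ι ⊕ ι) ℝ) :
      IsSemialgebraic {z : ι → 𝕜 | 0 < MvPolynomial.eval
        (Sum.elim (fun i => RCLike.re (z i)) (fun i => RCLike.im (z i))) p}
  | compl (S : Set (ι → 𝕜)) : IsSemialgebraic S → IsSemialgebraic Sᶜ
  | inter (S T : Set (ι → 𝕜)) : IsSemialgebraic S → IsSemialgebraic T → IsSemialgebraic (S ∩ T)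

/-- The scalar function `f` is algebraic over `𝕜(id)` on `U`: there is `P ∈ 𝕜[X₁, …, Xₙ][Y]` of
positive degree in `Y` with `P(u, f(u)) = 0` for all `u ∈ U`. -/
def IsAlgebraicOn {𝕜 : Type*} [RCLike 𝕜] {ι : Type*} (f : (ι → 𝕜) → 𝕜) (U : Set (ι → 𝕜)) : Prop :=
  ∃ P : Polynomial (MvPolynomial ι 𝕜), 0 < P.natDegree ∧
    ∀ u ∈ U, (P.map (MvPolynomial.eval u)).eval (f u) = 0

/-- `f : U → 𝕜ᵐ` is a `𝕜`-Nash map: `U ⊆ 𝕜ⁿ` is open and semialgebraic, and `f` is `𝕜`-analytic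
and (componentwise) algebraic over `𝕜(id)` on `U`. -/
structure IsNashOn {𝕜 : Type*} [RCLike 𝕜] {ι κ : Type*} [Fintype ι] [Fintype κ]
    (f : (ι → 𝕜) → (κ → 𝕜)) (U : Set (ι → 𝕜)) : Prop where
  isOpen : IsOpen U
  isSemialgebraic : IsSemialgebraic U
  analytic : AnalyticOnNhd 𝕜 f U
  algebraic : ∀ j, IsAlgebraicOn (fun u => f u j) U

/-- Two charts `φ`, `ψ` are `𝕜`-Nash compatible: their images are semialgebraic and the transition
map `ψ φ⁻¹ : φ(U ∩ V) → ψ(U ∩ V)` is a `𝕜`-Nash diffeomorphism, i.e. a `𝕜`-Nash map with analytic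
inverse. (If `U ∩ V` is empty the last two conditions are void.) -/
structure NashCompatible {𝕜 : Type*} [RCLike 𝕜] {ι : Type*} [Fintype ι]
    {M : Type*} [TopologicalSpace M] (φ ψ : OpenPartialHomeomorph M (ι → 𝕜)) : Prop where
  left : IsSemialgebraic φ.target
  right : IsSemialgebraic ψ.target
  nash : IsNashOn (fun x => ψ (φ.symm x)) (φ '' (φ.source ∩ ψ.source))
  analytic_inv : AnalyticOnNhd 𝕜 (fun y => φ (ψ.symm y)) (ψ '' (φ.source ∩ ψ.source))

/-- `𝒜` is a `𝕜`-Nash atlas of the `𝕜`-analytic manifold `M`: a set of charts of the analytic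
structure of `M` that covers `M` and consists of pairwise `𝕜`-Nash compatible charts. A
`𝕜`-analytic manifold with a `𝕜`-Nash atlas is a locally `𝕜`-Nash manifold. -/
structure IsNashAtlas {𝕜 : Type*} [RCLike 𝕜] {n : ℕ}
    {M : Type*} [TopologicalSpace M] [ChartedSpace (Fin n → 𝕜) M]
    (𝒜 : Set (OpenPartialHomeomorph M (Fin n → 𝕜))) : Prop where
  analytic : 𝒜 ⊆ IsManifold.maximalAtlas 𝓘(𝕜, Fin n → 𝕜) ω M
  cover : ∀ x : M, ∃ φ ∈ 𝒜, x ∈ φ.source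
  compatible : ∀ φ ∈ 𝒜, ∀ ψ ∈ 𝒜, NashCompatible φ ψ

/-- The product chart `φ × ψ` on `M × N`, with values in `𝕜ᵐ × 𝕜ⁿ = 𝕜ᵐ⁺ⁿ`. -/
def prodChart {𝕜 : Type*} [RCLike 𝕜] {ι κ : Type*} {M N : Type*}
    [TopologicalSpace M] [TopologicalSpace N]
    (φ : OpenPartialHomeomorph M (ι → 𝕜)) (ψ : OpenPartialHomeomorph N (κ → 𝕜)) :
    OpenPartialHomeomorph (M × N) (ι ⊕ κ → 𝕜) :=
  (φ.prod ψ).trans Homeomorph.sumArrowHomeomorphProdArrow.symm.toOpenPartialHomeomorph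

/-- The product of two atlases: all products of a chart of `𝒜` and a chart of `ℬ`. -/
def prodAtlas {𝕜 : Type*} [RCLike 𝕜] {ι κ : Type*} {M N : Type*}
    [TopologicalSpace M] [TopologicalSpace N]
    (𝒜 : Set (OpenPartialHomeomorph M (ι → 𝕜))) (ℬ : Set (OpenPartialHomeomorph N (κ → 𝕜))) :
    Set (OpenPartialHomeomorph (M × N) (ι ⊕ κ → 𝕜)) :=
  Set.image2 prodChart 𝒜 ℬ

/-- The restriction of `f` to the open set `W ⊆ M` is a locally `𝕜`-Nash map with respect to the
atlases `𝒜` of `M` and `ℬ` of `N`: it is continuous, and for every `a ∈ W` and every chart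
`ψ ∈ ℬ` around `f a` there are a chart `φ ∈ 𝒜` and an open neighbourhood `U ⊆ W` of `a` in the
domain of `φ` such that `f` maps `U` into the domain of `ψ` and `ψ f φ⁻¹` is a `𝕜`-Nash map on
`φ(U)`. -/
def IsLocallyNashOn {𝕜 : Type*} [RCLike 𝕜] {ι κ : Type*} [Fintype ι] [Fintype κ] {M N : Type*}
    [TopologicalSpace M] [TopologicalSpace N]
    (𝒜 : Set (OpenPartialHomeomorph M (ι → 𝕜))) (ℬ : Set (OpenPartialHomeomorph N (κ → 𝕜)))
    (f : M → N) (W : Set M) : Prop :=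
  ContinuousOn f W ∧
  ∀ a ∈ W, ∀ ψ ∈ ℬ, f a ∈ ψ.source → ∃ φ ∈ 𝒜, ∃ U : Set M, IsOpen U ∧ a ∈ U ∧ U ⊆ W ∧
    U ⊆ φ.source ∧ Set.MapsTo f U ψ.source ∧ IsNashOn (fun x => ψ (f (φ.symm x))) (φ '' U)

/-- `f : M → N` is a locally `𝕜`-Nash map with respect to the atlases `𝒜` and `ℬ`. -/
def IsLocallyNash {𝕜 : Type*} [RCLike 𝕜] {ι κ : Type*} [Fintype ι] [Fintype κ] {M N : Type*}
    [TopologicalSpace M] [TopologicalSpace N]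
    (𝒜 : Set (OpenPartialHomeomorph M (ι → 𝕜))) (ℬ : Set (OpenPartialHomeomorph N (κ → 𝕜)))
    (f : M → N) : Prop :=
  IsLocallyNashOn 𝒜 ℬ f Set.univ

/-- The `𝕜`-analytic manifold `G` with the group operations and the atlas `𝒜` is a locally
`𝕜`-Nash group. -/
structure IsLocallyNashGroup {𝕜 : Type*} [RCLike 𝕜] {n : ℕ}
    {G : Type*} [TopologicalSpace G] [ChartedSpace (Fin n → 𝕜) G] [Group G]
    (𝒜 : Set (OpenPartialHomeomorph G (Fin n → 𝕜))) : Prop where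
  atlas : IsNashAtlas 𝒜
  mul : IsLocallyNash (prodAtlas 𝒜 𝒜) 𝒜 (fun p : G × G => p.1 * p.2)
  inv : IsLocallyNash 𝒜 𝒜 (fun g : G => g⁻¹)

/-- `f` is a homomorphism of locally `𝕜`-Nash groups. -/
def IsLocallyNashHom {𝕜 : Type*} [RCLike 𝕜] {ι κ : Type*} [Fintype ι] [Fintype κ] {G H : Type*}
    [TopologicalSpace G] [TopologicalSpace H] [Group G] [Group H]
    (𝒜 : Set (OpenPartialHomeomorph G (ι → 𝕜))) (ℬ : Set (OpenPartialHomeomorph H (κ → 𝕜)))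
    (f : G → H) : Prop :=
  IsLocallyNash 𝒜 ℬ f ∧ ∀ x y, f (x * y) = f x * f y

/-- `π : X → M` is the analytic universal cover of the `𝕜`-analytic manifold `M`: `X` is a simply
connected `𝕜`-analytic manifold and `π` is a surjective covering map that is locally an analytic
diffeomorphism. -/
structure IsAnalyticUniversalCover (𝕜 : Type*) [RCLike 𝕜] (n : ℕ) {X M : Type*}
    [TopologicalSpace X] [ChartedSpace (Fin n → 𝕜) X]
    [TopologicalSpace M] [ChartedSpace (Fin n → 𝕜) M] (π : X → M) : Prop where
  isManifold : IsManifold 𝓘(𝕜, Fin n → 𝕜) ω X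
  simplyConnected : SimplyConnectedSpace X
  surjective : Function.Surjective π
  isCoveringMap : IsCoveringMap π
  isLocalDiffeomorph : IsLocalDiffeomorph 𝓘(𝕜, Fin n → 𝕜) 𝓘(𝕜, Fin n → 𝕜) ω π

end

open scoped Manifold ContDiff
open Polynomial Set Filter Topology
set_option linter.unusedSectionVars false

/-! ### Cylindrical decomposition over a connected base -/

/-! The group structure on the cover is forced by covering theory. The cover and its powers are
simply connected and locally path connected, so multiplication and inversion of the base, composed
with the projection, have unique continuous lifts fixing the chosen point over the identity.
Uniqueness of lifts gives the group axioms (`IsCoveringMap.exists_group`). It also gives the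
isomorphism between two covers: the lifts of each projection through the other are mutually inverse
and multiplicative.

That these lifts are Nash reduces to one fact: an analytic local section of a Nash local
diffeomorphism is Nash (`IsLocallyNash.isLocallyNashOn_section`). A continuous lift is locally such
a section after the given map (`IsLocallyNash.lift`). The fact rests on the algebraicity of inverses
and composites. On a connected open set the analytic functions form a domain, and those algebraic
over the polynomials form a subalgebra. Transitivity of algebraicity gives composites
(`IsAlgebraicOn.comp`), and counting transcendence degree gives inverses (`isAlgebraicOn_inverse`).
An equation for the outer function may vanish identically along the inner one; its Taylor
coefficients of lowest surviving order replace it.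

The substantial point is the Nash atlas on the cover. Charts of the base are composed with the
projection and shrunk to semialgebraic image. Transition maps are then restrictions of those below,
but their domains must be semialgebraic (`nashCompatible_of_charts`). Such a domain is the locus
where two local lifts agree, hence open and closed in a set obtained from semialgebraic sets by
intersection and by preimage under a Nash map. So two theorems of semialgebraic geometry are needed:
relatively clopen subsets and such preimages are again semialgebraic
(`IsSemialgebraic.of_isOpen_diff`, `IsSemialgebraic.inter_preimage`).

Both follow from a cylindrical decomposition in the manner of Łojasiewicz, without quantifier
elimination: every finite family of polynomials can be enlarged so that its sign conditions cut out
connected cells, which moreover fibre openly over connected sets of parameters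
(`exists_isStructured`, `exists_isFibred`). A set defined by finitely many sign conditions is then a
finite union of connected cells, so a clopen part is a union of cells. A continuous algebraic map
over a connected cell is a section with finitely many possible values in each fibre, so its graph
stays in a single cell. -/

/-- Two systems of cells in the line (given by their cell maps), with the same cells in the same
order: if a continuous function is monotone and takes a positive value on an open cell of the first
one, then so it does in the second one, if the signs of the functions agree in the point cells. -/
theorem exists_pos_of_cells {Λ : Type*} {c c' : ℝ → Λ} {p q : ℝ → ℝ} {S : Set Λ} {l : Λ}
    (hconv : ∀ m, (c ⁻¹' {m}).OrdConnected)
    (hr : ∀ y, ∃ z, c' z = c y) (hr' : ∀ z, ∃ y, c y = c' z)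
    (hord : ∀ y₁ y₂ z₁ z₂, c y₁ ≠ c y₂ → c' z₁ = c y₁ → c' z₂ = c y₂ → y₁ < y₂ → z₁ < z₂)
    (hS : ∀ y₁ y₂, c y₁ ∈ S → c y₁ = c y₂ → y₁ = y₂)
    (ho : ∀ m ∉ S, IsOpen (c ⁻¹' {m})) (ho' : ∀ m ∉ S, IsOpen (c' ⁻¹' {m}))
    (hp : Continuous p) (hq : Continuous q)
    (hs : ∀ y z, c' z = c y → c y ∈ S → SignType.sign (q z) = SignType.sign (p y))
    (hl : l ∉ S) (hmono : MonotoneOn p (c ⁻¹' {l}))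
    (hunb : ¬ BddAbove (c' ⁻¹' {l}) → ∃ z, c' z = l ∧ 0 < q z)
    {y : ℝ} (hy : c y = l) (hpy : 0 < p y) : ∃ z, c' z = l ∧ 0 < q z := by
  -- If `q ≤ 0` on the whole cell of `l`, its right end `e` is a point cell with `q e ≤ 0`. The
  -- matching point `e₀` of the first line has `p e₀ ≤ 0` and turns out to be the right end of the
  -- first cell, which contradicts monotonicity and `0 < p y`.
  by_contra hcon
  push Not at hcon
  have hbdd : BddAbove (c' ⁻¹' {l}) := by
    by_contra h
    obtain ⟨z, hz, hz'⟩ := hunb h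
    exact absurd hz' (not_lt.2 (hcon z hz))
  -- the right end of an open cell is a point cell
  have key : ∀ {k : ℝ → Λ} (_ : ∀ m ∉ S, IsOpen (k ⁻¹' {m})) (_ : BddAbove (k ⁻¹' {l}))
      (_ : (k ⁻¹' {l}).Nonempty), k (sSup (k ⁻¹' {l})) ≠ l ∧ k (sSup (k ⁻¹' {l})) ∈ S := by
    intro k hk hb hne
    have hlub := isLUB_csSup hne hb
    have h1 : k (sSup (k ⁻¹' {l})) ≠ l := by
      intro h
      obtain ⟨u, hu, hu'⟩ := exists_Ico_subset_of_mem_nhds ((hk l hl).mem_nhds h)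
        ⟨sSup (k ⁻¹' {l}) + 1, by linarith⟩
      have h2 : (sSup (k ⁻¹' {l}) + u) / 2 ∈ k ⁻¹' {l} := hu' ⟨by linarith, by linarith⟩
      have := hlub.1 h2
      linarith
    refine ⟨h1, ?_⟩
    by_contra h
    have hcl := hlub.mem_closure hne
    obtain ⟨x, hx1, hx2⟩ := mem_closure_iff.1 hcl _ (hk _ h) rfl
    exact h1 (hx1.symm.trans hx2)
  obtain ⟨z₀, hz₀⟩ := hr y
  have hne' : (c' ⁻¹' {l}).Nonempty := ⟨z₀, hz₀.trans hy⟩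
  obtain ⟨he1, he2⟩ := key ho' hbdd hne'
  have hlub' := isLUB_csSup hne' hbdd
  set e := sSup (c' ⁻¹' {l}) with he
  have hqe : q e ≤ 0 := by
    have : closure (c' ⁻¹' {l}) ⊆ {z | q z ≤ 0} :=
      closure_minimal (fun z hz => hcon z hz) (isClosed_le hq continuous_const)
    exact this (hlub'.mem_closure hne')
  obtain ⟨e₀, he₀⟩ := hr' e
  have hpe₀ : p e₀ ≤ 0 := by
    have h := hs e₀ e he₀.symm (he₀ ▸ he2)
    by_contra h'
    push Not at h'
    rw [sign_pos h', sign_eq_one_iff] at h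
    linarith
  have hz₀l : c' z₀ = l := hz₀.trans hy
  have hze : z₀ < e := lt_of_le_of_ne (hlub'.1 hz₀l) (by rintro rfl; exact he1 hz₀l)
  have hne₀ : c y ≠ c e₀ := by rw [hy, he₀]; exact he1.symm
  have hye : y < e₀ := by
    rcases lt_trichotomy y e₀ with h | h | h
    · exact h
    · exact absurd (congrArg c h) hne₀
    · exact absurd (hord e₀ y e z₀ hne₀.symm he₀.symm hz₀ h) (not_lt.2 hze.le)
  have hub : e₀ ∈ upperBounds (c ⁻¹' {l}) := by
    intro x hx
    by_contra h
    push Not at h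
    have : e₀ ∈ c ⁻¹' {l} := (hconv l).out hy hx ⟨hye.le, h.le⟩
    exact hne₀ (hy.trans (this : c e₀ = l).symm)
  have hne : (c ⁻¹' {l}).Nonempty := ⟨y, hy⟩
  obtain ⟨hf1, hf2⟩ := key ho ⟨e₀, hub⟩ hne
  have hlub := isLUB_csSup hne ⟨e₀, hub⟩
  set e₁ := sSup (c ⁻¹' {l}) with he₁
  have hye₁ : y < e₁ := lt_of_le_of_ne (hlub.1 hy) (by intro h; exact hf1 (h ▸ hy))
  -- If the first cell ended at some `e₁` before `e₀`, a point cell would separate the cell of `l`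
  -- from `e` in the second line too, although `e` is the end of that cell.
  rcases (hlub.2 hub).lt_or_eq with hlt | heq
  · have hne₁ : c e₁ ≠ c e₀ := fun h => hlt.ne (hS _ _ hf2 h)
    obtain ⟨z₁, hz₁⟩ := hr e₁
    have h1 : z₁ < e := hord e₁ e₀ z₁ e hne₁ hz₁ he₀.symm hlt
    have h2 : e ≤ z₁ := by
      refine hlub'.2 fun z hz => ?_
      exact (hord y e₁ z z₁ (by rw [hy]; exact hf1.symm) ((show c' z = l from hz).trans hy.symm)
        hz₁ hye₁).le
    linarith
  · have : p y ≤ p e₁ := by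
      have h1 : ∀ᶠ x in 𝓝[c ⁻¹' {l}] e₁, p y ≤ p x := by
        have : ∀ᶠ x in 𝓝[c ⁻¹' {l}] e₁, y < x :=
          mem_nhdsWithin_of_mem_nhds (lt_mem_nhds hye₁)
        filter_upwards [this, self_mem_nhdsWithin] with x hx hx'
        exact hmono hy hx' hx.le
      have : (𝓝[c ⁻¹' {l}] e₁).NeBot := mem_closure_iff_nhdsWithin_neBot.1 (hlub.mem_closure hne)
      exact ge_of_tendsto (hp.continuousAt.mono_left nhdsWithin_le_nhds) h1
    rw [heq] at this
    linarith

/-- The mirror image of `exists_pos_of_cells`. -/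
theorem exists_neg_of_cells {Λ : Type*} {c c' : ℝ → Λ} {p q : ℝ → ℝ} {S : Set Λ} {l : Λ}
    (hconv : ∀ m, (c ⁻¹' {m}).OrdConnected)
    (hr : ∀ y, ∃ z, c' z = c y) (hr' : ∀ z, ∃ y, c y = c' z)
    (hord : ∀ y₁ y₂ z₁ z₂, c y₁ ≠ c y₂ → c' z₁ = c y₁ → c' z₂ = c y₂ → y₁ < y₂ → z₁ < z₂)
    (hS : ∀ y₁ y₂, c y₁ ∈ S → c y₁ = c y₂ → y₁ = y₂)
    (ho : ∀ m ∉ S, IsOpen (c ⁻¹' {m})) (ho' : ∀ m ∉ S, IsOpen (c' ⁻¹' {m}))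
    (hp : Continuous p) (hq : Continuous q)
    (hs : ∀ y z, c' z = c y → c y ∈ S → SignType.sign (q z) = SignType.sign (p y))
    (hl : l ∉ S) (hmono : MonotoneOn p (c ⁻¹' {l}))
    (hunb : ¬ BddBelow (c' ⁻¹' {l}) → ∃ z, c' z = l ∧ q z < 0)
    {y : ℝ} (hy : c y = l) (hpy : p y < 0) : ∃ z, c' z = l ∧ q z < 0 := by
  have hneg : ∀ {k : ℝ → Λ}, (∀ m, (k ⁻¹' {m}).OrdConnected) →
      ∀ m, ((fun x => k (-x)) ⁻¹' {m}).OrdConnected := by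
    intro k hk m
    refine ⟨fun x hx y hy z hz => ?_⟩
    exact (hk m).out hy hx ⟨neg_le_neg hz.2, neg_le_neg hz.1⟩
  obtain ⟨z, hz, hz'⟩ := exists_pos_of_cells (c := fun x => c (-x)) (c' := fun x => c' (-x))
    (p := fun x => -p (-x)) (q := fun x => -q (-x)) (S := S) (l := l) (y := -y)
    (hneg hconv)
    (fun y => (hr (-y)).imp' Neg.neg (fun z hz => by simpa using hz))
    (fun y => (hr' (-y)).imp' Neg.neg (fun z hz => by simpa using hz))
    (fun y₁ y₂ z₁ z₂ h h1 h2 h3 => neg_lt_neg_iff.1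
      (hord _ _ _ _ h.symm h2 h1 (neg_lt_neg h3)))
    (fun y₁ y₂ h1 h2 => neg_injective (hS _ _ h1 h2))
    (fun m hm => (ho m hm).preimage continuous_neg)
    (fun m hm => (ho' m hm).preimage continuous_neg)
    (hp.comp continuous_neg).neg (hq.comp continuous_neg).neg
    (fun y z h1 h2 => by simp only [Left.sign_neg]; rw [hs _ _ h1 h2]) hl
    (fun a ha b hb hab => neg_le_neg (hmono hb ha (neg_le_neg hab)))
    (fun h => by
      obtain ⟨z, hz, hz'⟩ := hunb (fun ⟨b, hb⟩ => h ⟨-b, fun x hx => by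
        have := hb (show -x ∈ c' ⁻¹' {l} from hx); linarith⟩)
      exact ⟨-z, by simpa using hz, by simpa using hz'⟩)
    (by simpa using hy) (by simpa using hpy)
  exact ⟨-z, hz, by linarith⟩

/-! ### Sign conditions on univariate polynomials with varying coefficients -/

section Base

variable {T : Type*} {A : Type*} [CommRing A] (ev : T → A →+* ℝ)

/-- The value at `(t, y)` of the polynomial `p` with coefficients in a ring of functions on `T`. -/
noncomputable def polyVal (p : A[X]) (t : T) (y : ℝ) : ℝ := (p.map (ev t)).eval y

/-- The polynomials in `F` have the same signs at `(s, z)` and `(t, y)`. -/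
def SameSign (F : Finset A[X]) (s : T) (z : ℝ) (t : T) (y : ℝ) : Prop :=
  ∀ f ∈ F, SignType.sign (polyVal ev f s z) = SignType.sign (polyVal ev f t y)

/-- The functions in `E` have constant signs on `C`. -/
def SignInvariant (E : Finset A) (C : Set T) : Prop :=
  ∀ a ∈ E, ∀ s ∈ C, ∀ t ∈ C, SignType.sign (ev s a) = SignType.sign (ev t a)

variable {ev}

theorem SameSign.symm {F : Finset A[X]} {s t : T} {z y : ℝ} (h : SameSign ev F s z t y) :
    SameSign ev F t y s z := fun f hf => (h f hf).symm

theorem SameSign.trans {F : Finset A[X]} {s t u : T} {z y x : ℝ} (h : SameSign ev F s z t y)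
    (h' : SameSign ev F t y u x) : SameSign ev F s z u x := fun f hf => (h f hf).trans (h' f hf)

theorem SameSign.mono {F F' : Finset A[X]} (hF : F ⊆ F') {s t : T} {z y : ℝ}
    (h : SameSign ev F' s z t y) : SameSign ev F s z t y := fun f hf => h f (hF hf)

theorem SignInvariant.mono {E E' : Finset A} (hE : E ⊆ E') {C : Set T}
    (h : SignInvariant ev E' C) : SignInvariant ev E C := fun a ha => h a (hE ha)

theorem SignInvariant.eq_zero_iff {E : Finset A} {C : Set T} (h : SignInvariant ev E C) {a : A}
    (ha : a ∈ E) {s t : T} (hs : s ∈ C) (ht : t ∈ C) : ev s a = 0 ↔ ev t a = 0 := by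
  rw [← sign_eq_zero_iff, h a ha s hs t ht, sign_eq_zero_iff]

theorem continuous_polyVal_right (p : A[X]) (t : T) : Continuous (polyVal ev p t) :=
  (p.map (ev t)).continuous

theorem hasDerivAt_polyVal (p : A[X]) (t : T) (y : ℝ) :
    HasDerivAt (polyVal ev p t) (polyVal ev (derivative p) t y) y := by
  have := (p.map (ev t)).hasDerivAt y
  rwa [derivative_map] at this

theorem monotoneOn_polyVal {p : A[X]} {t : T} {I : Set ℝ} (hI : I.OrdConnected)
    (h : ∀ y ∈ I, 0 ≤ polyVal ev (derivative p) t y) : MonotoneOn (polyVal ev p t) I := by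
  refine monotoneOn_of_deriv_nonneg hI.convex (continuous_polyVal_right p t).continuousOn
    (fun y _ => (hasDerivAt_polyVal p t y).differentiableAt.differentiableWithinAt) fun y hy => ?_
  rw [(hasDerivAt_polyVal p t y).deriv]
  exact h y (interior_subset hy)

theorem antitoneOn_polyVal {p : A[X]} {t : T} {I : Set ℝ} (hI : I.OrdConnected)
    (h : ∀ y ∈ I, polyVal ev (derivative p) t y ≤ 0) : AntitoneOn (polyVal ev p t) I := by
  refine antitoneOn_of_deriv_nonpos hI.convex (continuous_polyVal_right p t).continuousOn
    (fun y _ => (hasDerivAt_polyVal p t y).differentiableAt.differentiableWithinAt) fun y hy => ?_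
  rw [(hasDerivAt_polyVal p t y).deriv]
  exact h y (interior_subset hy)

/-- Thom's lemma: the cells of a family of univariate polynomials that is closed under derivation
are intervals. -/
theorem sameSign_of_mem_Icc {F : Finset A[X]} (hF : ∀ f ∈ F, derivative f ∈ F) {t : T} {y₁ y₂ : ℝ}
    (h : SameSign ev F t y₁ t y₂) {y : ℝ} (hy : y ∈ Icc y₁ y₂) : SameSign ev F t y t y₁ := by
  -- Induction on the degree: the derivative has constant sign on the interval, so `f` is monotone
  -- there, and equal signs at the two ends force the same sign in between.
  have main : ∀ n, ∀ f ∈ F, f.natDegree ≤ n → ∀ y ∈ Icc y₁ y₂,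
      SignType.sign (polyVal ev f t y) = SignType.sign (polyVal ev f t y₁) := by
    intro n
    induction n with
    | zero =>
      intro f _ hd y _
      rw [eq_C_of_natDegree_le_zero hd]
      simp [polyVal]
    | succ n ih =>
      intro f hf hd y hy
      have hy₁ : y₁ ∈ Icc y₁ y₂ := ⟨le_rfl, hy.1.trans hy.2⟩
      have hy₂ : y₂ ∈ Icc y₁ y₂ := ⟨hy.1.trans hy.2, le_rfl⟩
      have ih' := ih (derivative f) (hF f hf) ((natDegree_derivative_le f).trans (by omega))
      have hs := h f hf
      rcases le_total 0 (polyVal ev (derivative f) t y₁) with h0 | h0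
      · have hm : MonotoneOn (polyVal ev f t) (Icc y₁ y₂) := by
          refine monotoneOn_polyVal ordConnected_Icc fun x hx => ?_
          rw [← sign_nonneg_iff, ih' x hx, sign_nonneg_iff]
          exact h0
        have h1 := SignType.sign.monotone (hm hy₁ hy hy.1)
        have h2 := SignType.sign.monotone (hm hy hy₂ hy.2)
        rw [← hs] at h2
        exact le_antisymm h2 h1
      · have hm : AntitoneOn (polyVal ev f t) (Icc y₁ y₂) := by
          refine antitoneOn_polyVal ordConnected_Icc fun x hx => ?_
          rw [← sign_nonpos_iff, ih' x hx, sign_nonpos_iff]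
          exact h0
        have h1 := SignType.sign.monotone (hm hy₁ hy hy.1)
        have h2 := SignType.sign.monotone (hm hy hy₂ hy.2)
        rw [← hs] at h2
        exact le_antisymm h1 h2
  exact fun f hf => main _ f hf le_rfl y hy

theorem ordConnected_sameSign {F : Finset A[X]} (hF : ∀ f ∈ F, derivative f ∈ F) (s t : T)
    (y : ℝ) : {z | SameSign ev F s z t y}.OrdConnected :=
  ⟨fun _ hx _ hz _ hw => (sameSign_of_mem_Icc hF (SameSign.trans hx (SameSign.symm hz)) hw).trans hx⟩

variable [TopologicalSpace T]

/-- The cells cut out by `F` in `C × ℝ` project onto `C`, by open maps. -/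
structure IsStructured (ev : T → A →+* ℝ) (C : Set T) (F : Finset A[X]) : Prop where
  isOpen : ∀ t ∈ C, ∀ y, ∀ V ∈ 𝓝 y, ∀ᶠ s in 𝓝[C] t, ∃ z ∈ V, SameSign ev F s z t y
  surj : ∀ t ∈ C, ∀ y, ∀ s ∈ C, ∃ z, SameSign ev F s z t y

theorem IsStructured.mono {C : Set T} {F F' : Finset A[X]} (hF : F ⊆ F')
    (h : IsStructured ev C F') : IsStructured ev C F where
  isOpen t ht y V hV := (h.isOpen t ht y V hV).mono fun _ ⟨z, hz, hz'⟩ => ⟨z, hz, hz'.mono hF⟩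
  surj t ht y s hs := (h.surj t ht y s hs).imp fun _ h => h.mono hF

theorem continuous_polyVal (hev : ∀ a, Continuous fun t => ev t a) (p : A[X]) :
    Continuous fun x : T × ℝ => polyVal ev p x.1 x.2 := by
  simp only [polyVal, eval_map, eval₂_eq_sum_range]
  exact continuous_finsetSum _ fun i _ =>
    ((hev _).comp continuous_fst).mul (continuous_snd.pow i)

/-- The order of the cells is the same over all points of a connected base. -/
theorem IsStructured.lt_of_lt {C : Set T} (hC : IsPreconnected C) {K : Finset A[X]}
    (hK : ∀ f ∈ K, derivative f ∈ K) (h : IsStructured ev C K) {s t : T} (hs : s ∈ C) (ht : t ∈ C)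
    {y₁ y₂ z₁ z₂ : ℝ} (hne : ¬ SameSign ev K t y₁ t y₂) (h₁ : SameSign ev K s z₁ t y₁)
    (h₂ : SameSign ev K s z₂ t y₂) (hlt : y₁ < y₂) : z₁ < z₂ := by
  -- `P` and `Q` say that the two cells occur over `u` in the given or in the reversed order.
  -- Disjoint intervals allow only one of the two, and each is an open condition on the connected
  -- base.
  let P : T → Prop := fun u => ∃ x₁ x₂, SameSign ev K u x₁ t y₁ ∧ SameSign ev K u x₂ t y₂ ∧ x₁ < x₂
  let Q : T → Prop := fun u => ∃ x₁ x₂, SameSign ev K u x₁ t y₁ ∧ SameSign ev K u x₂ t y₂ ∧ x₂ < x₁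
  have hex : ∀ u, P u → Q u → False := by
    rintro u ⟨x₁, x₂, hx₁, hx₂, hx⟩ ⟨w₁, w₂, hw₁, hw₂, hw⟩
    have hdis : ∀ x, SameSign ev K u x t y₁ → SameSign ev K u x t y₂ → False :=
      fun x h h' => hne (h.symm.trans h')
    rcases le_or_gt x₂ w₁ with h' | h'
    · exact hdis x₂ ((ordConnected_sameSign hK u t y₁).out hx₁ hw₁ ⟨hx.le, h'⟩) hx₂
    · exact hdis w₁ hw₁ ((ordConnected_sameSign hK u t y₂).out hw₂ hx₂ ⟨hw.le, h'.le⟩)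
  have hor : ∀ u ∈ C, P u ∨ Q u := by
    intro u hu
    obtain ⟨x₁, hx₁⟩ := h.surj t ht y₁ u hu
    obtain ⟨x₂, hx₂⟩ := h.surj t ht y₂ u hu
    rcases lt_trichotomy x₁ x₂ with h' | h' | h'
    · exact .inl ⟨x₁, x₂, hx₁, hx₂, h'⟩
    · exact absurd (hx₁.symm.trans (h' ▸ hx₂)) hne
    · exact .inr ⟨x₁, x₂, hx₁, hx₂, h'⟩
  have hPo : ∀ u ∈ C, P u → ∀ᶠ v in 𝓝[C] u, P v := by
    rintro u hu ⟨x₁, x₂, hx₁, hx₂, hx⟩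
    obtain ⟨m, hm₁, hm₂⟩ := exists_between hx
    filter_upwards [h.isOpen u hu x₁ _ (Iio_mem_nhds hm₁), h.isOpen u hu x₂ _ (Ioi_mem_nhds hm₂)]
      with v ⟨a, ha, ha'⟩ ⟨b, hb, hb'⟩
    exact ⟨a, b, ha'.trans hx₁, hb'.trans hx₂, lt_trans ha hb⟩
  have hQo : ∀ u ∈ C, Q u → ∀ᶠ v in 𝓝[C] u, Q v := by
    rintro u hu ⟨x₁, x₂, hx₁, hx₂, hx⟩
    obtain ⟨m, hm₁, hm₂⟩ := exists_between hx
    filter_upwards [h.isOpen u hu x₂ _ (Iio_mem_nhds hm₁), h.isOpen u hu x₁ _ (Ioi_mem_nhds hm₂)]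
      with v ⟨a, ha, ha'⟩ ⟨b, hb, hb'⟩
    exact ⟨b, a, hb'.trans hx₁, ha'.trans hx₂, lt_trans ha hb⟩
  have hiff := hC.induction₂ (fun u v => (P u ↔ P v)) (fun u hu => by
    rcases hor u hu with hP | hQ
    · filter_upwards [hPo u hu hP] with v hv
      exact ⟨fun _ => hv, fun _ => hP⟩
    · filter_upwards [hQo u hu hQ] with v hv
      exact ⟨fun hP => (hex u hP hQ).elim, fun hP => (hex v hP hv).elim⟩)
    (fun _ _ _ _ _ _ h1 h2 => h1.trans h2) (fun _ _ _ _ h => h.symm) ht hs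
  have hPs : P s := hiff.1 ⟨y₁, y₂, fun _ _ => rfl, fun _ _ => rfl, hlt⟩
  by_contra hle
  rcases (not_lt.1 hle).lt_or_eq with h' | h'
  · exact hex s hPs ⟨z₁, z₂, h₁, h₂, h'⟩
  · exact hne (h₁.symm.trans (h' ▸ h₂))

end Base

/-! ### Sign changes and growth of functions on the line -/

theorem eventually_sign_eq {c : ℝ} (hc : c ≠ 0) :
    ∀ᶠ x in 𝓝 c, SignType.sign x = SignType.sign c := by
  rcases hc.lt_or_gt with h | h
  · filter_upwards [gt_mem_nhds h] with x hx
    rw [sign_neg h, sign_neg hx]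
  · filter_upwards [lt_mem_nhds h] with x hx
    rw [sign_pos h, sign_pos hx]

/-- Near `y` the slope has the sign of the derivative on both sides. The unordered interval covers
the increasing and the decreasing case at once. -/
theorem exists_sign_change {p : ℝ → ℝ} {p' y : ℝ} (hp : HasDerivAt p p' y) (hp' : p' ≠ 0)
    (hy : p y = 0) {V : Set ℝ} (hV : V ∈ 𝓝 y) : ∃ a b, uIcc a b ⊆ V ∧ p a < 0 ∧ 0 < p b := by
  obtain ⟨ε, hε, hεV⟩ := Metric.mem_nhds_iff.1 hV
  have hB : (Metric.ball y ε).OrdConnected := by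
    rw [Real.ball_eq_Ioo]; exact ordConnected_Ioo
  have hsl := hasDerivAt_iff_tendsto_slope.1 hp
  have hev := hsl.eventually (eventually_sign_eq hp')
  have hr : ∃ b ∈ Metric.ball y ε, y < b ∧ SignType.sign (slope p y b) = SignType.sign p' := by
    have h1 : ∀ᶠ x in 𝓝[>] y, SignType.sign (slope p y x) = SignType.sign p' :=
      hev.filter_mono (nhdsWithin_mono _ fun x (hx : y < x) => hx.ne')
    have h2 : ∀ᶠ x in 𝓝[>] y, x ∈ Metric.ball y ε :=
      mem_nhdsWithin_of_mem_nhds (Metric.ball_mem_nhds _ hε)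
    obtain ⟨b, hb1, hb2, hb3⟩ := (h1.and (h2.and self_mem_nhdsWithin)).exists
    exact ⟨b, hb2, hb3, hb1⟩
  have hl : ∃ b ∈ Metric.ball y ε, b < y ∧ SignType.sign (slope p y b) = SignType.sign p' := by
    have h1 : ∀ᶠ x in 𝓝[<] y, SignType.sign (slope p y x) = SignType.sign p' :=
      hev.filter_mono (nhdsWithin_mono _ fun x (hx : x < y) => hx.ne)
    have h2 : ∀ᶠ x in 𝓝[<] y, x ∈ Metric.ball y ε :=
      mem_nhdsWithin_of_mem_nhds (Metric.ball_mem_nhds _ hε)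
    obtain ⟨b, hb1, hb2, hb3⟩ := (h1.and (h2.and self_mem_nhdsWithin)).exists
    exact ⟨b, hb2, hb3, hb1⟩
  obtain ⟨b, hb, hyb, hb'⟩ := hr
  obtain ⟨a, ha, hya, ha'⟩ := hl
  have hab : uIcc a b ⊆ V := (hB.uIcc_subset ha hb).trans hεV
  rw [slope_def_field, hy, sub_zero] at ha' hb'
  have ha0 : a - y < 0 := by linarith
  have hb0 : 0 < b - y := by linarith
  rcases hp'.lt_or_gt with h | h
  · rw [sign_neg h, sign_eq_neg_one_iff] at ha' hb'
    refine ⟨b, a, by rwa [uIcc_comm], ?_, ?_⟩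
    · by_contra hc
      exact absurd hb' (not_lt.2 (div_nonneg (not_lt.1 hc) hb0.le))
    · by_contra hc
      exact absurd ha' (not_lt.2 (div_nonneg_of_nonpos (not_lt.1 hc) ha0.le))
  · rw [sign_pos h, sign_eq_one_iff] at ha' hb'
    refine ⟨a, b, hab, ?_, ?_⟩
    · by_contra hc
      exact absurd ha' (not_lt.2 (div_nonpos_of_nonneg_of_nonpos (not_lt.1 hc) ha0.le))
    · by_contra hc
      exact absurd hb' (not_lt.2 (div_nonpos_of_nonpos_of_nonneg (not_lt.1 hc) hb0.le))

theorem exists_eq_zero_of_uIcc {p : ℝ → ℝ} (hp : Continuous p) {a b : ℝ} (ha : p a < 0)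
    (hb : 0 < p b) : ∃ z ∈ uIcc a b, p z = 0 := by
  have := intermediate_value_uIcc (a := a) (b := b) hp.continuousOn
  exact this ⟨inf_le_left.trans ha.le, le_sup_of_le_right hb.le⟩

/-- A monotone function that never becomes positive is bounded on the half-line, whereas a
nonconstant polynomial is not. This replaces the end point of a cell when the cell is unbounded. -/
theorem Polynomial.exists_pos_of_monotoneOn_Ici {P : ℝ[X]} (hP : derivative P ≠ 0) {z₀ : ℝ}
    (hm : MonotoneOn (fun z => P.eval z) (Ici z₀)) : ∃ z, z₀ ≤ z ∧ 0 < P.eval z := by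
  by_contra hcon
  push Not at hcon
  have : IsBoundedUnder (· ≤ ·) atTop fun x => |eval x P| := by
    refine ⟨|P.eval z₀|, ?_⟩
    rw [eventually_map]
    filter_upwards [eventually_ge_atTop z₀] with x hx
    have h1 := hm self_mem_Ici hx hx
    have h2 := hcon x hx
    simp only at h1
    rw [abs_of_nonpos h2, abs_of_nonpos (h1.trans h2)]
    linarith
  have hd := (P.isBoundedUnder_abs_atTop_iff).1 this
  rw [eq_C_of_degree_le_zero hd] at hP
  simp at hP

theorem Polynomial.exists_neg_of_monotoneOn_Iic {P : ℝ[X]} (hP : derivative P ≠ 0) {z₀ : ℝ}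
    (hm : MonotoneOn (fun z => P.eval z) (Iic z₀)) : ∃ z, z ≤ z₀ ∧ P.eval z < 0 := by
  have hd : derivative (-P.comp (-X)) ≠ 0 := by
    rw [derivative_neg, derivative_comp]
    simp only [derivative_neg, derivative_X, neg_mul, one_mul, neg_neg]
    intro h
    apply hP
    have h' := congrArg (fun q : ℝ[X] => q.comp (-X)) h
    simpa [comp_assoc] using h'
  obtain ⟨z, hz, hz'⟩ := exists_pos_of_monotoneOn_Ici (z₀ := -z₀) hd (fun a ha b hb hab => by
    simp only [eval_neg, eval_comp, eval_X, neg_le_neg_iff]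
    exact hm (show -b ≤ z₀ by linarith [mem_Ici.1 hb]) (show -a ≤ z₀ by linarith [mem_Ici.1 ha])
      (neg_le_neg hab))
  refine ⟨-z, by linarith, ?_⟩
  simpa using hz'

/-! ### Point cells, open cells and the addition of one polynomial -/

section Base

variable {T : Type*} [TopologicalSpace T] {A : Type*} [CommRing A] {ev : T → A →+* ℝ}

/-- A nonzero polynomial of `K` over `t` vanishes at `(t, y)`. -/
def IsSpecial (ev : T → A →+* ℝ) (K : Finset A[X]) (t : T) (y : ℝ) : Prop :=
  ∃ g ∈ K, g.map (ev t) ≠ 0 ∧ polyVal ev g t y = 0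

/-- At a point that is not special, each member of `K` either vanishes on the whole fibre, hence on
all fibres over `C`, or is nonzero there and keeps its sign by continuity. -/
theorem eventually_sameSign (hev : ∀ a, Continuous fun t => ev t a) {C : Set T} {K : Finset A[X]}
    (hnull : ∀ g ∈ K, ∀ s ∈ C, ∀ t ∈ C, g.map (ev s) = 0 → g.map (ev t) = 0)
    {t : T} (ht : t ∈ C) {y : ℝ} (hy : ¬ IsSpecial ev K t y) :
    ∀ᶠ x in 𝓝[C] t ×ˢ 𝓝 y, SameSign ev K x.1 x.2 t y := by
  simp only [SameSign, Finset.eventually_all]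
  intro g hg
  by_cases h0 : g.map (ev t) = 0
  · have : ∀ᶠ x in 𝓝[C] t ×ˢ 𝓝 y, x.1 ∈ C := tendsto_fst.eventually self_mem_nhdsWithin
    filter_upwards [this] with x hx
    simp [polyVal, h0, hnull g hg t ht x.1 hx h0]
  · have h1 : polyVal ev g t y ≠ 0 := fun h => hy ⟨g, hg, h0, h⟩
    have h2 := ((continuous_polyVal hev g).tendsto (t, y)).eventually (eventually_sign_eq h1)
    rw [nhds_prod_eq] at h2
    exact h2.filter_mono (prod_mono nhdsWithin_le_nhds le_rfl)

/-- Sign vectors of the polynomials in `K`. -/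
noncomputable def cellMap (ev : T → A →+* ℝ) (K : Finset A[X]) (t : T) (y : ℝ) : K → SignType :=
  fun g => SignType.sign (polyVal ev g.1 t y)

theorem cellMap_eq_iff {K : Finset A[X]} {s t : T} {z y : ℝ} :
    cellMap ev K s z = cellMap ev K t y ↔ SameSign ev K s z t y :=
  ⟨fun h g hg => congrFun h ⟨g, hg⟩, fun h => funext fun g => h g.1 g.2⟩

theorem ordConnected_cellMap {K : Finset A[X]} (hK : ∀ f ∈ K, derivative f ∈ K) (t : T)
    (m : K → SignType) : (cellMap ev K t ⁻¹' {m}).OrdConnected := by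
  refine ⟨fun x hx z hz w hw => ?_⟩
  exact (cellMap_eq_iff.2 (sameSign_of_mem_Icc hK (cellMap_eq_iff.1
    ((show _ = m from hx).trans (show _ = m from hz).symm)) hw)).trans hx

/-- The cell is an interval contained in the root set of a nonzero polynomial, hence a single point.
Special cells are thus the point cells; `isOpen_cell` shows that the others are open. -/
theorem sameSign_special_unique {K : Finset A[X]} (hK : ∀ f ∈ K, derivative f ∈ K) {t : T}
    {y₁ y₂ : ℝ} (h : IsSpecial ev K t y₁) (h' : SameSign ev K t y₁ t y₂) : y₁ = y₂ := by
  obtain ⟨g, hg, hg0, hgy⟩ := h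
  by_contra hne
  have hinf : {x | SameSign ev K t x t y₁}.Infinite := by
    have hc := ordConnected_sameSign (ev := ev) hK t t y₁
    have hsub : uIcc y₁ y₂ ⊆ {x | SameSign ev K t x t y₁} :=
      hc.uIcc_subset (fun _ _ => rfl) h'.symm
    exact (Icc_infinite (inf_lt_sup.2 hne)).mono hsub
  apply hinf
  refine (finite_setOfPred_isRoot hg0).subset fun x hx => ?_
  have := hx g hg
  rw [hgy, sign_zero, sign_eq_zero_iff] at this
  exact this

theorem IsSpecial.congr {C : Set T} {K : Finset A[X]}
    (hnull : ∀ g ∈ K, ∀ s ∈ C, ∀ t ∈ C, g.map (ev s) = 0 → g.map (ev t) = 0)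
    {s t : T} (hs : s ∈ C) (ht : t ∈ C) {z y : ℝ} (h : SameSign ev K s z t y)
    (hsp : IsSpecial ev K t y) : IsSpecial ev K s z := by
  obtain ⟨g, hg, hg0, hgy⟩ := hsp
  refine ⟨g, hg, fun h => hg0 (hnull g hg s hs t ht h), ?_⟩
  have := h g hg
  rwa [hgy, sign_zero, sign_eq_zero_iff] at this

theorem isOpen_cell (hev : ∀ a, Continuous fun t => ev t a) {C : Set T} {K : Finset A[X]}
    (hnull : ∀ g ∈ K, ∀ s ∈ C, ∀ t ∈ C, g.map (ev s) = 0 → g.map (ev t) = 0)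
    {s t : T} (hs : s ∈ C) (ht : t ∈ C) {y : ℝ} (hy : ¬ IsSpecial ev K t y) :
    IsOpen {z | SameSign ev K s z t y} := by
  rw [isOpen_iff_mem_nhds]
  intro z hz
  have h := eventually_sameSign hev hnull hs (y := z) fun h => hy (h.congr hnull ht hs
    (SameSign.symm hz))
  have h' := h.curry
  have h'' := h'.self_of_nhdsWithin hs
  filter_upwards [h''] with x hx
  exact SameSign.trans hx hz

/-- The sign change statement behind `IsStructured.insert`, for an increasing polynomial. -/
theorem IsStructured.transfer (hev : ∀ a, Continuous fun t => ev t a) {C : Set T}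
    (hC : IsPreconnected C) {K : Finset A[X]} (hK : ∀ f ∈ K, derivative f ∈ K)
    (hKC : IsStructured ev C K)
    (hnull : ∀ g ∈ K, ∀ s ∈ C, ∀ t ∈ C, g.map (ev s) = 0 → g.map (ev t) = 0)
    {f : A[X]} {s t : T} (hs : s ∈ C) (ht : t ∈ C)
    (hsp : ∀ y z, IsSpecial ev K t y → SameSign ev K s z t y →
      SignType.sign (polyVal ev f s z) = SignType.sign (polyVal ev f t y))
    {y : ℝ} (hy : ¬ IsSpecial ev K t y)
    (hpt : ∀ z, SameSign ev K t z t y → 0 < polyVal ev (derivative f) t z)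
    (hps : ∀ z, SameSign ev K s z t y → 0 < polyVal ev (derivative f) s z) :
    (0 < polyVal ev f t y → ∃ z, SameSign ev K s z t y ∧ 0 < polyVal ev f s z) ∧
    (polyVal ev f t y < 0 → ∃ z, SameSign ev K s z t y ∧ polyVal ev f s z < 0) := by
  classical
  -- The sign vectors of the point cells over `t`.
  let S : Set (K → SignType) := {m | ∃ y, cellMap ev K t y = m ∧ IsSpecial ev K t y}
  have hl : cellMap ev K t y ∉ S := by
    rintro ⟨x, hx, hx'⟩
    exact hy (hx'.congr hnull ht ht (cellMap_eq_iff.1 hx.symm))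
  have hS : ∀ y₁ y₂, cellMap ev K t y₁ ∈ S → cellMap ev K t y₁ = cellMap ev K t y₂ → y₁ = y₂ := by
    rintro y₁ y₂ ⟨x, hx, hx'⟩ h
    exact sameSign_special_unique hK (hx'.congr hnull ht ht (cellMap_eq_iff.1 hx.symm))
      (cellMap_eq_iff.1 h)
  have ho : ∀ u ∈ C, ∀ m ∉ S, IsOpen (cellMap ev K u ⁻¹' {m}) := by
    intro u hu m hm
    rcases (cellMap ev K u ⁻¹' {m}).eq_empty_or_nonempty with h | ⟨x, hx⟩
    · rw [h]; exact isOpen_empty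
    · obtain ⟨w, hw⟩ := hKC.surj u hu x t ht
      have hw' := cellMap_eq_iff.2 hw
      have hwm : cellMap ev K t w = m := hw'.trans hx
      have : cellMap ev K u ⁻¹' {m} = {z | SameSign ev K u z t w} := by
        ext z
        rw [mem_preimage, mem_singleton_iff, ← hwm, cellMap_eq_iff]
        rfl
      rw [this]
      exact isOpen_cell hev hnull hu ht fun h => hm ⟨w, hwm, h⟩
  have hr : ∀ y, ∃ z, cellMap ev K s z = cellMap ev K t y := fun y =>
    (hKC.surj t ht y s hs).imp fun z hz => cellMap_eq_iff.2 hz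
  have hr' : ∀ y, ∃ z, cellMap ev K t z = cellMap ev K s y := fun y =>
    (hKC.surj s hs y t ht).imp fun z hz => cellMap_eq_iff.2 hz
  have hord : ∀ y₁ y₂ z₁ z₂, cellMap ev K t y₁ ≠ cellMap ev K t y₂ →
      cellMap ev K s z₁ = cellMap ev K t y₁ → cellMap ev K s z₂ = cellMap ev K t y₂ →
      y₁ < y₂ → z₁ < z₂ := by
    intro y₁ y₂ z₁ z₂ h h1 h2 h3
    exact hKC.lt_of_lt hC hK hs ht (fun h' => h (cellMap_eq_iff.2 h')) (cellMap_eq_iff.1 h1)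
      (cellMap_eq_iff.1 h2) h3
  have hsS : ∀ y z, cellMap ev K s z = cellMap ev K t y → cellMap ev K t y ∈ S →
      SignType.sign (polyVal ev f s z) = SignType.sign (polyVal ev f t y) := by
    rintro y z h ⟨x, hx, hx'⟩
    exact hsp y z (hx'.congr hnull ht ht (cellMap_eq_iff.1 hx.symm)) (cellMap_eq_iff.1 h)
  have hmt : MonotoneOn (polyVal ev f t) (cellMap ev K t ⁻¹' {cellMap ev K t y}) :=
    monotoneOn_polyVal (ordConnected_cellMap hK t _) fun z hz => (hpt z (cellMap_eq_iff.1 hz)).le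
  have hms : MonotoneOn (polyVal ev f s) (cellMap ev K s ⁻¹' {cellMap ev K t y}) :=
    monotoneOn_polyVal (ordConnected_cellMap hK s _) fun z hz => (hps z (cellMap_eq_iff.1 hz)).le
  obtain ⟨z₀, hz₀⟩ := hr y
  -- For unbounded cells: they contain a half-line on which `f` is monotone and not constant, so `f`
  -- takes the required sign far out.
  have hd : derivative (f.map (ev s)) ≠ 0 := by
    intro h
    have := hps z₀ (cellMap_eq_iff.1 hz₀)
    rw [polyVal, ← derivative_map, h] at this
    simp at this
  constructor
  · intro hpos
    obtain ⟨z, hz, hz'⟩ := exists_pos_of_cells (ordConnected_cellMap hK t)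
      hr hr' hord hS (ho t ht) (ho s hs) (continuous_polyVal_right f t)
      (continuous_polyVal_right f s) hsS hl hmt (fun hb => by
        have hsub : Ici z₀ ⊆ cellMap ev K s ⁻¹' {cellMap ev K t y} := by
          intro w hw
          obtain ⟨v, hv, hv'⟩ := not_bddAbove_iff.1 hb w
          exact (ordConnected_cellMap hK s _).out hz₀ hv ⟨hw, hv'.le⟩
        obtain ⟨z, hz, hz'⟩ := exists_pos_of_monotoneOn_Ici hd (hms.mono hsub)
        exact ⟨z, hsub hz, hz'⟩) rfl hpos
    exact ⟨z, cellMap_eq_iff.1 hz, hz'⟩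
  · intro hneg
    obtain ⟨z, hz, hz'⟩ := exists_neg_of_cells (ordConnected_cellMap hK t)
      hr hr' hord hS (ho t ht) (ho s hs) (continuous_polyVal_right f t)
      (continuous_polyVal_right f s) hsS hl hmt (fun hb => by
        have hsub : Iic z₀ ⊆ cellMap ev K s ⁻¹' {cellMap ev K t y} := by
          intro w hw
          obtain ⟨v, hv, hv'⟩ := not_bddBelow_iff.1 hb w
          exact (ordConnected_cellMap hK s _).out hv hz₀ ⟨hv'.le, hw⟩
        obtain ⟨z, hz, hz'⟩ := exists_neg_of_monotoneOn_Iic hd (hms.mono hsub)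
        exact ⟨z, hsub hz, hz'⟩) rfl hneg
    exact ⟨z, cellMap_eq_iff.1 hz, hz'⟩

end Base

section Base

variable {T : Type*} [TopologicalSpace T] {A : Type*} [CommRing A] {ev : T → A →+* ℝ}

/-- On an open cell of `K` the derivative of `f` has constant sign. If it is nonzero, `f` is
strictly monotone on the fibres, and the signs it takes there are governed by its signs at the end
points, which are special, or by its growth at infinity. The larger family `F'` serves only to make
the sign of `f` at special points independent of the base point, as `hsp` requires. -/
theorem IsStructured.insert (hev : ∀ a, Continuous fun t => ev t a) {C : Set T}
    (hC : IsPreconnected C) {K : Finset A[X]} (hK : ∀ f ∈ K, derivative f ∈ K)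
    (hKC : IsStructured ev C K)
    (hnull : ∀ g ∈ K, ∀ s ∈ C, ∀ t ∈ C, g.map (ev s) = 0 → g.map (ev t) = 0)
    {F' : Finset A[X]} (hF' : IsStructured ev C F') (hKF' : K ⊆ F')
    {f : A[X]} (hf : derivative f ∈ K) (hlc : ∀ t ∈ C, ev t f.leadingCoeff ≠ 0)
    (hlc' : ∀ s ∈ C, ∀ t ∈ C,
      SignType.sign (ev s f.leadingCoeff) = SignType.sign (ev t f.leadingCoeff))
    (hsp : ∀ s ∈ C, ∀ t ∈ C, ∀ y z, IsSpecial ev K t y → SameSign ev F' s z t y →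
      SignType.sign (polyVal ev f s z) = SignType.sign (polyVal ev f t y))
    {F : Finset A[X]} (hF : ∀ g ∈ F, g = f ∨ g ∈ K) : IsStructured ev C F := by
  have hmk : ∀ {s t z y}, SameSign ev K s z t y →
      SignType.sign (polyVal ev f s z) = SignType.sign (polyVal ev f t y) →
      SameSign ev F s z t y := by
    intro s t z y h h' g hg
    rcases hF g hg with rfl | hg
    exacts [h', h g hg]
  -- if the derivative vanishes over `C`, then so `f` is constant on the fibres
  have hconst : ∀ t ∈ C, (derivative f).map (ev t) = 0 → ∀ s ∈ C, ∀ z,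
      polyVal ev f s z = ev s f.leadingCoeff := by
    intro t ht h s hs z
    have h1 := hnull _ hf t ht s hs h
    rw [← derivative_map] at h1
    have h2 := derivative_eq_zero.1 h1
    have h3 := natDegree_map_of_leadingCoeff_ne_zero (ev s) (hlc s hs)
    have h4 := eq_C_of_natDegree_eq_zero h2
    rw [polyVal, h4, eval_C, coeff_map, leadingCoeff, ← h3, h2]
  constructor
  · intro t ht y V hV
    by_cases hy : IsSpecial ev K t y
    · filter_upwards [hF'.isOpen t ht y V hV, self_mem_nhdsWithin] with s ⟨z, hz, hz'⟩ hs
      exact ⟨z, hz, hmk (hz'.mono hKF') (hsp s hs t ht y z hy hz')⟩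
    · have hloc := eventually_sameSign hev hnull ht hy
      by_cases h0 : polyVal ev f t y = 0
      -- A zero of `f` in an open cell is a sign change because the derivative does not vanish
      -- there. The sign change persists over nearby `s`, and the intermediate value theorem gives a
      -- zero close to `y` in the same cell.
      · have hd : (derivative f).map (ev t) ≠ 0 := by
          intro h
          rw [hconst t ht h t ht y] at h0
          exact hlc t ht h0
        have hd' : polyVal ev (derivative f) t y ≠ 0 := fun h => hy ⟨_, hf, hd, h⟩
        obtain ⟨N, hN, N', hN', hNN'⟩ := mem_prod_iff.1 hloc
        obtain ⟨a, b, hab, ha, hb⟩ := exists_sign_change (hasDerivAt_polyVal f t y) hd' h0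
          (inter_mem hV hN')
        have hca : Continuous fun s => polyVal ev f s a :=
          (continuous_polyVal hev f).comp (Continuous.prodMk_left a)
        have hcb : Continuous fun s => polyVal ev f s b :=
          (continuous_polyVal hev f).comp (Continuous.prodMk_left b)
        filter_upwards [hN, mem_nhdsWithin_of_mem_nhds (hca.continuousAt.eventually_lt_const ha),
          mem_nhdsWithin_of_mem_nhds (hcb.continuousAt.eventually_const_lt hb)] with s hs hsa hsb
        obtain ⟨z, hz, hz'⟩ := exists_eq_zero_of_uIcc (continuous_polyVal_right f s) hsa hsb
        exact ⟨z, (hab hz).1, hmk (hNN' (mk_mem_prod hs (hab hz).2)) (by rw [hz', h0])⟩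
      · have h2 := ((continuous_polyVal hev f).tendsto (t, y)).eventually (eventually_sign_eq h0)
        rw [nhds_prod_eq] at h2
        have h3 := h2.filter_mono (prod_mono (nhdsWithin_le_nhds (s := C)) le_rfl)
        filter_upwards [(hloc.and h3).curry] with s hs
        obtain ⟨h4, h5⟩ := hs.self_of_nhds
        exact ⟨y, mem_of_mem_nhds hV, hmk h4 h5⟩
  · intro t ht y s hs
    by_cases hy : IsSpecial ev K t y
    · obtain ⟨z, hz⟩ := hF'.surj t ht y s hs
      exact ⟨z, hmk (hz.mono hKF') (hsp s hs t ht y z hy hz)⟩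
    obtain ⟨z₀, hz₀⟩ := hKC.surj t ht y s hs
    by_cases hd : (derivative f).map (ev t) = 0
    · refine ⟨z₀, hmk hz₀ ?_⟩
      rw [hconst t ht hd s hs, hconst t ht hd t ht]
      exact hlc' s hs t ht
    have hd' : polyVal ev (derivative f) t y ≠ 0 := fun h => hy ⟨_, hf, hd, h⟩
    -- Since a special cell of `K` over `s` is a single point, `F'` cannot split it, so equality of
    -- the signs of `K` already suffices.
    have hsp' : ∀ y z, IsSpecial ev K t y → SameSign ev K s z t y →
        SignType.sign (polyVal ev f s z) = SignType.sign (polyVal ev f t y) := by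
      intro y z hy h
      obtain ⟨z', hz'⟩ := hF'.surj t ht y s hs
      have hz'' := hz'.mono hKF'
      rw [sameSign_special_unique hK (hy.congr hnull hs ht h) (h.trans hz''.symm)]
      exact hsp s hs t ht y z' hy hz'
    have hcell : ∀ {x}, SameSign ev K t x t y →
        (0 < polyVal ev f t x → ∃ z, SameSign ev K s z t y ∧ 0 < polyVal ev f s z) ∧
        (polyVal ev f t x < 0 → ∃ z, SameSign ev K s z t y ∧ polyVal ev f s z < 0) := by
      intro x hx
      have hx' : ¬ IsSpecial ev K t x := fun h => hy (h.congr hnull ht ht hx.symm)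
      have hdx : polyVal ev (derivative f) t x ≠ 0 := fun h => hx' ⟨_, hf, hd, h⟩
      rcases hdx.lt_or_gt with hneg | hpos
      · have hv : ∀ (g : A[X]) u x, polyVal ev (-g) u x = -polyVal ev g u x := fun g u x => by
          simp [polyVal]
        have hpos : ∀ u z, SameSign ev K u z t x → 0 < polyVal ev (derivative (-f)) u z := by
          intro u z h
          have := h _ hf
          rw [sign_neg hneg, sign_eq_neg_one_iff] at this
          rw [derivative_neg, hv]
          linarith
        have := IsStructured.transfer hev hC hK hKC hnull (f := -f) hs ht
          (fun y z h1 h2 => by rw [hv, hv, Left.sign_neg, Left.sign_neg, hsp' y z h1 h2]) hx'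
          (hpos t) (hpos s)
        simp only [hv, neg_pos, neg_lt_zero] at this
        exact ⟨fun h => (this.2 h).imp fun z hz => ⟨hz.1.trans hx, hz.2⟩,
          fun h => (this.1 h).imp fun z hz => ⟨hz.1.trans hx, hz.2⟩⟩
      · have hpos : ∀ u z, SameSign ev K u z t x → 0 < polyVal ev (derivative f) u z := by
          intro u z h
          have := h _ hf
          rwa [sign_pos hpos, sign_eq_one_iff] at this
        have := IsStructured.transfer hev hC hK hKC hnull hs ht hsp' hx' (hpos t) (hpos s)
        exact ⟨fun h => (this.1 h).imp fun z hz => ⟨hz.1.trans hx, hz.2⟩,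
          fun h => (this.2 h).imp fun z hz => ⟨hz.1.trans hx, hz.2⟩⟩
    have htrans := hcell (x := y) fun _ _ => rfl
    rcases lt_trichotomy (polyVal ev f t y) 0 with h | h | h
    · obtain ⟨z, hz, hz'⟩ := htrans.2 h
      exact ⟨z, hmk hz (by rw [sign_neg h, sign_neg hz'])⟩
    · -- both signs occur in the cell over `t`, so over `s`
      obtain ⟨a, b, hab, ha, hb⟩ := exists_sign_change (hasDerivAt_polyVal f t y) hd' h
        ((isOpen_cell hev hnull ht ht hy).mem_nhds fun _ _ => rfl)
      obtain ⟨z₁, hz₁, hz₁'⟩ := (hcell (hab left_mem_uIcc)).2 ha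
      obtain ⟨z₂, hz₂, hz₂'⟩ := (hcell (hab right_mem_uIcc)).1 hb
      obtain ⟨z, hz, hz'⟩ := exists_eq_zero_of_uIcc (continuous_polyVal_right f s) hz₁' hz₂'
      exact ⟨z, hmk ((ordConnected_sameSign hK s t y).uIcc_subset hz₁ hz₂ hz) (by rw [hz', h])⟩
    · obtain ⟨z, hz, hz'⟩ := htrans.1 h
      exact ⟨z, hmk hz (by rw [sign_pos h, sign_pos hz'])⟩

end Base

/-! ### Pseudo-division and Łojasiewicz's induction -/

section Base

variable {T : Type*} [TopologicalSpace T] {A : Type*} [CommRing A] {ev : T → A →+* ℝ}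

open Classical in
/-- All iterated derivatives of the polynomials in `F`. -/
noncomputable def derivClosure (F : Finset A[X]) : Finset A[X] :=
  -- The order goes up to `natDegree + 1`, so that `0` is included and the set is closed under
  -- derivation.
  F.biUnion fun f => (Finset.range (f.natDegree + 2)).image fun k => derivative^[k] f

theorem mem_derivClosure {F : Finset A[X]} {f : A[X]} :
    f ∈ derivClosure F ↔ ∃ g ∈ F, ∃ k < g.natDegree + 2, derivative^[k] g = f := by
  simp [derivClosure]

theorem subset_derivClosure (F : Finset A[X]) : F ⊆ derivClosure F := fun f hf =>
  mem_derivClosure.2 ⟨f, hf, 0, by omega, rfl⟩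

theorem derivative_mem_derivClosure {F : Finset A[X]} :
    ∀ f ∈ derivClosure F, derivative f ∈ derivClosure F := by
  intro f hf
  obtain ⟨g, hg, k, hk, rfl⟩ := mem_derivClosure.1 hf
  rw [mem_derivClosure]
  by_cases h : k < g.natDegree + 1
  · exact ⟨g, hg, k + 1, by omega, Function.iterate_succ_apply' _ _ _⟩
  · refine ⟨g, hg, k, hk, ?_⟩
    have : k = g.natDegree + 1 := by omega
    rw [this, iterate_derivative_eq_zero (Nat.lt_succ_self _), derivative_zero]

theorem degree_lt_of_mem_derivClosure {F : Finset A[X]} {d : WithBot ℕ}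
    (hF : ∀ f ∈ F, f.degree < d) : ∀ f ∈ derivClosure F, f.degree < d := by
  intro f hf
  obtain ⟨g, hg, k, hk, rfl⟩ := mem_derivClosure.1 hf
  refine lt_of_le_of_lt ?_ (hF g hg)
  clear hk hf
  induction k with
  | zero => exact le_rfl
  | succ k ih =>
    rw [Function.iterate_succ_apply']
    exact (degree_derivative_le).trans ih

/-- The terms of degree at most `j` of `g`. -/
noncomputable def truncLE (g : A[X]) (j : ℕ) : A[X] :=
  ∑ i ∈ Finset.range (j + 1), monomial i (g.coeff i)

theorem coeff_truncLE (g : A[X]) (j m : ℕ) :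
    (truncLE g j).coeff m = if m ≤ j then g.coeff m else 0 := by
  simp only [truncLE, finsetSum_coeff, coeff_monomial, Finset.sum_ite_eq', Finset.mem_range]
  simp only [Nat.lt_succ_iff]

/-- One step of the pseudo-division of `f` by the truncation of `g`. -/
noncomputable def pseudoStep (f g : A[X]) (j : ℕ) : A[X] :=
  C (g.coeff j) * f - C f.leadingCoeff * (truncLE g j * X ^ (f.natDegree - j))

/-- Both terms have the same coefficient in degree `f.natDegree`, the product of `g.coeff j` and the
leading coefficient of `f`, and none above it. -/
theorem degree_pseudoStep_lt (f g : A[X]) {j : ℕ} (hj : j ≤ f.natDegree) :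
    (pseudoStep f g j).degree < (f.natDegree : WithBot ℕ) := by
  rw [degree_lt_iff_coeff_zero]
  intro m hm
  simp only [pseudoStep, coeff_sub, coeff_C_mul, coeff_mul_X_pow']
  rw [if_pos (by omega), coeff_truncLE]
  rcases hm.eq_or_lt with rfl | hm
  · rw [if_pos (by omega), Nat.sub_sub_self hj, leadingCoeff]
    ring
  · rw [if_neg (by omega), coeff_eq_zero_of_natDegree_lt hm]
    ring

/-- When the actual degree of `g` over `t` is at most `j`, truncation does not change `g` there. At
a zero of `g` the sign of the remainder therefore determines that of `f`, up to the known sign of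
`g.coeff j`; a single division step is enough. -/
theorem polyVal_pseudoStep (f : A[X]) {g : A[X]} {j : ℕ} {t : T} {y : ℝ}
    (h : ∀ m, j < m → ev t (g.coeff m) = 0) (hg : polyVal ev g t y = 0) :
    polyVal ev (pseudoStep f g j) t y = ev t (g.coeff j) * polyVal ev f t y := by
  have h1 : (truncLE g j).map (ev t) = g.map (ev t) := by
    ext m
    rw [coeff_map, coeff_map, coeff_truncLE]
    split_ifs with hm
    · rfl
    · rw [h m (not_le.1 hm), map_zero]
  have h2 : (g.map (ev t)).eval y = 0 := hg
  simp [polyVal, pseudoStep, h1, h2]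

theorem map_eq_zero_of_signInvariant {E : Finset A} {C : Set T} (hE : SignInvariant ev E C)
    {g : A[X]} (hg : g.coeffs ⊆ E) {s t : T} (hs : s ∈ C) (ht : t ∈ C)
    {m : ℕ} (h : ev s (g.coeff m) = 0) : ev t (g.coeff m) = 0 := by
  by_cases h0 : g.coeff m = 0
  · rw [h0, map_zero]
  · exact (hE.eq_zero_iff (hg (coeff_mem_coeffs h0)) hs ht).1 h

theorem isStructured_of_eq_zero {C : Set T} {F : Finset A[X]} (hF : ∀ f ∈ F, f = 0) :
    IsStructured ev C F where
  isOpen t _ y V hV := .of_forall fun s => ⟨y, mem_of_mem_nhds hV, fun f hf => by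
    simp [hF f hf, polyVal]⟩
  surj t _ y s _ := ⟨y, fun f hf => by simp [hF f hf, polyVal]⟩

/-- Łojasiewicz: a finite family of polynomials is structured over every connected set on which
finitely many functions have constant signs. -/
theorem exists_isStructured (hev : ∀ a, Continuous fun t => ev t a) {F : Finset A[X]}
    (hF : ∀ f ∈ F, derivative f ∈ F) : ∃ E : Finset A, ∀ C : Set T, IsPreconnected C →
      SignInvariant ev E C → IsStructured ev C F := by
  classical
  -- Double induction: on a strict bound for the degrees, and within it on the number of polynomials
  -- of the top degree. One polynomial `f` of top degree is traded for any number of polynomials of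
  -- smaller degree.
  have main : ∀ d : ℕ, ∀ F : Finset A[X], (∀ f ∈ F, derivative f ∈ F) →
      (∀ f ∈ F, f.degree < d) → ∃ E : Finset A, ∀ C : Set T, IsPreconnected C →
      SignInvariant ev E C → IsStructured ev C F := by
    intro d
    induction d with
    | zero =>
      intro F _ hF
      exact ⟨∅, fun C _ _ => isStructured_of_eq_zero fun f hf => by
        have := hF f hf
        rw [degree_lt_iff_coeff_zero] at this
        ext m
        exact this m (Nat.zero_le m)⟩
    | succ d ihd =>
      have inner : ∀ k, ∀ F : Finset A[X], (∀ f ∈ F, derivative f ∈ F) →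
          (∀ f ∈ F, f.degree < (d + 1 : ℕ)) →
          (F.filter fun f : A[X] => f.degree = (d : WithBot ℕ)).card ≤ k →
          ∃ E : Finset A, ∀ C : Set T, IsPreconnected C →
          SignInvariant ev E C → IsStructured ev C F := by
        intro k
        induction k with
        | zero =>
          intro F hF hd hk
          refine ihd F hF fun f hf => ?_
          rw [Nat.le_zero, Finset.card_eq_zero, Finset.filter_eq_empty_iff] at hk
          have h1 := hd f hf
          rw [degree_lt_iff_coeff_zero] at h1
          exact lt_of_le_of_ne ((degree_le_iff_coeff_zero _ _).2 fun m hm =>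
            h1 m (by exact_mod_cast hm)) (hk hf)
        | succ k ihk =>
          intro F hF hd hk
          by_cases hk0 : (F.filter fun f : A[X] => f.degree = (d : WithBot ℕ)).card ≤ k
          · exact ihk F hF hd hk0
          have hne : (F.filter fun f : A[X] => f.degree = (d : WithBot ℕ)).Nonempty := by
            rw [← Finset.card_pos]; omega
          obtain ⟨f, hf⟩ := hne
          obtain ⟨hfF, hfd⟩ := Finset.mem_filter.1 hf
          have hf0 : f ≠ 0 := by rintro rfl; simp at hfd
          have hfn : f.natDegree = d := natDegree_eq_of_degree_eq_some hfd
          set K := F.erase f with hKdef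
          have hle : ∀ g ∈ F, g.natDegree ≤ d := fun g hg => by
            have := hd g hg
            rw [degree_lt_iff_coeff_zero] at this
            exact natDegree_le_iff_coeff_eq_zero.2 fun m hm => this m hm
          have hder : ∀ g ∈ F, derivative g ∈ K := by
            intro g hg
            refine Finset.mem_erase.2 ⟨?_, hF g hg⟩
            intro h
            by_cases hg0 : g = 0
            · rw [hg0, derivative_zero] at h
              exact hf0 h.symm
            · have h1 := degree_derivative_lt hg0
              rw [h, hfd, degree_eq_natDegree hg0] at h1
              exact absurd (hle g hg) (not_le.2 (by exact_mod_cast h1))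
          have hK : ∀ g ∈ K, derivative g ∈ K := fun g hg => hder g (Finset.mem_of_mem_erase hg)
          -- adding polynomials of smaller degree to `K`
          have hadd : ∀ R : Finset A[X], (∀ g ∈ R, g.degree < d) →
              ∃ E : Finset A, ∀ C : Set T, IsPreconnected C →
              SignInvariant ev E C → IsStructured ev C (K ∪ derivClosure R) := by
            intro R hR
            have hR' := degree_lt_of_mem_derivClosure hR
            refine ihk _ ?_ ?_ ?_
            · intro g hg
              rcases Finset.mem_union.1 hg with hg | hg
              · exact Finset.mem_union_left _ (hK g hg)
              · exact Finset.mem_union_right _ (derivative_mem_derivClosure g hg)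
            · intro g hg
              rcases Finset.mem_union.1 hg with hg | hg
              · exact hd g (Finset.mem_of_mem_erase hg)
              · exact (hR' g hg).trans (by exact_mod_cast Nat.lt_succ_self d)
            · have hsub : ((K ∪ derivClosure R).filter fun g : A[X] => g.degree = (d : WithBot ℕ)) ⊆
                  (F.filter fun g : A[X] => g.degree = (d : WithBot ℕ)).erase f := by
                intro g hg
                obtain ⟨hg, hgd⟩ := Finset.mem_filter.1 hg
                rcases Finset.mem_union.1 hg with hg | hg
                · exact Finset.mem_erase.2 ⟨Finset.ne_of_mem_erase hg,
                    Finset.mem_filter.2 ⟨Finset.mem_of_mem_erase hg, hgd⟩⟩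
                · exact absurd hgd (hR' g hg).ne
              have := Finset.card_le_card hsub
              rw [Finset.card_erase_of_mem hf] at this
              omega
          -- For the case that the leading coefficient of `f` has no zero on `C`: the remainders of
          -- `f` modulo all truncations of members of `K` control the sign of `f` at special points.
          obtain ⟨E₁, hE₁⟩ := hadd
            (K.biUnion fun g => (Finset.range (d + 1)).image fun j => pseudoStep f g j) (by
              intro g hg
              simp only [Finset.mem_biUnion, Finset.mem_image, Finset.mem_range] at hg
              obtain ⟨g', _, j, hj, rfl⟩ := hg
              rw [← hfn]
              exact degree_pseudoStep_lt f g' (by omega))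
          -- For the case that the leading coefficient of `f` vanishes somewhere, hence everywhere,
          -- on `C`: there `f` agrees with `f.eraseLead`.
          obtain ⟨E₂, hE₂⟩ := hadd {f.eraseLead} (by
            intro g hg
            rw [Finset.mem_singleton] at hg
            rw [hg, ← hfd]
            exact degree_eraseLead_lt hf0)
          refine ⟨(F.biUnion fun g => g.coeffs) ∪ (E₁ ∪ E₂), fun C hC hE => ?_⟩
          have hEc := hE.mono (Finset.subset_union_left)
          have hcoef : ∀ g ∈ F, g.coeffs ⊆ F.biUnion fun g => g.coeffs := fun g hg =>
            Finset.subset_biUnion_of_mem (fun g : A[X] => g.coeffs) hg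
          have hcz : ∀ g ∈ F, ∀ s ∈ C, ∀ t ∈ C, ∀ m, ev s (g.coeff m) = 0 → ev t (g.coeff m) = 0 :=
            fun g hg s hs t ht m h => map_eq_zero_of_signInvariant hEc (hcoef g hg) hs ht h
          have hS₁ := hE₁ C hC ((hE.mono Finset.subset_union_right).mono Finset.subset_union_left)
          have hS₂ := hE₂ C hC ((hE.mono Finset.subset_union_right).mono Finset.subset_union_right)
          by_cases hlead : ∃ t ∈ C, ev t f.leadingCoeff = 0
          · obtain ⟨t₀, ht₀, h0⟩ := hlead
            have hl0 : ∀ t ∈ C, ev t f.leadingCoeff = 0 := fun t ht => hcz f hfF t₀ ht₀ t ht _ h0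
            have hval : ∀ t ∈ C, ∀ y, polyVal ev f t y = polyVal ev f.eraseLead t y := by
              intro t ht y
              have : f.map (ev t) = f.eraseLead.map (ev t) :=
                calc f.map (ev t)
                    = (f.eraseLead + monomial f.natDegree f.leadingCoeff).map (ev t) := by
                      rw [eraseLead_add_monomial_natDegree_leadingCoeff]
                  _ = _ := by
                      rw [Polynomial.map_add, map_monomial, hl0 t ht, monomial_zero_right, add_zero]
              rw [polyVal, this, polyVal]
            have htr : ∀ s ∈ C, ∀ t ∈ C, ∀ z y,
                SameSign ev (K ∪ derivClosure {f.eraseLead}) s z t y → SameSign ev F s z t y := by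
              intro s hs t ht z y h g hg
              by_cases hgf : g = f
              · rw [hgf, hval s hs, hval t ht]
                exact h _ (Finset.mem_union_right _ (subset_derivClosure _ (by simp)))
              · exact h g (Finset.mem_union_left _ (Finset.mem_erase.2 ⟨hgf, hg⟩))
            constructor
            · intro t ht y V hV
              filter_upwards [hS₂.isOpen t ht y V hV, self_mem_nhdsWithin] with s ⟨z, hz, hz'⟩ hs
              exact ⟨z, hz, htr s hs t ht z y hz'⟩
            · intro t ht y s hs
              exact (hS₂.surj t ht y s hs).imp fun z hz => htr s hs t ht z y hz
          · push Not at hlead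
            refine IsStructured.insert hev hC hK (hS₁.mono Finset.subset_union_left) ?_ hS₁
              Finset.subset_union_left (hder f hfF) hlead ?_ ?_ (F := F) ?_
            · intro g hg s hs t ht h
              ext m
              have := congrArg (fun p => p.coeff m) h
              simp only [coeff_map, coeff_zero] at this ⊢
              exact hcz g (Finset.mem_of_mem_erase hg) s hs t ht m this
            · exact hEc _ (hcoef f hfF (coeff_mem_coeffs (leadingCoeff_ne_zero.2 hf0)))
            · rintro s hs t ht y z ⟨g, hg, hg0, hgy⟩ h
              have hgF := Finset.mem_of_mem_erase hg
              -- The actual degree of `g` over `t`; as the vanishing of coefficients is constant on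
              -- `C`, the coefficients beyond `j` vanish over `s` as well.
              set j := (g.map (ev t)).natDegree with hj
              have hjd : j ≤ d := (natDegree_map_le).trans (hle g hgF)
              have hjt : ∀ m, j < m → ev t (g.coeff m) = 0 := fun m hm => by
                rw [← coeff_map]; exact coeff_eq_zero_of_natDegree_lt hm
              have hjs : ∀ m, j < m → ev s (g.coeff m) = 0 := fun m hm =>
                hcz g hgF t ht s hs m (hjt m hm)
              have hjn : ev t (g.coeff j) ≠ 0 := by
                rw [← coeff_map]; exact leadingCoeff_ne_zero.2 hg0
              have hgz : polyVal ev g s z = 0 := by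
                have := h g (Finset.mem_union_left _ hg)
                rwa [hgy, sign_zero, sign_eq_zero_iff] at this
              have hred := h (pseudoStep f g j) (Finset.mem_union_right _ (subset_derivClosure _ (by
                simp only [Finset.mem_biUnion, Finset.mem_image, Finset.mem_range]
                exact ⟨g, hg, j, by omega, rfl⟩)))
              rw [polyVal_pseudoStep f hjt hgy, polyVal_pseudoStep f hjs hgz, sign_mul, sign_mul] at hred
              have hc : SignType.sign (ev s (g.coeff j)) = SignType.sign (ev t (g.coeff j)) :=
                hEc _ (hcoef g hgF (coeff_mem_coeffs (by
                  intro h0; rw [h0, map_zero] at hjn; exact hjn rfl))) s hs t ht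
              rw [hc] at hred
              exact mul_left_cancel₀ (fun h0 => hjn (sign_eq_zero_iff.1 h0)) hred
            · intro g hg
              by_cases hgf : g = f
              · exact .inl hgf
              · exact .inr (Finset.mem_erase.2 ⟨hgf, hg⟩)
      intro F hF hd
      exact inner _ F hF hd le_rfl
  refine main (F.sup natDegree + 1) F hF fun f hf => ?_
  refine lt_of_le_of_lt degree_le_natDegree ?_
  exact_mod_cast Nat.lt_succ_of_le (Finset.le_sup (f := natDegree) hf)

end Base

/-- A family of nonempty connected sets that varies openly over a connected base has a connected
total space. -/
theorem isPreconnected_total {Y Z : Type*} [TopologicalSpace Y] [TopologicalSpace Z] {B : Set Y}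
    {S : Y → Set Z} (hB : IsPreconnected B) (hS : ∀ b ∈ B, IsPreconnected (S b))
    (hne : ∀ b ∈ B, (S b).Nonempty)
    (ho : ∀ b ∈ B, ∀ z ∈ S b, ∀ V ∈ 𝓝 z, ∀ᶠ b' in 𝓝[B] b, ∃ z' ∈ V, z' ∈ S b') :
    IsPreconnected {x : Y × Z | x.1 ∈ B ∧ x.2 ∈ S x.1} := by
  rw [isPreconnected_iff_subset_of_disjoint]
  intro u v hu hv hsub hdis
  -- A connected fibre lies in one of the two open sets. Which one is locally constant in `b`,
  -- because nearby fibres contain points near any given point of the fibre over `b`.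
  have hor : ∀ b ∈ B, (∀ z ∈ S b, (b, z) ∈ u) ∨ (∀ z ∈ S b, (b, z) ∈ v) := by
    intro b hb
    have h1 : IsPreconnected ((fun z => (b, z)) '' S b) :=
      (hS b hb).image _ (Continuous.prodMk_right b).continuousOn
    have h2 : (fun z => (b, z)) '' S b ⊆ {x : Y × Z | x.1 ∈ B ∧ x.2 ∈ S x.1} := by
      rintro _ ⟨z, hz, rfl⟩
      exact ⟨hb, hz⟩
    rcases isPreconnected_iff_subset_of_disjoint.1 h1 u v hu hv (h2.trans hsub)
      (subset_empty_iff.1 (hdis ▸ inter_subset_inter_left _ h2)) with h | h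
    · exact .inl fun z hz => h ⟨z, hz, rfl⟩
    · exact .inr fun z hz => h ⟨z, hz, rfl⟩
  have hex : ∀ b ∈ B, ∀ z ∈ S b, (b, z) ∈ u → (b, z) ∈ v → False := by
    intro b hb z hz h1 h2
    have : (b, z) ∈ ({x : Y × Z | x.1 ∈ B ∧ x.2 ∈ S x.1} ∩ (u ∩ v)) := ⟨⟨hb, hz⟩, h1, h2⟩
    rwa [hdis] at this
  have hloc : ∀ {w w' : Set (Y × Z)}, IsOpen w →
      (∀ b ∈ B, (∀ z ∈ S b, (b, z) ∈ w) ∨ (∀ z ∈ S b, (b, z) ∈ w')) →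
      (∀ b ∈ B, ∀ z ∈ S b, (b, z) ∈ w → (b, z) ∈ w' → False) →
      ∀ b ∈ B, (∀ z ∈ S b, (b, z) ∈ w) → ∀ᶠ b' in 𝓝[B] b, ∀ z ∈ S b', (b', z) ∈ w := by
    intro w w' hw hor hex b hb h
    obtain ⟨z, hz⟩ := hne b hb
    obtain ⟨N, hN, V, hV, hNV⟩ := mem_nhds_prod_iff.1 (hw.mem_nhds (h z hz))
    filter_upwards [ho b hb z hz V hV, mem_nhdsWithin_of_mem_nhds hN, self_mem_nhdsWithin]
      with b' ⟨z', hz', hz''⟩ hb' hB'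
    rcases hor b' hB' with h | h
    · exact h
    · exact (hex b' hB' z' hz'' (hNV ⟨hb', hz'⟩) (h z' hz'')).elim
  have hPQ : ∀ b ∈ B, (∀ z ∈ S b, (b, z) ∈ u) → (∀ z ∈ S b, (b, z) ∈ v) → False := by
    intro b hb h1 h2
    obtain ⟨z, hz⟩ := hne b hb
    exact hex b hb z hz (h1 z hz) (h2 z hz)
  have hconst : ∀ b ∈ B, ∀ b' ∈ B, ((∀ z ∈ S b, (b, z) ∈ u) ↔ (∀ z ∈ S b', (b', z) ∈ u)) := by
    intro b hb b' hb'
    refine hB.induction₂ (fun b b' => ((∀ z ∈ S b, (b, z) ∈ u) ↔ (∀ z ∈ S b', (b', z) ∈ u)))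
      (fun b hb => ?_) (fun _ _ _ _ _ _ h1 h2 => h1.trans h2) (fun _ _ _ _ h => h.symm) hb hb'
    rcases hor b hb with h | h
    · filter_upwards [hloc hu hor hex b hb h] with b' h'
      exact ⟨fun _ => h', fun _ => h⟩
    · filter_upwards [hloc hv (fun b hb => (hor b hb).symm) (fun b hb z hz h1 h2 =>
        hex b hb z hz h2 h1) b hb h, self_mem_nhdsWithin] with b' h' hb'
      exact ⟨fun h1 => (hPQ b hb h1 h).elim, fun h1 => (hPQ b' hb' h1 h').elim⟩
  by_cases hP : ∃ b ∈ B, ∀ z ∈ S b, (b, z) ∈ u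
  · obtain ⟨b, hb, h⟩ := hP
    exact .inl fun x hx => (hconst b hb x.1 hx.1).1 h x.2 hx.2
  · push Not at hP
    refine .inr fun x hx => ?_
    rcases hor x.1 hx.1 with h | h
    · obtain ⟨z, hz, hz'⟩ := hP x.1 hx.1
      exact (hz' (h z hz)).elim
    · exact h x.2 hx.2

/-! ### Cylindrical decomposition in several variables -/

section Base

variable {T : Type*} {A : Type*} [CommRing A] {κ : Type*}

/-- The value at `(t, y)` of the polynomial `p` with coefficients in a ring of functions on `T`. -/
noncomputable def mvVal (ev : T → A →+* ℝ) (p : MvPolynomial κ A) (t : T) (y : κ → ℝ) : ℝ :=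
  MvPolynomial.eval₂Hom (ev t) y p

/-- The polynomials in `F` have the same signs at `(s, z)` and `(t, y)`. -/
def MvSameSign (ev : T → A →+* ℝ) (F : Finset (MvPolynomial κ A)) (s : T) (z : κ → ℝ) (t : T)
    (y : κ → ℝ) : Prop :=
  ∀ f ∈ F, SignType.sign (mvVal ev f s z) = SignType.sign (mvVal ev f t y)

variable {ev : T → A →+* ℝ}

theorem MvSameSign.symm {F : Finset (MvPolynomial κ A)} {s t : T} {z y : κ → ℝ}
    (h : MvSameSign ev F s z t y) : MvSameSign ev F t y s z := fun f hf => (h f hf).symm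

theorem MvSameSign.trans {F : Finset (MvPolynomial κ A)} {s t u : T} {z y x : κ → ℝ}
    (h : MvSameSign ev F s z t y) (h' : MvSameSign ev F t y u x) : MvSameSign ev F s z u x :=
  fun f hf => (h f hf).trans (h' f hf)

variable [TopologicalSpace T]

/-- The cells cut out by `F` in `C × ℝ^κ` have connected fibres over `C`, and project onto `C` by
open maps. -/
structure IsFibred (ev : T → A →+* ℝ) (C : Set T) (F : Finset (MvPolynomial κ A)) : Prop where
  isOpen : ∀ t ∈ C, ∀ y, ∀ V ∈ 𝓝 y, ∀ᶠ s in 𝓝[C] t, ∃ z ∈ V, MvSameSign ev F s z t y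
  surj : ∀ t ∈ C, ∀ y, ∀ s ∈ C, ∃ z, MvSameSign ev F s z t y
  fibre : ∀ t ∈ C, ∀ y, IsPreconnected {z | MvSameSign ev F t z t y}

theorem continuous_mvVal [Finite κ] (hev : ∀ a, Continuous fun t => ev t a)
    (p : MvPolynomial κ A) : Continuous fun x : T × (κ → ℝ) => mvVal ev p x.1 x.2 := by
  induction p using MvPolynomial.induction_on with
  | C a =>
    simp only [mvVal, MvPolynomial.coe_eval₂Hom, MvPolynomial.eval₂_C]
    exact (hev a).comp continuous_fst
  | add p q hp hq =>
    simp only [mvVal, map_add]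
    exact hp.add hq
  | mul_X p i hp =>
    simp only [mvVal, map_mul, MvPolynomial.coe_eval₂Hom, MvPolynomial.eval₂_X]
    exact hp.mul ((continuous_apply i).comp continuous_snd)

/-- The cells of a fibred family are connected. -/
theorem IsFibred.isPreconnected_cell {C : Set T} (hC : IsPreconnected C)
    {F : Finset (MvPolynomial κ A)} (hF : IsFibred ev C F) {t : T} (ht : t ∈ C) (y : κ → ℝ) :
    IsPreconnected {x : T × (κ → ℝ) | x.1 ∈ C ∧ MvSameSign ev F x.1 x.2 t y} := by
  refine isPreconnected_total (S := fun s => {z | MvSameSign ev F s z t y}) hC ?_ ?_ ?_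
  · intro s hs
    obtain ⟨z, hz⟩ := hF.surj t ht y s hs
    have : {z | MvSameSign ev F s z t y} = {w | MvSameSign ev F s w s z} :=
      ext fun w => ⟨fun h => h.trans hz.symm, fun h => h.trans hz⟩
    rw [this]
    exact hF.fibre s hs z
  · exact fun s hs => hF.surj t ht y s hs
  · intro s hs z hz V hV
    exact (hF.isOpen s hs z V hV).mono fun u ⟨w, hw, hw'⟩ => ⟨w, hw, hw'.trans hz⟩

theorem mvVal_optionEquivLeft (p : MvPolynomial (Option κ) A) (t : T) (y : Option κ → ℝ) :
    polyVal (fun x : T × (κ → ℝ) => MvPolynomial.eval₂Hom (ev x.1) x.2)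
      (MvPolynomial.optionEquivLeft A κ p) (t, fun i => y (some i)) (y none) = mvVal ev p t y := by
  induction p using MvPolynomial.induction_on with
  | C a => simp [polyVal, mvVal]
  | add p q hp hq =>
    simp only [polyVal, mvVal] at hp hq ⊢
    simp [hp, hq]
  | mul_X p i hp =>
    simp only [polyVal, mvVal] at hp ⊢
    rw [map_mul, Polynomial.map_mul, eval_mul, hp, map_mul]
    cases i <;> simp

/-- Induction on the number of variables. With one variable singled out, the polynomials are
univariate over functions on `T × ℝ^κ`. Their derivative closure is structured over connected sets
where a finite set `E₁` has constant signs, and the induction hypothesis supplies such sets as cells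
of a family containing `E₁`. The new cells are stacks of intervals over these. -/
theorem exists_isFibred [Finite κ] (hev : ∀ a, Continuous fun t => ev t a)
    (F : Finset (MvPolynomial κ A)) : ∃ F' : Finset (MvPolynomial κ A), F ⊆ F' ∧
      ∃ E : Finset A, ∀ C : Set T, IsPreconnected C → SignInvariant ev E C → IsFibred ev C F' := by
  classical
  revert F
  refine Finite.induction_empty_option (P := fun κ => ∀ F : Finset (MvPolynomial κ A),
      ∃ F' : Finset (MvPolynomial κ A), F ⊆ F' ∧ ∃ E : Finset A, ∀ C : Set T, IsPreconnected C →
        SignInvariant ev E C → IsFibred ev C F') ?_ ?_ ?_ κ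
  · intro α β e ih F
    obtain ⟨F', hF', E, hE⟩ := ih (F.image (MvPolynomial.rename e.symm))
    have hval : ∀ (p : MvPolynomial α A) (t : T) (y : β → ℝ),
        mvVal ev (MvPolynomial.rename e p) t y = mvVal ev p t (y ∘ e) := fun p t y => by
      simp [mvVal, MvPolynomial.eval₂_rename]
    have hiff : ∀ s z t y, MvSameSign ev (F'.image (MvPolynomial.rename e)) s z t y ↔
        MvSameSign ev F' s (z ∘ e) t (y ∘ e) := by
      intro s z t y
      simp [MvSameSign, hval]
    have hc : Continuous fun (z : α → ℝ) => z ∘ e.symm :=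
      continuous_pi fun i => continuous_apply _
    have hc' : Continuous fun (z : β → ℝ) => z ∘ e := continuous_pi fun i => continuous_apply _
    refine ⟨F'.image (MvPolynomial.rename e), fun f hf => ?_, E, fun C hC hEC => ?_⟩
    · refine Finset.mem_image.2 ⟨MvPolynomial.rename e.symm f,
        hF' (Finset.mem_image_of_mem _ hf), ?_⟩
      simp [MvPolynomial.rename_rename]
    · have hfib := hE C hC hEC
      constructor
      · intro t ht y V hV
        have hV' : (fun (z : α → ℝ) => z ∘ e.symm) ⁻¹' V ∈ 𝓝 (y ∘ e) := by
          refine hc.continuousAt.preimage_mem_nhds ?_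
          convert hV
          ext i; simp
        filter_upwards [hfib.isOpen t ht (y ∘ e) _ hV'] with s ⟨z, hz, hz'⟩
        refine ⟨z ∘ e.symm, hz, (hiff _ _ _ _).2 ?_⟩
        convert hz'
        ext i; simp
      · intro t ht y s hs
        obtain ⟨z, hz⟩ := hfib.surj t ht (y ∘ e) s hs
        refine ⟨z ∘ e.symm, (hiff _ _ _ _).2 ?_⟩
        convert hz
        ext i; simp
      · intro t ht y
        have : {z | MvSameSign ev (F'.image (MvPolynomial.rename e)) t z t y} =
            (fun (z : α → ℝ) => z ∘ e.symm) '' {z | MvSameSign ev F' t z t (y ∘ e)} := by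
          ext z
          simp only [mem_ofPred_eq, hiff, mem_image]
          constructor
          · exact fun h => ⟨z ∘ e, h, by ext i; simp⟩
          · rintro ⟨w, hw, rfl⟩
            convert hw
            ext i; simp
        rw [this]
        exact (hfib.fibre t ht _).image _ hc.continuousOn
  · intro F
    refine ⟨F, Finset.Subset.refl _, F.image fun f => (MvPolynomial.isEmptyAlgEquiv A PEmpty f),
      fun C _ hE => ?_⟩
    have hval : ∀ (p : MvPolynomial PEmpty A) t y,
        mvVal ev p t y = ev t (MvPolynomial.isEmptyAlgEquiv A PEmpty p) := by
      intro p t y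
      obtain ⟨a, rfl⟩ := MvPolynomial.C_surjective PEmpty p
      rw [← MvPolynomial.algebraMap_eq, AlgEquiv.commutes]
      simp [mvVal]
    have hss : ∀ s ∈ C, ∀ t ∈ C, ∀ z y, MvSameSign ev F s z t y := by
      intro s hs t ht z y f hf
      rw [hval, hval]
      exact hE _ (Finset.mem_image_of_mem _ hf) s hs t ht
    constructor
    · intro t ht y V hV
      filter_upwards [self_mem_nhdsWithin] with s hs
      exact ⟨y, mem_of_mem_nhds hV, hss s hs t ht y y⟩
    · exact fun t ht y s hs => ⟨y, hss s hs t ht y y⟩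
    · exact fun t ht y => Set.Subsingleton.isPreconnected fun _ _ _ _ => Subsingleton.elim _ _
  · intro κ _ ih F
    let ev' : T × (κ → ℝ) → MvPolynomial κ A →+* ℝ := fun x => MvPolynomial.eval₂Hom (ev x.1) x.2
    have hev' : ∀ a, Continuous fun x => ev' x a := fun a => continuous_mvVal hev a
    let e := MvPolynomial.optionEquivLeft A κ
    obtain ⟨E₁, hE₁⟩ := exists_isStructured hev' (F := derivClosure (F.image e))
      derivative_mem_derivClosure
    obtain ⟨E₁', hE₁', E, hE⟩ := ih E₁
    let F' : Finset (MvPolynomial (Option κ) A) :=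
      (derivClosure (F.image e)).image e.symm ∪ E₁'.image (MvPolynomial.rename some)
    have hval : ∀ (p : (MvPolynomial κ A)[X]) t y,
        mvVal ev (e.symm p) t y = polyVal ev' p (t, fun i => y (some i)) (y none) := by
      intro p t y
      rw [← mvVal_optionEquivLeft]
      simp only [e, AlgEquiv.apply_symm_apply]
      rfl
    have hval' : ∀ (p : MvPolynomial κ A) t (y : Option κ → ℝ),
        mvVal ev (MvPolynomial.rename some p) t y = mvVal ev p t fun i => y (some i) := by
      intro p t y
      simp [mvVal, MvPolynomial.eval₂_rename]
      rfl
    have hiff : ∀ s z t y, MvSameSign ev F' s z t y ↔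
        SameSign ev' (derivClosure (F.image e)) (s, fun i => z (some i)) (z none)
          (t, fun i => y (some i)) (y none) ∧
        MvSameSign ev E₁' s (fun i => z (some i)) t (fun i => y (some i)) := by
      intro s z t y
      constructor
      · intro h
        refine ⟨fun f hf => ?_, fun f hf => ?_⟩
        · have := h (e.symm f) (Finset.mem_union_left _ (Finset.mem_image_of_mem _ hf))
          rwa [hval, hval] at this
        · have := h _ (Finset.mem_union_right _ (Finset.mem_image_of_mem _ hf))
          rwa [hval', hval'] at this
      · rintro ⟨h1, h2⟩ f hf
        rcases Finset.mem_union.1 hf with hf | hf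
        · obtain ⟨g, hg, rfl⟩ := Finset.mem_image.1 hf
          rw [hval, hval]
          exact h1 g hg
        · obtain ⟨g, hg, rfl⟩ := Finset.mem_image.1 hf
          rw [hval', hval']
          exact h2 g hg
    let ext : (κ → ℝ) × ℝ → Option κ → ℝ := fun x i => i.elim x.2 x.1
    have hext : Continuous ext := by
      refine continuous_pi fun i => ?_
      cases i
      · exact continuous_snd
      · exact (continuous_apply _).comp continuous_fst
    have hext' : ∀ y : Option κ → ℝ, ext (fun i => y (some i), y none) = y := by
      intro y; ext i; cases i <;> rfl
    refine ⟨F', ?_, E, fun C hC hEC => ?_⟩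
    · intro f hf
      refine Finset.mem_union_left _ (Finset.mem_image.2 ⟨e f, ?_, e.symm_apply_apply f⟩)
      exact subset_derivClosure _ (Finset.mem_image_of_mem _ hf)
    · have hfib := hE C hC hEC
      -- the cells of `E₁'` over `C`
      have hstr : ∀ t ∈ C, ∀ y, IsStructured ev'
          {x : T × (κ → ℝ) | x.1 ∈ C ∧ MvSameSign ev E₁' x.1 x.2 t y}
          (derivClosure (F.image e)) := by
        intro t ht y
        refine hE₁ _ (hfib.isPreconnected_cell hC ht y) ?_
        intro a ha s hs u hu
        exact (hs.2.trans hu.2.symm) a (hE₁' ha)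
      constructor
      · intro t ht y V hV
        rw [← hext' y] at hV
        have hV' := hext.continuousAt.preimage_mem_nhds hV
        obtain ⟨N, hN, V₀, hV₀, hNV⟩ := mem_nhds_prod_iff.1 hV'
        have h1 := (hstr t ht fun i => y (some i)).isOpen (t, fun i => y (some i))
          ⟨ht, fun _ _ => rfl⟩ (y none) V₀ hV₀
        rw [eventually_nhdsWithin_iff] at h1
        obtain ⟨M, hM, N', hN', hMN⟩ := mem_nhds_prod_iff.1 h1
        filter_upwards [hfib.isOpen t ht (fun i => y (some i)) _ (inter_mem hN hN'),
          mem_nhdsWithin_of_mem_nhds hM, self_mem_nhdsWithin] with s ⟨z, hz, hz'⟩ hs hsC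
        obtain ⟨x, hx, hx'⟩ := hMN (mk_mem_prod hs hz.2) ⟨hsC, hz'⟩
        exact ⟨ext (z, x), hNV (mk_mem_prod hz.1 hx), (hiff _ _ _ _).2 ⟨hx', hz'⟩⟩
      · intro t ht y s hs
        obtain ⟨z, hz⟩ := hfib.surj t ht (fun i => y (some i)) s hs
        obtain ⟨x, hx⟩ := (hstr t ht fun i => y (some i)).surj (t, fun i => y (some i))
          ⟨ht, fun _ _ => rfl⟩ (y none) (s, z) ⟨hs, hz⟩
        exact ⟨ext (z, x), (hiff _ _ _ _).2 ⟨hx, hz⟩⟩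
      · intro t ht y
        have hS := hstr t ht fun i => y (some i)
        -- Over `t` the new cell is the total space of a family of intervals over a connected cell
        -- of `E₁'`.
        have htot := isPreconnected_total
          (B := {z : κ → ℝ | MvSameSign ev E₁' t z t fun i => y (some i)})
          (S := fun z => {x | SameSign ev' (derivClosure (F.image e)) (t, z) x
            (t, fun i => y (some i)) (y none)})
          (hfib.fibre t ht _)
          (fun z _ => (ordConnected_sameSign derivative_mem_derivClosure _ _ _).isPreconnected)
          (fun z hz => hS.surj _ ⟨ht, fun _ _ => rfl⟩ _ (t, z) ⟨ht, hz⟩) (by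
            intro z hz x hx V hV
            have h1 := hS.isOpen (t, z) ⟨ht, hz⟩ x V hV
            have h2 : Tendsto (fun z' : κ → ℝ => (t, z'))
                (𝓝[{z : κ → ℝ | MvSameSign ev E₁' t z t fun i => y (some i)}] z)
                (𝓝[{x : T × (κ → ℝ) | x.1 ∈ C ∧
                  MvSameSign ev E₁' x.1 x.2 t fun i => y (some i)}] (t, z)) :=
              tendsto_nhdsWithin_of_tendsto_nhds_of_eventually_within _
                ((Continuous.prodMk_right t).continuousAt.mono_left nhdsWithin_le_nhds)
                (eventually_mem_nhdsWithin.mono fun w hw => ⟨ht, hw⟩)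
            exact (h2.eventually h1).mono fun w ⟨v, hv, hv'⟩ => ⟨v, hv, hv'.trans hx⟩)
        have himg : {z | MvSameSign ev F' t z t y} = ext '' {x : (κ → ℝ) × ℝ |
            x.1 ∈ {z : κ → ℝ | MvSameSign ev E₁' t z t fun i => y (some i)} ∧
            x.2 ∈ {x' | SameSign ev' (derivClosure (F.image e)) (t, x.1) x'
              (t, fun i => y (some i)) (y none)}} := by
          ext z
          constructor
          · intro h
            obtain ⟨h1, h2⟩ := (hiff _ _ _ _).1 h
            exact ⟨(fun i => z (some i), z none), ⟨h2, h1⟩, hext' z⟩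
          · rintro ⟨x, ⟨h1, h2⟩, rfl⟩
            exact (hiff _ _ _ _).2 ⟨h2, h1⟩
        rw [himg]
        exact htot.image _ hext.continuousOn

end Base

/-! ### Semialgebraic sets -/

section Semialgebraic

variable {𝕜 : Type*} [RCLike 𝕜] {ι : Type*}

/-- Real and imaginary parts of a vector. -/
def reIm (z : ι → 𝕜) : ι ⊕ ι → ℝ := Sum.elim (fun i => RCLike.re (z i)) (fun i => RCLike.im (z i))

variable (𝕜) in
/-- The vector with the given real and imaginary parts. -/
noncomputable def ofReIm (y : ι ⊕ ι → ℝ) : ι → 𝕜 :=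
  fun i => (y (.inl i) : 𝕜) + (y (.inr i) : 𝕜) * RCLike.I

theorem ofReIm_reIm (z : ι → 𝕜) : ofReIm 𝕜 (reIm z) = z :=
  funext fun i => RCLike.re_add_im (z i)

/-- This lets `ℝ` and `ℂ` be treated together: in the real case `I = 0` and the imaginary
coordinates have to vanish, in the complex case there is no condition. -/
theorem reIm_ofReIm_iff (y : ι ⊕ ι → ℝ) :
    reIm (ofReIm 𝕜 y) = y ↔ ((RCLike.I : 𝕜) = 0 → ∀ i, y (.inr i) = 0) := by
  rcases RCLike.I_eq_zero_or_im_I_eq_one (K := 𝕜) with h | h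
  · constructor
    · intro hy _ i
      rw [← congrFun hy (.inr i)]
      simp [reIm, ofReIm, h]
    · intro hy
      ext i
      cases i <;> simp [reIm, ofReIm, h, hy h]
  · have h0 : (RCLike.I : 𝕜) ≠ 0 := by
      intro h0; simp [h0] at h
    refine ⟨fun _ h => (h0 h).elim, fun _ => ?_⟩
    ext i
    cases i <;> simp [reIm, ofReIm, h]

theorem reIm_inr_eq_zero (h : (RCLike.I : 𝕜) = 0) (z : ι → 𝕜) (i : ι) :
    reIm z (.inr i) = 0 := by
  have := (reIm_ofReIm_iff (𝕜 := 𝕜) (reIm z)).1 (by rw [ofReIm_reIm]) h i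
  exact this

theorem continuous_reIm : Continuous (reIm : (ι → 𝕜) → ι ⊕ ι → ℝ) := by
  refine continuous_pi fun i => ?_
  cases i
  · exact RCLike.continuous_re.comp (continuous_apply _)
  · exact RCLike.continuous_im.comp (continuous_apply _)

theorem continuous_ofReIm : Continuous (ofReIm 𝕜 : (ι ⊕ ι → ℝ) → ι → 𝕜) := by
  refine continuous_pi fun i => ?_
  exact (RCLike.continuous_ofReal.comp (continuous_apply _)).add
    ((RCLike.continuous_ofReal.comp (continuous_apply _)).mul continuous_const)

/-- The evaluation of real polynomials in the real and imaginary parts. -/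
noncomputable def evReIm (z : ι → 𝕜) : MvPolynomial (ι ⊕ ι) ℝ →+* ℝ := MvPolynomial.eval (reIm z)

theorem continuous_evReIm [Finite ι] (a : MvPolynomial (ι ⊕ ι) ℝ) :
    Continuous fun z : ι → 𝕜 => evReIm z a :=
  (MvPolynomial.continuous_eval a).comp continuous_reIm

/-- The polynomials in `Q` have the same signs at `z` and `w`. -/
def SignEq (Q : Finset (MvPolynomial (ι ⊕ ι) ℝ)) (z w : ι → 𝕜) : Prop :=
  ∀ q ∈ Q, SignType.sign (evReIm z q) = SignType.sign (evReIm w q)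

theorem SignEq.symm {Q : Finset (MvPolynomial (ι ⊕ ι) ℝ)} {z w : ι → 𝕜} (h : SignEq Q z w) :
    SignEq Q w z := fun q hq => (h q hq).symm

theorem SignEq.trans {Q : Finset (MvPolynomial (ι ⊕ ι) ℝ)} {z w v : ι → 𝕜} (h : SignEq Q z w)
    (h' : SignEq Q w v) : SignEq Q z v := fun q hq => (h q hq).trans (h' q hq)

theorem SignEq.mono {Q Q' : Finset (MvPolynomial (ι ⊕ ι) ℝ)} (hQ : Q ⊆ Q') {z w : ι → 𝕜}
    (h : SignEq Q' z w) : SignEq Q z w := fun q hq => h q (hQ hq)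

theorem isSemialgebraic_empty : IsSemialgebraic (∅ : Set (ι → 𝕜)) := by
  convert IsSemialgebraic.pos (𝕜 := 𝕜) (ι := ι) 0
  ext; simp

theorem IsSemialgebraic.of_compl {S : Set (ι → 𝕜)} (h : IsSemialgebraic Sᶜ) :
    IsSemialgebraic S := compl_compl S ▸ h.compl

theorem IsSemialgebraic.union {S S' : Set (ι → 𝕜)} (h : IsSemialgebraic S)
    (h' : IsSemialgebraic S') : IsSemialgebraic (S ∪ S') := by
  refine .of_compl ?_
  rw [compl_union]
  exact h.compl.inter _ _ h'.compl

theorem isSemialgebraic_biUnion {α : Type*} (s : Finset α) (S : α → Set (ι → 𝕜))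
    (h : ∀ a ∈ s, IsSemialgebraic (S a)) : IsSemialgebraic (⋃ a ∈ s, S a) := by
  classical
  induction s using Finset.induction_on with
  | empty => simpa using isSemialgebraic_empty
  | insert a s _ ih =>
    rw [Finset.set_biUnion_insert]
    exact (h a (Finset.mem_insert_self _ _)).union
      (ih fun b hb => h b (Finset.mem_insert_of_mem hb))

theorem isSemialgebraic_biInter {α : Type*} (s : Finset α) (S : α → Set (ι → 𝕜))
    (h : ∀ a ∈ s, IsSemialgebraic (S a)) : IsSemialgebraic (⋂ a ∈ s, S a) := by
  refine .of_compl ?_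
  rw [compl_iInter₂]
  exact isSemialgebraic_biUnion s _ fun a ha => (h a ha).compl

theorem isSemialgebraic_sign_eq (p : MvPolynomial (ι ⊕ ι) ℝ) (ε : SignType) :
    IsSemialgebraic {z : ι → 𝕜 | SignType.sign (evReIm z p) = ε} := by
  have hpos : ∀ p : MvPolynomial (ι ⊕ ι) ℝ,
      IsSemialgebraic {z : ι → 𝕜 | 0 < evReIm z p} := fun p => IsSemialgebraic.pos p
  have hneg : IsSemialgebraic {z : ι → 𝕜 | evReIm z p < 0} := by
    simpa using hpos (-p)
  rcases ε with _ | _ | _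
  · convert (hpos p).compl.inter _ _ hneg.compl using 1
    ext z
    simp only [mem_inter_iff, mem_compl_iff, mem_ofPred_eq, not_lt]
    exact ⟨fun h => by have h' := sign_eq_zero_iff.1 h; exact ⟨h'.le, h'.ge⟩,
      fun h => sign_eq_zero_iff.2 (le_antisymm h.1 h.2)⟩
  · simpa [sign_eq_neg_one_iff] using hneg
  · simpa [sign_eq_one_iff] using hpos p

/-- A set is semialgebraic iff membership depends only on the signs of finitely many polynomials. -/
theorem isSemialgebraic_iff {S : Set (ι → 𝕜)} : IsSemialgebraic S ↔
    ∃ Q : Finset (MvPolynomial (ι ⊕ ι) ℝ), ∀ z w : ι → 𝕜, SignEq Q z w → z ∈ S → w ∈ S := by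
  classical
  constructor
  · intro h
    induction h with
    | pos p =>
      refine ⟨{p}, fun z w h hz => ?_⟩
      have h1 := h p (Finset.mem_singleton_self p)
      have h2 : 0 < evReIm z p := hz
      rw [sign_pos h2] at h1
      exact sign_eq_one_iff.1 h1.symm
    | compl S _ ih =>
      obtain ⟨Q, hQ⟩ := ih
      exact ⟨Q, fun z w h hz hw => hz (hQ w z h.symm hw)⟩
    | inter S S' _ _ ih ih' =>
      obtain ⟨Q, hQ⟩ := ih
      obtain ⟨Q', hQ'⟩ := ih'
      exact ⟨Q ∪ Q', fun z w h hz => ⟨hQ z w (h.mono Finset.subset_union_left) hz.1,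
        hQ' z w (h.mono Finset.subset_union_right) hz.2⟩⟩
  · rintro ⟨Q, hQ⟩
    have : S = ⋃ ε ∈ (Finset.univ : Finset (Q → SignType)).filter (fun ε => ∃ z ∈ S,
        ∀ q : Q, SignType.sign (evReIm z q.1) = ε q),
        ⋂ q ∈ (Finset.univ : Finset Q), {z : ι → 𝕜 | SignType.sign (evReIm z q.1) = ε q} := by
      ext w
      simp only [Finset.mem_filter, Finset.mem_univ, true_and, mem_iUnion, mem_iInter,
        mem_ofPred_eq, exists_prop, forall_const]
      constructor
      · exact fun hw => ⟨fun q => SignType.sign (evReIm w q.1), ⟨w, hw, fun _ => rfl⟩, fun _ => rfl⟩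
      · rintro ⟨ε, ⟨z, hz, hzε⟩, hwε⟩
        exact hQ z w (fun q hq => (hzε ⟨q, hq⟩).trans (hwε ⟨q, hq⟩).symm) hz
    rw [this]
    exact isSemialgebraic_biUnion _ _ fun ε _ => isSemialgebraic_biInter _ _ fun q _ =>
      isSemialgebraic_sign_eq q.1 (ε q)

/-- Every finite set of polynomials is contained in one whose sign conditions define connected
sets. -/
theorem exists_isPreconnected_signEq [Finite ι] (Q : Finset (MvPolynomial (ι ⊕ ι) ℝ)) :
    ∃ Q' : Finset (MvPolynomial (ι ⊕ ι) ℝ), Q ⊆ Q' ∧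
      ∀ z : ι → 𝕜, IsPreconnected {w | SignEq Q' w z} := by
  classical
  have := Fintype.ofFinite ι
  -- The base is a point. The imaginary coordinates are added to the family so that, in the real
  -- case, a cell through some `reIm z` stays where they are zero.
  obtain ⟨Q', hQ', E, hE⟩ := exists_isFibred (T := Unit) (ev := fun _ => RingHom.id ℝ)
    (fun _ => continuous_const)
    (Q ∪ (Finset.univ : Finset ι).image fun i => MvPolynomial.X (.inr i))
  have hfib := hE univ isPreconnected_univ (fun a _ s _ t _ => rfl)
  refine ⟨Q', Finset.subset_union_left.trans hQ', fun z => ?_⟩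
  have hval : ∀ (p : MvPolynomial (ι ⊕ ι) ℝ) (y : ι ⊕ ι → ℝ),
      mvVal (fun _ : Unit => RingHom.id ℝ) p () y = MvPolynomial.eval y p := fun p y => rfl
  have : {w | SignEq Q' w z} = ofReIm 𝕜 '' {y | MvSameSign (fun _ : Unit => RingHom.id ℝ) Q' () y ()
      (reIm z)} := by
    ext w
    constructor
    · exact fun h => ⟨reIm w, h, ofReIm_reIm w⟩
    · rintro ⟨y, hy, rfl⟩
      have hy' : reIm (ofReIm 𝕜 y) = y := by
        rw [reIm_ofReIm_iff]
        intro hI i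
        have := hy (MvPolynomial.X (.inr i)) (hQ' (Finset.mem_union_right _ (Finset.mem_image.2
          ⟨i, Finset.mem_univ _, rfl⟩)))
        rw [hval, hval, MvPolynomial.eval_X, MvPolynomial.eval_X, reIm_inr_eq_zero hI,
          sign_zero, sign_eq_zero_iff] at this
        exact this
      intro q hq
      have := hy q hq
      rw [hval, hval] at this
      rwa [evReIm, hy']
  rw [this]
  exact (hfib.fibre () (mem_univ _) _).image _ continuous_ofReIm.continuousOn

/-- A relatively open and closed subset of a semialgebraic set is semialgebraic. -/
theorem IsSemialgebraic.of_isOpen_diff [Finite ι] {S V : Set (ι → 𝕜)} (hS : IsSemialgebraic S)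
    (hVS : V ⊆ S) (hV : IsOpen V) (hSV : IsOpen (S \ V)) : IsSemialgebraic V := by
  obtain ⟨Q, hQ⟩ := isSemialgebraic_iff.1 hS
  obtain ⟨Q', hQQ', hQ'⟩ := exists_isPreconnected_signEq (𝕜 := 𝕜) Q
  refine isSemialgebraic_iff.2 ⟨Q', fun z w h hz => ?_⟩
  have hsub : {w | SignEq Q' w z} ⊆ S := fun v hv => hQ z v ((SignEq.symm hv).mono hQQ') (hVS hz)
  have hzz : z ∈ {w | SignEq Q' w z} := fun _ _ => rfl
  -- A connected cell contained in `S` that meets `V` cannot meet the open set `S \ V`.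
  have := (hQ' z).subset_left_of_subset_union hV hSV disjoint_sdiff_right
    (fun v hv => by by_cases hvV : v ∈ V; exacts [.inl hvV, .inr ⟨hsub hv, hvV⟩])
    ⟨z, hzz, hz⟩
  exact this h.symm

end Semialgebraic

/-! ### Taylor coefficients -/

section Taylor

variable {𝕜 : Type*} [RCLike 𝕜] {ι : Type*}

/-- The polynomial `a(X + W)`, as a polynomial in `W`. -/
noncomputable def taylorHom : MvPolynomial ι 𝕜 →+* MvPolynomial ι (MvPolynomial ι 𝕜) :=
  MvPolynomial.eval₂Hom (MvPolynomial.C.comp MvPolynomial.C)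
    fun i => MvPolynomial.C (MvPolynomial.X i) + MvPolynomial.X i

/-- The coefficient of `W^m` in `P(X + W, Y)`. -/
noncomputable def taylorCoeff (P : (MvPolynomial ι 𝕜)[X]) (m : ι →₀ ℕ) : (MvPolynomial ι 𝕜)[X] :=
  ∑ i ∈ Finset.range (P.natDegree + 1), monomial i ((taylorHom (P.coeff i)).coeff m)

open Classical in
/-- A finite set of exponents that contains those of all nonzero Taylor coefficients. -/
noncomputable def taylorSupport (P : (MvPolynomial ι 𝕜)[X]) : Finset (ι →₀ ℕ) :=
  (Finset.range (P.natDegree + 1)).biUnion fun i => (taylorHom (P.coeff i)).support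

theorem mem_taylorSupport {P : (MvPolynomial ι 𝕜)[X]} {m : ι →₀ ℕ} : m ∈ taylorSupport P ↔
    ∃ i ∈ Finset.range (P.natDegree + 1), m ∈ (taylorHom (P.coeff i)).support := by
  classical
  simp only [taylorSupport]
  convert Finset.mem_biUnion

theorem taylorCoeff_eq_zero {P : (MvPolynomial ι 𝕜)[X]} {m : ι →₀ ℕ} (hm : m ∉ taylorSupport P) :
    taylorCoeff P m = 0 := by
  refine Finset.sum_eq_zero fun i hi => ?_
  rw [mem_taylorSupport] at hm
  push Not at hm
  rw [MvPolynomial.notMem_support_iff.1 (hm i hi), monomial_zero_right]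

/-- The value of the polynomial `P` in `X₁, …, Xₙ, Y`. -/
noncomputable def nashVal (P : (MvPolynomial ι 𝕜)[X]) (u : ι → 𝕜) (y : 𝕜) : 𝕜 :=
  (P.map (MvPolynomial.eval u)).eval y

theorem nashVal_eq_sum (P : (MvPolynomial ι 𝕜)[X]) (u : ι → 𝕜) (y : 𝕜) : nashVal P u y =
    ∑ i ∈ Finset.range (P.natDegree + 1), MvPolynomial.eval u (P.coeff i) * y ^ i := by
  rw [nashVal, eval_map, eval₂_eq_sum_range]

theorem continuous_nashVal_right (P : (MvPolynomial ι 𝕜)[X]) (u : ι → 𝕜) :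
    Continuous (nashVal P u) := (P.map (MvPolynomial.eval u)).continuous

theorem nashVal_taylorCoeff (P : (MvPolynomial ι 𝕜)[X]) (m : ι →₀ ℕ) (u : ι → 𝕜) (y : 𝕜) :
    nashVal (taylorCoeff P m) u y = ∑ i ∈ Finset.range (P.natDegree + 1),
      MvPolynomial.eval u ((taylorHom (P.coeff i)).coeff m) * y ^ i := by
  simp only [nashVal, taylorCoeff, Polynomial.map_sum, eval_finsetSum, map_monomial, eval_monomial]

variable [Fintype ι]

theorem eval_add_eq (a : MvPolynomial ι 𝕜) (u w : ι → 𝕜) : MvPolynomial.eval (u + w) a =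
    ∑ m ∈ (taylorHom a).support, MvPolynomial.eval u ((taylorHom a).coeff m) * ∏ i, w i ^ m i := by
  rw [← MvPolynomial.eval₂_eq']
  have : MvPolynomial.eval (u + w) =
      (MvPolynomial.eval₂Hom (MvPolynomial.eval u) w).comp (taylorHom (𝕜 := 𝕜) (ι := ι)) := by
    refine MvPolynomial.ringHom_ext (fun c => ?_) fun i => ?_ <;> simp [taylorHom]
  exact congrArg (fun h => h a) this

/-- Taylor's formula. -/
theorem nashVal_add (P : (MvPolynomial ι 𝕜)[X]) (u w : ι → 𝕜) (y : 𝕜) : nashVal P (u + w) y =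
    ∑ m ∈ taylorSupport P, nashVal (taylorCoeff P m) u y * ∏ i, w i ^ m i := by
  simp only [nashVal_taylorCoeff, Finset.sum_mul]
  rw [nashVal_eq_sum, Finset.sum_comm]
  refine Finset.sum_congr rfl fun i hi => ?_
  rw [eval_add_eq, Finset.sum_mul]
  refine (Finset.sum_subset (fun m hm => ?_) fun m _ hm => ?_).trans
    (Finset.sum_congr rfl fun m _ => mul_right_comm _ _ _)
  · exact mem_taylorSupport.2 ⟨i, hi, hm⟩
  · rw [MvPolynomial.notMem_support_iff.1 hm, map_zero, zero_mul, zero_mul]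

/-- Otherwise Taylor's formula at `u` makes `P` vanish everywhere. Although `P` itself may become
zero over `u`, some Taylor coefficient still gives a nontrivial equation there. -/
theorem exists_taylorCoeff_ne_zero {P : (MvPolynomial ι 𝕜)[X]} (hP : P ≠ 0) (u : ι → 𝕜) :
    ∃ m ∈ taylorSupport P, (taylorCoeff P m).map (MvPolynomial.eval u) ≠ 0 := by
  by_contra h
  push Not at h
  apply hP
  ext1 i
  refine MvPolynomial.funext fun x => ?_
  have : P.map (MvPolynomial.eval x) = 0 := by
    refine Polynomial.funext fun y => ?_
    have h1 := nashVal_add P u (x - u) y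
    rw [add_sub_cancel] at h1
    rw [eval_zero]
    refine h1.trans (Finset.sum_eq_zero fun m hm => ?_)
    rw [nashVal, h m hm, eval_zero, zero_mul]
  rw [← coeff_map, this]
  simp

/-- If `P(x, g(x)) = 0` near `v`, then `(v, g(v))` is a zero of the Taylor coefficients of the
lowest order that does not vanish identically at `v`. -/
theorem nashVal_taylorCoeff_eq_zero {P : (MvPolynomial ι 𝕜)[X]} {g : (ι → 𝕜) → 𝕜} {v : ι → 𝕜}
    (hg : ContinuousAt g v) (hP : ∀ᶠ x in 𝓝 v, nashVal P x (g x) = 0) {k : ℕ}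
    (hk : ∀ m, ∑ i, m i < k → (taylorCoeff P m).map (MvPolynomial.eval v) = 0)
    {m : ι →₀ ℕ} (hm : ∑ i, m i = k) : nashVal (taylorCoeff P m) v (g v) = 0 := by
  classical
  -- The homogeneous part of degree `k` in `w` of `P(v + w, g(v))`. Its vanishing as a polynomial
  -- yields all coefficients of order `k` at once.
  let H : MvPolynomial ι 𝕜 := ∑ m ∈ (taylorSupport P).filter fun m => ∑ i, m i = k,
    MvPolynomial.monomial m (nashVal (taylorCoeff P m) v (g v))
  have hH : H = 0 := by
    refine MvPolynomial.funext fun w => ?_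
    -- compare with the terms of lowest order of `P(v + t w, g(v + t w))`
    let Φ : 𝕜 → 𝕜 := fun t => ∑ m ∈ taylorSupport P,
      (if ∑ i, m i < k then 0 else t ^ (∑ i, m i - k)) *
        (nashVal (taylorCoeff P m) v (g (v + t • w)) * ∏ i, w i ^ m i)
    have hline : ContinuousAt (fun t : 𝕜 => v + t • w) 0 := by fun_prop
    have hline0 : v + (0 : 𝕜) • w = v := by simp
    have hgl : ContinuousAt (fun t : 𝕜 => g (v + t • w)) 0 := by
      refine ContinuousAt.comp (f := fun t : 𝕜 => v + t • w) ?_ hline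
      rwa [hline0]
    have hΦc : ContinuousAt Φ 0 := by
      refine tendsto_finsetSum _ fun m _ => ?_
      refine ContinuousAt.mul ?_ (ContinuousAt.mul ?_ continuousAt_const)
      · split_ifs
        · exact continuousAt_const
        · fun_prop
      · exact (continuous_nashVal_right _ v).continuousAt.comp hgl
    have hΦ0 : Φ 0 = MvPolynomial.eval w H := by
      simp only [Φ, H, map_sum, MvPolynomial.eval_monomial, hline0]
      rw [Finset.sum_filter]
      refine Finset.sum_congr rfl fun m _ => ?_
      rcases lt_trichotomy (∑ i, m i) k with h | h | h
      · simp [h, h.ne]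
      · simp [h, Finsupp.prod_fintype]
      · rw [if_neg h.not_gt, if_neg h.ne', zero_pow (by omega), zero_mul]
    have hΦz : ∀ᶠ t in 𝓝[≠] (0 : 𝕜), Φ t = 0 := by
      have h1 : ∀ᶠ t in 𝓝 (0 : 𝕜), nashVal P (v + t • w) (g (v + t • w)) = 0 := by
        have h0 := hline.tendsto
        rw [hline0] at h0
        exact h0.eventually hP
      filter_upwards [mem_nhdsWithin_of_mem_nhds h1, self_mem_nhdsWithin] with t ht ht0
      have ht0 : t ≠ 0 := ht0
      have h2 : t ^ k * Φ t = 0 := by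
        rw [← ht, nashVal_add, Finset.mul_sum]
        refine Finset.sum_congr rfl fun m _ => ?_
        have h3 : ∏ i, (t • w) i ^ m i = t ^ (∑ i, m i) * ∏ i, w i ^ m i := by
          simp only [Pi.smul_apply, smul_eq_mul, mul_pow, Finset.prod_mul_distrib,
            Finset.prod_pow_eq_pow_sum]
        rw [h3]
        split_ifs with h
        · rw [nashVal, hk m h]
          simp
        · have h4 : t ^ (∑ i, m i) = t ^ k * t ^ (∑ i, m i - k) := by
            rw [← pow_add]; congr 1; omega
          rw [h4]
          ring
      exact (mul_eq_zero.1 h2).resolve_left (pow_ne_zero _ ht0)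
    have h5 : Tendsto Φ (𝓝[≠] 0) (𝓝 (Φ 0)) := hΦc.mono_left nhdsWithin_le_nhds
    have h6 : Φ 0 = 0 := tendsto_nhds_unique h5
      (tendsto_const_nhds.congr' (hΦz.mono fun _ h => h.symm))
    rw [← hΦ0, h6, map_zero]
  by_cases hmS : m ∈ taylorSupport P
  · have := congrArg (MvPolynomial.coeff m) hH
    simp only [H, MvPolynomial.coeff_sum, MvPolynomial.coeff_monomial, MvPolynomial.coeff_zero] at this
    rwa [Finset.sum_ite_eq' _ m, if_pos (Finset.mem_filter.2 ⟨hmS, hm⟩)] at this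
  · rw [taylorCoeff_eq_zero hmS]
    simp [nashVal]

end Taylor

/-- A continuous section of a fibred family that stays in finitely many points of each fibre stays
in one cell. -/
theorem IsFibred.mvSameSign_of_section {T A κ : Type*} [TopologicalSpace T] [CommRing A] [Finite κ]
    {ev : T → A →+* ℝ} {C : Set T} (hC : IsPreconnected C) {F : Finset (MvPolynomial κ A)}
    (hF : IsFibred ev C F) {Z : T → Set (κ → ℝ)} (hZ : ∀ t ∈ C, (Z t).Finite)
    (hZF : ∀ t ∈ C, ∀ s ∈ C, ∀ y ∈ Z t, ∀ z, MvSameSign ev F s z t y → z ∈ Z s)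
    {σ : T → κ → ℝ} (hσ : ContinuousOn σ C) (hσZ : ∀ t ∈ C, σ t ∈ Z t) {s t : T} (hs : s ∈ C)
    (ht : t ∈ C) : MvSameSign ev F s (σ s) t (σ t) := by
  refine hC.induction₂ (fun s t => MvSameSign ev F s (σ s) t (σ t)) (fun t ht => ?_)
    (fun _ _ _ _ _ _ h1 h2 => h1.trans h2) (fun _ _ _ _ h => h.symm) hs ht
  obtain ⟨V, hV, hVdis⟩ := (hZ t ht).t2_separation
  have h1 : ∀ᶠ s in 𝓝[C] t, ∀ y ∈ Z t, ∃ z ∈ V y, MvSameSign ev F s z t y := by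
    rw [Filter.eventually_all_finite (hZ t ht)]
    exact fun y _ => hF.isOpen t ht y (V y) ((hV y).2.mem_nhds (hV y).1)
  have h2 : ∀ᶠ s in 𝓝[C] t, σ s ∈ V (σ t) := hσ t ht ((hV _).2.mem_nhds (hV _).1)
  filter_upwards [h1, h2, self_mem_nhdsWithin] with s h1 h2 hsC
  -- `y` is a point over `t` in the cell of `σ s`. The aim is `y = σ t`: the cell returns over `s`
  -- near `y`, and since its fibre over `s` is connected and finite, it does so at `σ s`, which is
  -- near `σ t`.
  obtain ⟨y, hy⟩ := hF.surj s hsC (σ s) t ht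
  have hyZ : y ∈ Z t := hZF s hsC t ht _ (hσZ s hsC) y hy
  obtain ⟨z, hzV, hz⟩ := h1 y hyZ
  have hzσ : z = σ s := by
    by_contra hne
    have hnt : {w | MvSameSign ev F s w s (σ s)}.Nontrivial :=
      ⟨z, hz.trans hy, σ s, fun _ _ => rfl, hne⟩
    refine (hF.fibre s hsC (σ s)).infinite_of_nontrivial hnt ((hZ s hsC).subset fun w hw => ?_)
    exact hZF s hsC s hsC _ (hσZ s hsC) w hw
  have hyσ : y = σ t := by
    by_contra hne
    exact (hVdis hyZ (hσZ t ht) hne).le_bot ⟨hzσ ▸ hzV, h2⟩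
  rw [← hyσ]
  exact hy

/-! ### Preimages of semialgebraic sets under algebraic maps -/

section Nash

variable {𝕜 : Type*} [RCLike 𝕜]

/-- The real and imaginary parts of `h` are given by elements of the ring `B` of real functions. -/
def HasParts {Ω B : Type*} [CommRing B] (val : Ω → B →+* ℝ) (h : Ω → 𝕜) : Prop :=
  ∃ p q : B, ∀ x, val x p = RCLike.re (h x) ∧ val x q = RCLike.im (h x)

theorem HasParts.add {Ω B : Type*} [CommRing B] {val : Ω → B →+* ℝ} {h h' : Ω → 𝕜}
    (hh : HasParts val h) (hh' : HasParts val h') : HasParts val fun x => h x + h' x := by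
  obtain ⟨p, q, hpq⟩ := hh
  obtain ⟨p', q', hpq'⟩ := hh'
  exact ⟨p + p', q + q', fun x => by simp [hpq x, hpq' x]⟩

theorem HasParts.mul {Ω B : Type*} [CommRing B] {val : Ω → B →+* ℝ} {h h' : Ω → 𝕜}
    (hh : HasParts val h) (hh' : HasParts val h') : HasParts val fun x => h x * h' x := by
  obtain ⟨p, q, hpq⟩ := hh
  obtain ⟨p', q', hpq'⟩ := hh'
  exact ⟨p * p' - q * q', p * q' + q * p', fun x => by
    simp [hpq x, hpq' x, RCLike.mul_re, RCLike.mul_im]⟩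

theorem HasParts.pow {Ω B : Type*} [CommRing B] {val : Ω → B →+* ℝ} {h : Ω → 𝕜}
    (hh : HasParts val h) (k : ℕ) : HasParts val fun x => h x ^ k := by
  induction k with
  | zero => exact ⟨1, 0, fun x => by simp⟩
  | succ k ih => simpa only [pow_succ] using ih.mul hh

theorem HasParts.sum {Ω B α : Type*} [CommRing B] {val : Ω → B →+* ℝ} {s : Finset α}
    {h : α → Ω → 𝕜} (hh : ∀ a ∈ s, HasParts val (h a)) :
    HasParts val fun x => ∑ a ∈ s, h a x := by
  classical
  induction s using Finset.induction_on with
  | empty => exact ⟨0, 0, fun x => by simp⟩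
  | insert a s ha ih =>
    simp only [Finset.sum_insert ha]
    exact (hh a (Finset.mem_insert_self _ _)).add
      (ih fun b hb => hh b (Finset.mem_insert_of_mem hb))

theorem hasParts_eval {ι : Type*} (a : MvPolynomial ι 𝕜) :
    HasParts (fun z : ι → 𝕜 => evReIm z) fun z => MvPolynomial.eval z a := by
  induction a using MvPolynomial.induction_on with
  | C c => exact ⟨MvPolynomial.C (RCLike.re c), MvPolynomial.C (RCLike.im c), fun z => by
      simp [evReIm]⟩
  | add p q hp hq => simpa using hp.add hq
  | mul_X p i hp =>
    have : HasParts (fun z : ι → 𝕜 => evReIm z) fun z => z i :=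
      ⟨MvPolynomial.X (.inl i), MvPolynomial.X (.inr i), fun z => by simp [evReIm, reIm]⟩
    simpa using hp.mul this

/-- Expresses a `𝕜`-valued equation as the vanishing of two real polynomials in the fibre variables
over the base, so that sign conditions detect it. -/
theorem hasParts_nashVal {ι κ : Type*} (P : (MvPolynomial ι 𝕜)[X]) (j : κ) :
    HasParts (fun x : (ι → 𝕜) × (κ ⊕ κ → ℝ) => MvPolynomial.eval₂Hom (evReIm x.1) x.2)
      fun x => nashVal P x.1 (ofReIm 𝕜 x.2 j) := by
  simp only [nashVal_eq_sum]
  refine HasParts.sum fun i _ => ?_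
  have h1 : HasParts (fun x : (ι → 𝕜) × (κ ⊕ κ → ℝ) => MvPolynomial.eval₂Hom (evReIm x.1) x.2)
      fun x => MvPolynomial.eval x.1 (P.coeff i) := by
    obtain ⟨p, q, h⟩ := hasParts_eval (P.coeff i)
    exact ⟨MvPolynomial.C p, MvPolynomial.C q, fun x => by simpa using h x.1⟩
  have h2 : HasParts (fun x : (ι → 𝕜) × (κ ⊕ κ → ℝ) => MvPolynomial.eval₂Hom (evReIm x.1) x.2)
      fun x => ofReIm 𝕜 x.2 j := by
    rcases RCLike.I_eq_zero_or_im_I_eq_one (K := 𝕜) with h | h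
    · exact ⟨MvPolynomial.X (.inl j), 0, fun x => by simp [ofReIm, h]⟩
    · exact ⟨MvPolynomial.X (.inl j), MvPolynomial.X (.inr j), fun x => by simp [ofReIm, h]⟩
  exact h1.mul (h2.pow i)

/-- The preimage of a semialgebraic set under a continuous algebraic map is semialgebraic. -/
theorem IsSemialgebraic.inter_preimage {ι κ : Type*} [Fintype ι] [Finite κ] {U : Set (ι → 𝕜)}
    (hU : IsSemialgebraic U) (hUo : IsOpen U) {f : (ι → 𝕜) → (κ → 𝕜)} (hf : ContinuousOn f U)
    (halg : ∀ j, IsAlgebraicOn (fun u => f u j) U) {S : Set (κ → 𝕜)} (hS : IsSemialgebraic S) :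
    IsSemialgebraic (U ∩ f ⁻¹' S) := by
  classical
  have := Fintype.ofFinite κ
  choose P hPd hP using halg
  choose re im hre using fun a : MvPolynomial ι 𝕜 => hasParts_eval a
  choose re' im' hre' using fun (j : κ) (Q : (MvPolynomial ι 𝕜)[X]) => hasParts_nashVal Q j
  obtain ⟨QS, hQS⟩ := isSemialgebraic_iff.1 hS
  obtain ⟨QU, hQU⟩ := isSemialgebraic_iff.1 hU
  -- The given equations may vanish identically over some points of `U`, hence the passage to Taylor
  -- coefficients.
  let Tm : κ → (ι →₀ ℕ) → (MvPolynomial ι 𝕜)[X] := fun j m => taylorCoeff (P j) m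
  let J : Finset (κ × (ι →₀ ℕ)) :=
    Finset.univ.biUnion fun j => (taylorSupport (P j)).image fun m => (j, m)
  have hJ : ∀ j, ∀ m ∈ taylorSupport (P j), (j, m) ∈ J := fun j m hm =>
    Finset.mem_biUnion.2 ⟨j, Finset.mem_univ _, Finset.mem_image_of_mem _ hm⟩
  obtain ⟨F', hF', E, hE⟩ := exists_isFibred (ev := fun z : ι → 𝕜 => evReIm z) (κ := κ ⊕ κ)
    continuous_evReIm
    (QS.image (MvPolynomial.map MvPolynomial.C) ∪
      (J.image (fun x => re' x.1 (Tm x.1 x.2)) ∪ J.image (fun x => im' x.1 (Tm x.1 x.2))) ∪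
      Finset.univ.image fun j => MvPolynomial.X (.inr j))
  let cf : Finset (MvPolynomial ι 𝕜) := J.biUnion fun x => (Tm x.1 x.2).coeffs
  obtain ⟨Q', hQ', hcell⟩ := exists_isPreconnected_signEq (𝕜 := 𝕜)
    (E ∪ QU ∪ (cf.image re ∪ cf.image im))
  refine isSemialgebraic_iff.2 ⟨Q', fun z w hzw hz => ?_⟩
  -- The cell of `z`: a connected subset of `U` on which `E` has constant signs and the vanishing of
  -- the coefficients of the `Tm j m` does not vary.
  set C : Set (ι → 𝕜) := {x | SignEq Q' x z} with hCdef
  have hzC : z ∈ C := fun _ _ => rfl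
  have hwC : w ∈ C := hzw.symm
  have hCC : ∀ x ∈ C, ∀ x' ∈ C, SignEq Q' x x' := fun x hx x' hx' =>
    SignEq.trans hx (SignEq.symm hx')
  have hCU : C ⊆ U := fun x hx => hQU z x ((SignEq.symm hx).mono
    ((Finset.subset_union_right.trans Finset.subset_union_left).trans hQ')) hz.1
  have hfib := hE C (hcell z) fun a ha x hx x' hx' => hCC x hx x' hx' a
    (hQ' (Finset.mem_union_left _ (Finset.mem_union_left _ ha)))
  -- vanishing of Taylor coefficients does not depend on the point of `C`
  have hnull : ∀ j m, ∀ x ∈ C, ∀ x' ∈ C, (Tm j m).map (MvPolynomial.eval x) = 0 →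
      (Tm j m).map (MvPolynomial.eval x') = 0 := by
    intro j m x hx x' hx' h
    by_cases hm : m ∈ taylorSupport (P j)
    · ext i
      have h1 : MvPolynomial.eval x ((Tm j m).coeff i) = 0 := by
        rw [← coeff_map, h, coeff_zero]
      rw [coeff_map, coeff_zero]
      by_cases h0 : (Tm j m).coeff i = 0
      · rw [h0, map_zero]
      have hcf : (Tm j m).coeff i ∈ cf :=
        Finset.mem_biUnion.2 ⟨(j, m), hJ j m hm, coeff_mem_coeffs h0⟩
      have h2 := hCC x hx x' hx' _ (hQ' (Finset.mem_union_right _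
        (Finset.mem_union_left _ (Finset.mem_image_of_mem re hcf))))
      have h3 := hCC x hx x' hx' _ (hQ' (Finset.mem_union_right _
        (Finset.mem_union_right _ (Finset.mem_image_of_mem im hcf))))
      simp only [(hre _ _).1, (hre _ _).2, h1, map_zero, sign_zero] at h2 h3
      exact RCLike.ext (by rw [map_zero]; exact sign_eq_zero_iff.1 h2.symm)
        (by rw [map_zero]; exact sign_eq_zero_iff.1 h3.symm)
    · have : Tm j m = 0 := taylorCoeff_eq_zero hm
      rw [this, Polynomial.map_zero]
  -- a nontrivial equation for each component of `f` over `C`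
  have hmin : ∀ j, ∃ m ∈ taylorSupport (P j), (Tm j m).map (MvPolynomial.eval z) ≠ 0 ∧
      ∀ x ∈ C, nashVal (Tm j m) x (f x j) = 0 := by
    intro j
    have hP0 : P j ≠ 0 := by
      intro h
      have := hPd j
      simp [h] at this
    obtain ⟨m₀, hm₀, hm₀'⟩ := exists_taylorCoeff_ne_zero hP0 z
    -- The lowest order that survives at `z` survives at every point of `C`, with the lower ones
    -- vanishing, so one index `m` serves all of `C`.
    obtain ⟨m, hm, hmin⟩ := Finset.exists_min_image
      ((taylorSupport (P j)).filter fun m => (Tm j m).map (MvPolynomial.eval z) ≠ 0)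
      (fun m => ∑ i, m i) ⟨m₀, Finset.mem_filter.2 ⟨hm₀, hm₀'⟩⟩
    obtain ⟨hmS, hmz⟩ := Finset.mem_filter.1 hm
    refine ⟨m, hmS, hmz, fun x hx => ?_⟩
    have hxU : U ∈ 𝓝 x := hUo.mem_nhds (hCU hx)
    refine nashVal_taylorCoeff_eq_zero (P := P j) (g := fun x => f x j) (k := ∑ i, m i) ?_ ?_ ?_ rfl
    · exact (continuous_apply j).continuousAt.comp (hf.continuousAt hxU)
    · filter_upwards [hxU] with u hu using hP j u hu
    · intro m' hm'
      by_contra hne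
      have hm'S : m' ∈ taylorSupport (P j) := by
        by_contra h
        rw [taylorCoeff_eq_zero h, Polynomial.map_zero] at hne
        exact hne rfl
      have := hmin m' (Finset.mem_filter.2 ⟨hm'S, fun h => hne (hnull j m' z hzC x hx h)⟩)
      omega
  choose m hmS hmz hmf using hmin
  -- The finitely many candidates for the value of `f` over `x`, in real coordinates.
  let Z : (ι → 𝕜) → Set (κ ⊕ κ → ℝ) := fun x =>
    {y | reIm (ofReIm 𝕜 y) = y ∧ ∀ j, nashVal (Tm j (m j)) x (ofReIm 𝕜 y j) = 0}
  have hZ : ∀ x ∈ C, (Z x).Finite := by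
    intro x hx
    have hfin : {g : κ → 𝕜 | ∀ j, g j ∈ {c : 𝕜 | nashVal (Tm j (m j)) x c = 0}}.Finite :=
      Set.Finite.pi' fun j => finite_setOfPred_isRoot
        fun h => hmz j (hnull j (m j) x hx z hzC h)
    refine (hfin.image reIm).subset fun y hy => ⟨ofReIm 𝕜 y, fun j => hy.2 j, hy.1⟩
  have hZF : ∀ x ∈ C, ∀ x' ∈ C, ∀ y ∈ Z x, ∀ y',
      MvSameSign (fun z : ι → 𝕜 => evReIm z) F' x' y' x y → y' ∈ Z x' := by
    intro x hx x' hx' y hy y' h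
    constructor
    · rw [reIm_ofReIm_iff]
      intro hI j
      have h1 := h (MvPolynomial.X (.inr j)) (hF' (Finset.mem_union_right _
        (Finset.mem_image_of_mem _ (Finset.mem_univ j))))
      have h2 := (reIm_ofReIm_iff y).1 hy.1 hI j
      simp only [mvVal, MvPolynomial.coe_eval₂Hom, MvPolynomial.eval₂_X, h2, sign_zero] at h1
      exact sign_eq_zero_iff.1 h1
    · intro j
      have hj := hJ j (m j) (hmS j)
      have h1 := h _ (hF' (Finset.mem_union_left _ (Finset.mem_union_right _
        (Finset.mem_union_left _ (Finset.mem_image_of_mem (fun x => re' x.1 (Tm x.1 x.2)) hj)))))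
      have h2 := h _ (hF' (Finset.mem_union_left _ (Finset.mem_union_right _
        (Finset.mem_union_right _ (Finset.mem_image_of_mem (fun x => im' x.1 (Tm x.1 x.2)) hj)))))
      simp only [mvVal, (hre' j _ (x', y')).1, (hre' j _ (x, y)).1, hy.2 j, map_zero,
        sign_zero] at h1
      simp only [mvVal, (hre' j _ (x', y')).2, (hre' j _ (x, y)).2, hy.2 j, map_zero,
        sign_zero] at h2
      exact RCLike.ext (by rw [map_zero]; exact sign_eq_zero_iff.1 h1)
        (by rw [map_zero]; exact sign_eq_zero_iff.1 h2)
  have hsec := hfib.mvSameSign_of_section (hcell z) hZ hZF (σ := fun x => reIm (f x))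
    (continuous_reIm.comp_continuousOn (hf.mono hCU))
    (fun x hx => ⟨by rw [ofReIm_reIm], fun j => by rw [ofReIm_reIm]; exact hmf j x hx⟩) hzC hwC
  refine ⟨hCU hwC, hQS (f z) (f w) (fun q hq => ?_) hz.2⟩
  have := hsec _ (hF' (Finset.mem_union_left _ (Finset.mem_union_left _
    (Finset.mem_image_of_mem (MvPolynomial.map MvPolynomial.C) hq))))
  have hv : ∀ x : ι → 𝕜, mvVal (fun z : ι → 𝕜 => evReIm z) (MvPolynomial.map MvPolynomial.C q) x
      (reIm (f x)) = evReIm (f x) q := by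
    intro x
    have hC : (evReIm x).comp (MvPolynomial.C : ℝ →+* MvPolynomial (ι ⊕ ι) ℝ) = RingHom.id ℝ := by
      ext r
      simp [evReIm]
    simp only [mvVal, evReIm, MvPolynomial.coe_eval₂Hom, MvPolynomial.eval₂_map]
    rw [show (MvPolynomial.eval (reIm x)).comp MvPolynomial.C = RingHom.id ℝ from hC]
    exact MvPolynomial.eval₂_id _
  rwa [hv, hv] at this

end Nash

/-! ### Algebraic analytic functions -/

section AlgebraicFunctions

variable {𝕜 : Type*} [RCLike 𝕜] {ι κ : Type*} [Fintype ι] [Fintype κ]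

/-- The ring of analytic functions on `B`. -/
def AnalyticFun (B : Set (ι → 𝕜)) : Subalgebra 𝕜 (B → 𝕜) where
  carrier := {f | ∃ F : (ι → 𝕜) → 𝕜, AnalyticOnNhd 𝕜 F B ∧ ∀ u : B, f u = F u}
  mul_mem' := by
    rintro f g ⟨F, hF, hf⟩ ⟨G, hG, hg⟩
    exact ⟨F * G, hF.mul hG, fun u => by simp [hf, hg]⟩
  add_mem' := by
    rintro f g ⟨F, hF, hf⟩ ⟨G, hG, hg⟩
    exact ⟨F + G, hF.add hG, fun u => by simp [hf, hg]⟩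
  algebraMap_mem' c := ⟨fun _ => c, analyticOnNhd_const, fun _ => rfl⟩

/-- The restriction of an analytic function to `B`. -/
def AnalyticFun.mk {B : Set (ι → 𝕜)} (F : (ι → 𝕜) → 𝕜) (hF : AnalyticOnNhd 𝕜 F B) :
    AnalyticFun B := ⟨fun u => F u, F, hF, fun _ => rfl⟩

/-- Evaluation of analytic functions at a point. -/
def AnalyticFun.ev {B : Set (ι → 𝕜)} (u : B) : AnalyticFun B →ₐ[𝕜] 𝕜 :=
  (Pi.evalAlgHom 𝕜 (fun _ : B => 𝕜) u).comp (AnalyticFun B).val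

@[simp]
theorem AnalyticFun.ev_mk {B : Set (ι → 𝕜)} (F : (ι → 𝕜) → 𝕜) (hF : AnalyticOnNhd 𝕜 F B) (u : B) :
    AnalyticFun.ev u (AnalyticFun.mk F hF) = F u := rfl

theorem AnalyticFun.ext {B : Set (ι → 𝕜)} {f g : AnalyticFun B}
    (h : ∀ u, AnalyticFun.ev u f = AnalyticFun.ev u g) : f = g := Subtype.ext (funext h)

theorem AnalyticFun.exists_mk {B : Set (ι → 𝕜)} (f : AnalyticFun B) :
    ∃ F, ∃ hF : AnalyticOnNhd 𝕜 F B, f = AnalyticFun.mk F hF := by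
  obtain ⟨f, F, hF, h⟩ := f
  exact ⟨F, hF, AnalyticFun.ext fun u => h u⟩

/-- By the identity theorem: where one factor is nonzero, the other vanishes on a neighbourhood,
hence on all of the connected set `B`. -/
theorem AnalyticFun.isDomain {B : Set (ι → 𝕜)} (hBo : IsOpen B) (hB : IsPreconnected B)
    (hne : B.Nonempty) : IsDomain (AnalyticFun B) := by
  have hnt : Nontrivial (AnalyticFun B) := by
    obtain ⟨u, hu⟩ := hne
    refine ⟨0, 1, fun h => ?_⟩
    have := congrArg (AnalyticFun.ev ⟨u, hu⟩) h
    simp at this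
  have hnz : NoZeroDivisors (AnalyticFun B) := by
    refine ⟨fun {f g} h => ?_⟩
    obtain ⟨F, hF, rfl⟩ := AnalyticFun.exists_mk f
    obtain ⟨G, hG, rfl⟩ := AnalyticFun.exists_mk g
    have hFG : ∀ u ∈ B, F u * G u = 0 := fun u hu => by
      simpa using congrArg (AnalyticFun.ev ⟨u, hu⟩) h
    by_cases hF0 : ∀ u ∈ B, F u = 0
    · exact .inl (AnalyticFun.ext fun u => by simpa using hF0 u u.2)
    · push Not at hF0
      obtain ⟨u, hu, hu0⟩ := hF0
      right
      have hG0 : G =ᶠ[𝓝 u] 0 := by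
        filter_upwards [(hF u hu).continuousAt.eventually_ne hu0, hBo.mem_nhds hu] with v hv hvB
        exact (mul_eq_zero.1 (hFG v hvB)).resolve_left hv
      have := hG.eqOn_zero_of_preconnected_of_eventuallyEq_zero hB hu hG0
      exact AnalyticFun.ext fun u => by simpa using this u.2
  exact NoZeroDivisors.to_isDomain _

/-- The coordinate functions. -/
def AnalyticFun.coord {B : Set (ι → 𝕜)} (i : ι) : AnalyticFun B :=
  AnalyticFun.mk (fun u => u i) fun u _ => (ContinuousLinearMap.proj (R := 𝕜) i).analyticAt u

noncomputable instance {B : Set (ι → 𝕜)} : Algebra (MvPolynomial ι 𝕜) (AnalyticFun B) :=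
  (MvPolynomial.aeval AnalyticFun.coord).toRingHom.toAlgebra

theorem AnalyticFun.ev_algebraMap {B : Set (ι → 𝕜)} (u : B) (p : MvPolynomial ι 𝕜) :
    AnalyticFun.ev u (algebraMap (MvPolynomial ι 𝕜) (AnalyticFun B) p) =
      MvPolynomial.eval u.1 p := by
  have : (AnalyticFun.ev u : AnalyticFun B →+* 𝕜).comp
      (algebraMap (MvPolynomial ι 𝕜) (AnalyticFun B)) = MvPolynomial.eval u.1 := by
    refine MvPolynomial.ringHom_ext (fun c => ?_) fun i => ?_
    · simp [RingHom.algebraMap_toAlgebra]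
    · simp only [RingHom.algebraMap_toAlgebra]
      simp [AnalyticFun.coord]
      rfl
  exact congrArg (fun h => h p) this

instance {B : Set (ι → 𝕜)} : IsScalarTower 𝕜 (MvPolynomial ι 𝕜) (AnalyticFun B) :=
  IsScalarTower.of_algebraMap_eq fun c => AnalyticFun.ext fun u => by
    rw [AnalyticFun.ev_algebraMap]
    simp

theorem MvPolynomial.eq_zero_of_eval_eq_zero_of_isOpen {B : Set (ι → 𝕜)} (hB : IsOpen B) (hne : B.Nonempty)
    {p : MvPolynomial ι 𝕜} (h : ∀ u ∈ B, MvPolynomial.eval u p = 0) : p = 0 := by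
  obtain ⟨u, hu⟩ := hne
  refine MvPolynomial.funext fun x => ?_
  have hev : (fun v => MvPolynomial.eval v p) =ᶠ[𝓝 u] 0 := by
    filter_upwards [hB.mem_nhds hu] with v hv using h v hv
  have := (AnalyticOnNhd.eval_mvPolynomial p).eqOn_zero_of_preconnected_of_eventuallyEq_zero
    isPreconnected_univ (mem_univ u) hev (mem_univ x)
  simpa using this

theorem AnalyticFun.algebraMap_injective {B : Set (ι → 𝕜)} (hB : IsOpen B) (hne : B.Nonempty) :
    Function.Injective (algebraMap (MvPolynomial ι 𝕜) (AnalyticFun B)) := by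
  rw [injective_iff_map_eq_zero]
  intro p hp
  refine MvPolynomial.eq_zero_of_eval_eq_zero_of_isOpen hB hne fun u hu => ?_
  rw [← AnalyticFun.ev_algebraMap ⟨u, hu⟩, hp, map_zero]

/-- A nonzero equation is enough. -/
theorem isAlgebraicOn_of_ne_zero {f : (ι → 𝕜) → 𝕜} {U V : Set (ι → 𝕜)} (hV : IsOpen V)
    (hne : V.Nonempty) (hVU : V ⊆ U) {P : (MvPolynomial ι 𝕜)[X]} (hP : P ≠ 0)
    (h : ∀ u ∈ U, nashVal P u (f u) = 0) : IsAlgebraicOn f U := by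
  refine ⟨P, Nat.pos_of_ne_zero fun h0 => hP ?_, h⟩
  rw [eq_C_of_natDegree_eq_zero h0] at h ⊢
  rw [MvPolynomial.eq_zero_of_eval_eq_zero_of_isOpen hV hne (p := P.coeff 0) fun u hu => by
    simpa [nashVal] using h u (hVU hu), C_0]

theorem AnalyticFun.ev_aeval {B : Set (ι → 𝕜)} (u : B) (P : (MvPolynomial ι 𝕜)[X])
    (f : AnalyticFun B) :
    AnalyticFun.ev u (aeval f P) = nashVal P u.1 (AnalyticFun.ev u f) := by
  have h := hom_eval₂ P (algebraMap (MvPolynomial ι 𝕜) (AnalyticFun B))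
    (AnalyticFun.ev u : AnalyticFun B →+* 𝕜) f
  have h2 : (AnalyticFun.ev u : AnalyticFun B →+* 𝕜).comp
      (algebraMap (MvPolynomial ι 𝕜) (AnalyticFun B)) = MvPolynomial.eval u.1 :=
    RingHom.ext fun p => AnalyticFun.ev_algebraMap u p
  rw [h2] at h
  rw [nashVal, eval_map]
  exact h

/-- The bridge to commutative algebra, which makes algebraic closures and transcendence bases
available. -/
theorem isAlgebraicOn_iff {B : Set (ι → 𝕜)} (hB : IsOpen B) (hne : B.Nonempty)
    {f : (ι → 𝕜) → 𝕜} (hf : AnalyticOnNhd 𝕜 f B) :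
    IsAlgebraicOn f B ↔ IsAlgebraic (MvPolynomial ι 𝕜) (AnalyticFun.mk f hf) := by
  constructor
  · rintro ⟨P, hP, h⟩
    refine ⟨P, fun h0 => by simp [h0] at hP, AnalyticFun.ext fun u => ?_⟩
    rw [AnalyticFun.ev_aeval, map_zero]
    exact h u u.2
  · rintro ⟨P, hP, h⟩
    refine isAlgebraicOn_of_ne_zero hB hne subset_rfl hP fun u hu => ?_
    have := congrArg (AnalyticFun.ev ⟨u, hu⟩) h
    rwa [AnalyticFun.ev_aeval, map_zero] at this

/-- The composition of algebraic analytic functions is algebraic. -/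
theorem IsAlgebraicOn.comp {B : Set (ι → 𝕜)} (hBo : IsOpen B) (hB : IsPreconnected B)
    {f : (ι → 𝕜) → (κ → 𝕜)} (hf : ∀ j, AnalyticOnNhd 𝕜 (fun u => f u j) B)
    (hfa : ∀ j, IsAlgebraicOn (fun u => f u j) B) {V : Set (κ → 𝕜)} (hV : IsOpen V)
    (hfV : MapsTo f B V) {g : (κ → 𝕜) → 𝕜} (hg : AnalyticOnNhd 𝕜 g V) (hga : IsAlgebraicOn g V) :
    IsAlgebraicOn (fun u => g (f u)) B := by
  classical
  rcases B.eq_empty_or_nonempty with rfl | hne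
  · exact ⟨X, by simp, by simp⟩
  have hdom := AnalyticFun.isDomain hBo hB hne
  have hgf : AnalyticOnNhd 𝕜 (fun u => g (f u)) B := fun u hu =>
    (hg (f u) (hfV hu)).comp (analyticAt_pi_iff.2 fun j => hf j u hu)
  obtain ⟨P, hP, hPg⟩ := hga
  have hP0 : P ≠ 0 := by rintro rfl; simp at hP
  -- an equation that does not vanish identically along `f`
  obtain ⟨Q, hQ0, hQ⟩ : ∃ Q : (MvPolynomial κ 𝕜)[X],
      (∃ u ∈ B, Q.map (MvPolynomial.eval (f u)) ≠ 0) ∧ ∀ u ∈ B, nashVal Q (f u) (g (f u)) = 0 := by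
    obtain ⟨u₀, hu₀⟩ := hne
    obtain ⟨m₀, hm₀, hm₀'⟩ := exists_taylorCoeff_ne_zero hP0 (f u₀)
    -- Minimal order among the Taylor coefficients that are not identically zero along `f`; all
    -- those of lower order vanish at every `f u`.
    obtain ⟨m, hm, hmin⟩ := Finset.exists_min_image ((taylorSupport P).filter fun m =>
      ∃ u ∈ B, (taylorCoeff P m).map (MvPolynomial.eval (f u)) ≠ 0) (fun m => ∑ i, m i)
      ⟨m₀, Finset.mem_filter.2 ⟨hm₀, u₀, hu₀, hm₀'⟩⟩
    obtain ⟨hmS, hmu⟩ := Finset.mem_filter.1 hm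
    refine ⟨taylorCoeff P m, hmu, fun u hu => ?_⟩
    refine nashVal_taylorCoeff_eq_zero (P := P) (k := ∑ i, m i) (hg _ (hfV hu)).continuousAt ?_ ?_ rfl
    · filter_upwards [hV.mem_nhds (hfV hu)] with x hx using hPg x hx
    · intro m' hm'
      by_contra hne
      have hm'S : m' ∈ taylorSupport P := by
        by_contra h
        rw [taylorCoeff_eq_zero h, Polynomial.map_zero] at hne
        exact hne rfl
      have := hmin m' (Finset.mem_filter.2 ⟨hm'S, u, hu, hne⟩)
      omega
  rw [isAlgebraicOn_iff hBo hne hgf]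
  -- The components of `f` lie in `S`, so `Q` along `f` is a nonzero polynomial over `S` with root
  -- `g ∘ f`, and algebraicity is transitive.
  let S := Subalgebra.algebraicClosure (MvPolynomial ι 𝕜) (AnalyticFun B)
  let φ : MvPolynomial κ 𝕜 →ₐ[𝕜] AnalyticFun B :=
    MvPolynomial.aeval fun j => AnalyticFun.mk _ (hf j)
  have hφ : ∀ p, φ p ∈ S := by
    intro p
    induction p using MvPolynomial.induction_on with
    | C c =>
      have : φ (MvPolynomial.C c) = algebraMap (MvPolynomial ι 𝕜) _ (MvPolynomial.C c) := by
        refine AnalyticFun.ext fun u => ?_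
        rw [AnalyticFun.ev_algebraMap]
        simp [φ]
      rw [this]
      exact S.algebraMap_mem _
    | add p q hp hq => rw [map_add]; exact S.add_mem hp hq
    | mul_X p j hp =>
      rw [map_mul]
      refine S.mul_mem hp ?_
      rw [show φ (MvPolynomial.X j) = AnalyticFun.mk _ (hf j) by simp [φ]]
      exact (isAlgebraicOn_iff hBo hne (hf j)).1 (hfa j)
  let ψ : MvPolynomial κ 𝕜 →+* S := (φ : MvPolynomial κ 𝕜 →+* AnalyticFun B).codRestrict S hφ
  have hev : ∀ u : B, (AnalyticFun.ev u : AnalyticFun B →+* 𝕜).comp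
      ((algebraMap S (AnalyticFun B)).comp ψ) = MvPolynomial.eval (f u) := by
    intro u
    refine MvPolynomial.ringHom_ext (fun c => ?_) fun i => ?_
    · change AnalyticFun.ev u (φ (MvPolynomial.C c)) = _
      simp [φ]
    · change AnalyticFun.ev u (φ (MvPolynomial.X i)) = _
      simp [φ]
  have halg : IsAlgebraic S (AnalyticFun.mk _ hgf) := by
    refine ⟨Q.map ψ, fun h0 => ?_, AnalyticFun.ext fun u => ?_⟩
    · obtain ⟨u, hu, hu'⟩ := hQ0
      apply hu'
      rw [← hev ⟨u, hu⟩, ← RingHom.comp_assoc, ← Polynomial.map_map, h0, Polynomial.map_zero]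
    · rw [map_zero, aeval_def, eval₂_map]
      have h := hom_eval₂ Q ((algebraMap S (AnalyticFun B)).comp ψ)
        (AnalyticFun.ev u : AnalyticFun B →+* 𝕜) (AnalyticFun.mk _ hgf)
      rw [hev u] at h
      have h2 := hQ u u.2
      rw [nashVal, eval_map] at h2
      exact h.trans h2
  exact halg.restrictScalars _

set_option maxHeartbeats 1000000 in
/-- The inverse of an algebraic analytic map of an open set onto its image is algebraic. -/
theorem isAlgebraicOn_inverse {B : Set (ι → 𝕜)} (hBo : IsOpen B) (hB : IsPreconnected B)
    {f : (ι → 𝕜) → (ι → 𝕜)} (hf : ∀ j, AnalyticOnNhd 𝕜 (fun u => f u j) B)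
    (hfa : ∀ j, IsAlgebraicOn (fun u => f u j) B) (hfB : IsOpen (f '' B))
    {g : (ι → 𝕜) → (ι → 𝕜)} (hgf : ∀ u ∈ B, g (f u) = u) (i : ι) :
    IsAlgebraicOn (fun v => g v i) (f '' B) := by
  rcases B.eq_empty_or_nonempty with rfl | hne
  · exact ⟨X, by simp, by simp⟩
  have hdom := AnalyticFun.isDomain hBo hB hne
  let S := Subalgebra.algebraicClosure (MvPolynomial ι 𝕜) (AnalyticFun B)
  have hinj : Function.Injective (algebraMap (MvPolynomial ι 𝕜) S) :=
    Function.Injective.of_comp (f := algebraMap S (AnalyticFun B))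
      (AnalyticFun.algebraMap_injective hBo hne)
  have hfaith : FaithfulSMul (MvPolynomial ι 𝕜) S := (faithfulSMul_iff_algebraMap_injective _ _).2 hinj
  let x : ι → S := fun j => ⟨AnalyticFun.mk _ (hf j), (isAlgebraicOn_iff hBo hne (hf j)).1 (hfa j)⟩
  have hev : ∀ (u : B) p, AnalyticFun.ev u (MvPolynomial.aeval x p : S).1 =
      MvPolynomial.eval (f u) p := by
    intro u p
    induction p using MvPolynomial.induction_on with
    | C c =>
      rw [MvPolynomial.aeval_C, MvPolynomial.eval_C]
      exact (AnalyticFun.ev u).commutes c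
    | add p q hp hq => rw [map_add, map_add, ← hp, ← hq]; rfl
    | mul_X p j hp =>
      rw [map_mul, map_mul, ← hp, MvPolynomial.aeval_X, MvPolynomial.eval_X]; rfl
  -- A relation between the components of `f` would be a polynomial vanishing on the open set `f ''
  -- B`.
  have hx : AlgebraicIndependent 𝕜 x := by
    rw [algebraicIndependent_iff]
    intro p hp
    refine MvPolynomial.eq_zero_of_eval_eq_zero_of_isOpen hfB (hne.image f) ?_
    rintro _ ⟨u, hu, rfl⟩
    rw [← hev ⟨u, hu⟩, hp]
    exact map_zero (AnalyticFun.ev ⟨u, hu⟩)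
  have hbase : IsTranscendenceBasis 𝕜 (algebraMap (MvPolynomial ι 𝕜) S ∘ MvPolynomial.X) :=
    (IsTranscendenceBasis.mvPolynomial ι 𝕜).algebraMap_comp
  -- The coordinates form a transcendence basis of `S` with the same finite number of elements.
  -- Hence each coordinate is algebraic over `𝕜[f]`, and reading its equation at `v = f u` gives one
  -- for `g`.
  have hxb : IsTranscendenceBasis 𝕜 x :=
    hx.isTranscendenceBasis_of_lift_trdeg_le_of_finite hbase.lift_cardinalMk_eq_trdeg.ge
  have halg := hxb.isAlgebraic.isAlgebraic (algebraMap (MvPolynomial ι 𝕜) S (MvPolynomial.X i))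
  obtain ⟨p, hp0, hp⟩ := halg
  let e := hx.aevalEquiv
  let P : (MvPolynomial ι 𝕜)[X] := p.map (e.symm : _ →+* MvPolynomial ι 𝕜)
  have hP0 : P ≠ 0 := (Polynomial.map_ne_zero_iff e.symm.injective).2 hp0
  refine isAlgebraicOn_of_ne_zero hfB (hne.image f) subset_rfl hP0 ?_
  rintro _ ⟨u, hu, rfl⟩
  rw [hgf u hu, nashVal, eval_map]
  have h1 : (MvPolynomial.eval (f u)).comp (e.symm : _ →+* MvPolynomial ι 𝕜) =
      (AnalyticFun.ev ⟨u, hu⟩ : AnalyticFun B →+* 𝕜).comp ((algebraMap S (AnalyticFun B)).comp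
        (algebraMap (Algebra.adjoin 𝕜 (range x)) S)) := by
    ext q
    obtain ⟨q, rfl⟩ := e.surjective q
    have := hev ⟨u, hu⟩ q
    rw [← hx.algebraMap_aevalEquiv] at this
    simpa using! this.symm
  rw [eval₂_map, h1]
  have h2 := congrArg (fun s : S => AnalyticFun.ev ⟨u, hu⟩ s.1) hp
  have h3 := hom_eval₂ p (algebraMap (Algebra.adjoin 𝕜 (range x)) S)
    ((AnalyticFun.ev ⟨u, hu⟩ : AnalyticFun B →+* 𝕜).comp (algebraMap S (AnalyticFun B)))
    (algebraMap (MvPolynomial ι 𝕜) S (MvPolynomial.X i))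
  have h4 : ((AnalyticFun.ev ⟨u, hu⟩ : AnalyticFun B →+* 𝕜).comp (algebraMap S (AnalyticFun B)))
      (algebraMap (MvPolynomial ι 𝕜) S (MvPolynomial.X i)) = u i := by
    have := AnalyticFun.ev_algebraMap ⟨u, hu⟩ (MvPolynomial.X i : MvPolynomial ι 𝕜)
    rwa [MvPolynomial.eval_X] at this
  rw [h4] at h3
  exact h3.symm.trans (h2.trans (map_zero (AnalyticFun.ev (⟨u, hu⟩ : B))))

end AlgebraicFunctions

/-! ### Germs of Nash maps -/

section NashGerms

variable {𝕜 : Type*} [RCLike 𝕜] {ι κ ν : Type*} [Fintype ι] [Fintype κ] [Fintype ν]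

/-- In the sup norm a ball is a product of intervals or discs, given by one quadratic inequality per
coordinate. -/
lemma isSemialgebraic_ball (u : ι → 𝕜) {r : ℝ} (hr : 0 < r) :
    IsSemialgebraic (Metric.ball u r) := by
  have h : Metric.ball u r = ⋂ i ∈ (Finset.univ : Finset ι),
      {z : ι → 𝕜 | 0 < MvPolynomial.eval
        (Sum.elim (fun i => RCLike.re (z i)) (fun i => RCLike.im (z i)))
        (MvPolynomial.C (r ^ 2) - (MvPolynomial.X (Sum.inl i) - MvPolynomial.C (RCLike.re (u i))) ^ 2
          - (MvPolynomial.X (Sum.inr i) - MvPolynomial.C (RCLike.im (u i))) ^ 2)} := by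
    ext z
    simp only [Metric.mem_ball, Set.mem_iInter, Finset.mem_univ, forall_true_left,
      Set.mem_ofPred_eq, dist_pi_lt_iff hr]
    refine forall_congr' fun i => ?_
    have h2 : dist (z i) (u i) ^ 2 = (RCLike.re (z i) - RCLike.re (u i)) ^ 2
        + (RCLike.im (z i) - RCLike.im (u i)) ^ 2 := by
      rw [dist_eq_norm, RCLike.norm_sq_eq_def, map_sub, map_sub]
      ring
    rw [← sq_lt_sq₀ dist_nonneg hr.le, h2]
    simp only [map_sub, map_pow, MvPolynomial.eval_C, MvPolynomial.eval_X, Sum.elim_inl,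
      Sum.elim_inr]
    constructor <;> intro h <;> linarith
  rw [h]
  exact isSemialgebraic_biInter _ _ fun i _ => IsSemialgebraic.pos _

lemma IsAlgebraicOn.mono {f : (ι → 𝕜) → 𝕜} {U V : Set (ι → 𝕜)} (h : IsAlgebraicOn f U)
    (hV : V ⊆ U) : IsAlgebraicOn f V :=
  let ⟨P, hP, h⟩ := h
  ⟨P, hP, fun u hu => h u (hV hu)⟩

lemma IsAlgebraicOn.congr {f g : (ι → 𝕜) → 𝕜} {U : Set (ι → 𝕜)} (h : IsAlgebraicOn f U)
    (hfg : EqOn f g U) : IsAlgebraicOn g U :=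
  let ⟨P, hP, h⟩ := h
  ⟨P, hP, fun u hu => hfg hu ▸ h u hu⟩

lemma IsNashOn.mono {f : (ι → 𝕜) → (κ → 𝕜)} {U V : Set (ι → 𝕜)} (h : IsNashOn f U)
    (hVU : V ⊆ U) (hV : IsOpen V) (hVs : IsSemialgebraic V) : IsNashOn f V :=
  ⟨hV, hVs, h.analytic.mono hVU, fun j => (h.algebraic j).mono hVU⟩

lemma IsNashOn.congr {f g : (ι → 𝕜) → (κ → 𝕜)} {U : Set (ι → 𝕜)} (h : IsNashOn f U)
    (hfg : EqOn f g U) : IsNashOn g U :=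
  ⟨h.isOpen, h.isSemialgebraic, h.analytic.congr h.isOpen hfg,
    fun j => (h.algebraic j).congr fun _ hu => congrFun (hfg hu) j⟩

/-- `f` is a Nash map in a neighbourhood of `u`. -/
def IsNashAt (f : (ι → 𝕜) → (κ → 𝕜)) (u : ι → 𝕜) : Prop :=
  ∃ V, u ∈ V ∧ IsNashOn f V

lemma IsNashAt.eventually_isNashOn_ball {f : (ι → 𝕜) → (κ → 𝕜)} {u : ι → 𝕜} (h : IsNashAt f u) :
    ∀ᶠ r in 𝓝[>] (0 : ℝ), IsNashOn f (Metric.ball u r) := by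
  obtain ⟨V, hu, hV⟩ := h
  obtain ⟨r, hr, hrV⟩ := Metric.isOpen_iff.1 hV.isOpen u hu
  filter_upwards [Ioc_mem_nhdsGT hr] with s hs
  exact hV.mono ((Metric.ball_subset_ball hs.2).trans hrV) Metric.isOpen_ball
    (isSemialgebraic_ball u hs.1)

lemma IsNashAt.exists_ball {f : (ι → 𝕜) → (κ → 𝕜)} {u : ι → 𝕜} (h : IsNashAt f u)
    {V : Set (ι → 𝕜)} (hV : V ∈ 𝓝 u) :
    ∃ r > 0, Metric.ball u r ⊆ V ∧ IsNashOn f (Metric.ball u r) := by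
  obtain ⟨r, ⟨h1, h2⟩, h3⟩ := ((h.eventually_isNashOn_ball.and
    ((eventually_ball_subset hV).filter_mono nhdsWithin_le_nhds)).and
    self_mem_nhdsWithin).exists
  exact ⟨r, h3, h2, h1⟩

lemma IsNashAt.analyticAt {f : (ι → 𝕜) → (κ → 𝕜)} {u : ι → 𝕜} (h : IsNashAt f u) :
    AnalyticAt 𝕜 f u :=
  let ⟨_, hu, hV⟩ := h
  hV.analytic u hu

lemma IsNashAt.congr {f g : (ι → 𝕜) → (κ → 𝕜)} {u : ι → 𝕜} (h : IsNashAt f u)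
    (hfg : f =ᶠ[𝓝 u] g) : IsNashAt g u := by
  obtain ⟨r, hr, hrV, hN⟩ := h.exists_ball hfg
  exact ⟨_, Metric.mem_ball_self hr, hN.congr hrV⟩

/-- Passing to a small ball provides a connected semialgebraic domain, so no preimage has to be
shown semialgebraic. -/
lemma IsNashAt.comp {f : (ι → 𝕜) → (κ → 𝕜)} {g : (κ → 𝕜) → (ν → 𝕜)} {u : ι → 𝕜}
    (hg : IsNashAt g (f u)) (hf : IsNashAt f u) : IsNashAt (fun x => g (f x)) u := by
  obtain ⟨V, hu, hV⟩ := hg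
  obtain ⟨r, hr, hrV, hN⟩ := hf.exists_ball
    (hf.analyticAt.continuousAt.preimage_mem_nhds (hV.isOpen.mem_nhds hu))
  refine ⟨_, Metric.mem_ball_self hr, Metric.isOpen_ball, isSemialgebraic_ball u hr,
    fun x hx => (hV.analytic _ (hrV hx)).comp (hN.analytic x hx), fun j => ?_⟩
  exact IsAlgebraicOn.comp Metric.isOpen_ball Metric.isPreconnected_ball
    (fun i => (analyticOnNhd_pi_iff.1 hN.analytic i)) hN.algebraic hV.isOpen hrV
    (analyticOnNhd_pi_iff.1 hV.analytic j) (hV.algebraic j)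

/-- The analyticity of `g` is assumed; its algebraicity comes from `isAlgebraicOn_inverse` on a
ball, whose image is open because it equals a preimage under `g`. -/
lemma IsNashAt.inverse {f g : (ι → 𝕜) → (ι → 𝕜)} {u : ι → 𝕜} (hf : IsNashAt f u)
    (hg : AnalyticAt 𝕜 g (f u)) (hgf : ∀ᶠ x in 𝓝 u, g (f x) = x)
    (hfg : ∀ᶠ y in 𝓝 (f u), f (g y) = y) : IsNashAt g (f u) := by
  obtain ⟨V, hV, hVo, huV⟩ := eventually_nhds_iff.1 (hfg.and hg.eventually_analyticAt)
  obtain ⟨r, hr, hrV, hN⟩ := hf.exists_ball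
    (inter_mem (hf.analyticAt.continuousAt.preimage_mem_nhds (hVo.mem_nhds huV)) hgf)
  have himg : f '' Metric.ball u r = V ∩ g ⁻¹' Metric.ball u r := by
    ext y
    constructor
    · rintro ⟨x, hx, rfl⟩
      exact ⟨(hrV hx).1, by rw [mem_preimage, (hrV hx).2]; exact hx⟩
    · rintro ⟨hy, hgy⟩
      exact ⟨g y, hgy, (hV y hy).1⟩
  have hopen : IsOpen (f '' Metric.ball u r) := by
    rw [himg]
    exact ContinuousOn.isOpen_inter_preimage (fun y hy => (hV y hy).2.continuousAt.continuousWithinAt)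
      hVo Metric.isOpen_ball
  have halg := isAlgebraicOn_inverse (g := g) Metric.isOpen_ball Metric.isPreconnected_ball
    (fun i => analyticOnNhd_pi_iff.1 hN.analytic i) hN.algebraic hopen (fun x hx => (hrV hx).2)
  obtain ⟨s, hs, hsV⟩ := Metric.isOpen_iff.1 hopen (f u) ⟨u, Metric.mem_ball_self hr, rfl⟩
  exact ⟨_, Metric.mem_ball_self hs, Metric.isOpen_ball, isSemialgebraic_ball _ hs,
    fun y hy => (hV y (himg.subset (hsV hy)).1).2, fun j => (halg j).mono hsV⟩

end NashGerms

/-! ### Locally Nash maps as a condition on germs in charts -/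

section LocallyNash

variable {𝕜 : Type*} [RCLike 𝕜] {ι κ ν : Type*} [Fintype ι] [Fintype κ] [Fintype ν]
  {M N P : Type*} [TopologicalSpace M] [TopologicalSpace N] [TopologicalSpace P]
  {𝒜 : Set (OpenPartialHomeomorph M (ι → 𝕜))} {ℬ : Set (OpenPartialHomeomorph N (κ → 𝕜))}
  {𝒞 : Set (OpenPartialHomeomorph P (ν → 𝕜))}

/-- Given a Nash germ, the neighbourhood required by the definition is the part of the chart lying
over a small ball, whose image is semialgebraic. -/
lemma isLocallyNashOn_iff {f : M → N} {W : Set M} (hW : IsOpen W) :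
    IsLocallyNashOn 𝒜 ℬ f W ↔ ContinuousOn f W ∧ ∀ a ∈ W, ∀ ψ ∈ ℬ, f a ∈ ψ.source →
      ∃ φ ∈ 𝒜, a ∈ φ.source ∧ IsNashAt (fun x => ψ (f (φ.symm x))) (φ a) := by
  refine and_congr_right fun hc => forall₂_congr fun a ha => forall₃_congr fun ψ _ hψ =>
    exists_congr fun φ => and_congr_right fun _ => ?_
  constructor
  · rintro ⟨U, _, haU, _, hUφ, _, hN⟩
    exact ⟨hUφ haU, _, mem_image_of_mem φ haU, hN⟩
  · rintro ⟨haφ, hN⟩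
    have hca : ContinuousAt f a := hc.continuousAt (hW.mem_nhds ha)
    obtain ⟨r, hr, hrV, hN⟩ := hN.exists_ball (V := φ.target ∩ φ.symm ⁻¹' (W ∩ f ⁻¹' ψ.source))
      (inter_mem (φ.open_target.mem_nhds (φ.map_source haφ))
        ((φ.symm.continuousAt (φ.map_source haφ)).preimage_mem_nhds
          (by
            rw [φ.left_inv haφ]
            exact inter_mem (hW.mem_nhds ha) (hca.preimage_mem_nhds (ψ.open_source.mem_nhds hψ)))))
    have himg : φ '' (φ.source ∩ φ ⁻¹' Metric.ball (φ a) r) = Metric.ball (φ a) r := by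
      rw [φ.image_source_inter_eq']
      ext x
      constructor
      · rintro ⟨h1, h2⟩
        simpa [φ.right_inv h1] using h2
      · intro hx
        exact ⟨(hrV hx).1, by simpa [φ.right_inv (hrV hx).1] using hx⟩
    refine ⟨φ.source ∩ φ ⁻¹' Metric.ball (φ a) r,
      φ.isOpen_inter_preimage Metric.isOpen_ball, ⟨haφ, Metric.mem_ball_self hr⟩, ?_,
      inter_subset_left, ?_, by rwa [himg]⟩
    · rintro x ⟨hx, hxr⟩
      simpa [φ.left_inv hx] using (hrV hxr).2.1
    · rintro x ⟨hx, hxr⟩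
      simpa [φ.left_inv hx] using (hrV hxr).2.2

lemma isLocallyNash_iff {f : M → N} :
    IsLocallyNash 𝒜 ℬ f ↔ Continuous f ∧ ∀ a, ∀ ψ ∈ ℬ, f a ∈ ψ.source →
      ∃ φ ∈ 𝒜, a ∈ φ.source ∧ IsNashAt (fun x => ψ (f (φ.symm x))) (φ a) := by
  rw [IsLocallyNash, isLocallyNashOn_iff isOpen_univ, continuousOn_univ]
  simp

lemma IsLocallyNash.continuous {f : M → N} (hf : IsLocallyNash 𝒜 ℬ f) : Continuous f :=
  (isLocallyNash_iff.1 hf).1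

/-- Composition of Nash germs in charts. -/
lemma IsNashAt.comp_charts {φ : OpenPartialHomeomorph M (ι → 𝕜)}
    {ψ : OpenPartialHomeomorph N (κ → 𝕜)} {χ : OpenPartialHomeomorph P (ν → 𝕜)}
    {f : M → N} {g : N → P} {a : M} (ha : a ∈ φ.source) (hfa : f a ∈ ψ.source)
    (hfc : ContinuousAt f a)
    (hg : IsNashAt (fun y => χ (g (ψ.symm y))) (ψ (f a)))
    (hf : IsNashAt (fun x => ψ (f (φ.symm x))) (φ a)) :
    IsNashAt (fun x => χ (g (f (φ.symm x)))) (φ a) := by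
  have h : IsNashAt (fun x => χ (g (ψ.symm (ψ (f (φ.symm x)))))) (φ a) :=
    IsNashAt.comp (g := fun y => χ (g (ψ.symm y))) (by simpa only [φ.left_inv ha] using hg) hf
  refine h.congr ?_
  have hc : Tendsto (fun x => f (φ.symm x)) (𝓝 (φ a)) (𝓝 (f a)) := by
    have := φ.tendsto_symm ha
    exact hfc.tendsto.comp this
  filter_upwards [hc (ψ.open_source.mem_nhds hfa)] with x hx
  rw [ψ.left_inv hx]

lemma IsLocallyNashOn.comp {f : M → N} {g : N → P} {W : Set M} {W' : Set N} (hW : IsOpen W)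
    (hW' : IsOpen W') (hg : IsLocallyNashOn ℬ 𝒞 g W') (hf : IsLocallyNashOn 𝒜 ℬ f W)
    (hfW : MapsTo f W W') : IsLocallyNashOn 𝒜 𝒞 (g ∘ f) W := by
  rw [isLocallyNashOn_iff hW] at hf ⊢
  rw [isLocallyNashOn_iff hW'] at hg
  refine ⟨hg.1.comp hf.1 hfW, fun a ha χ hχ hgf => ?_⟩
  obtain ⟨ψ, hψ, haψ, hgN⟩ := hg.2 (f a) (hfW ha) χ hχ hgf
  obtain ⟨φ, hφ, haφ, hfN⟩ := hf.2 a ha ψ hψ haψ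
  exact ⟨φ, hφ, haφ, IsNashAt.comp_charts haφ haψ (hf.1.continuousAt (hW.mem_nhds ha)) hgN hfN⟩

lemma IsLocallyNash.comp {f : M → N} {g : N → P} (hg : IsLocallyNash ℬ 𝒞 g)
    (hf : IsLocallyNash 𝒜 ℬ f) : IsLocallyNash 𝒜 𝒞 (g ∘ f) :=
  IsLocallyNashOn.comp isOpen_univ isOpen_univ hg hf (mapsTo_univ _ _)

/-- Being locally Nash is a local property. -/
lemma isLocallyNash_of_locally {f : M → N}
    (h : ∀ a, ∃ W, IsOpen W ∧ a ∈ W ∧ IsLocallyNashOn 𝒜 ℬ f W) : IsLocallyNash 𝒜 ℬ f := by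
  rw [isLocallyNash_iff]
  refine ⟨continuous_iff_continuousAt.2 fun a => ?_, fun a ψ hψ hfa => ?_⟩
  · obtain ⟨W, hW, ha, h⟩ := h a
    exact h.1.continuousAt (hW.mem_nhds ha)
  · obtain ⟨W, hW, ha, h⟩ := h a
    exact ((isLocallyNashOn_iff hW).1 h).2 a ha ψ hψ hfa

lemma IsLocallyNashOn.congr {f g : M → N} {W : Set M} (h : IsLocallyNashOn 𝒜 ℬ f W)
    (hfg : EqOn f g W) : IsLocallyNashOn 𝒜 ℬ g W := by
  refine ⟨h.1.congr hfg.symm, fun a ha ψ hψ hga => ?_⟩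
  obtain ⟨φ, hφ, U, hU, haU, hUW, hUφ, hm, hN⟩ := h.2 a ha ψ hψ (by rwa [hfg ha])
  refine ⟨φ, hφ, U, hU, haU, hUW, hUφ, fun x hx => hfg (hUW hx) ▸ hm hx, hN.congr ?_⟩
  rintro _ ⟨x, hx, rfl⟩
  simp only [φ.left_inv (hUφ hx), hfg (hUW hx)]

lemma IsLocallyNash.isLocallyNashOn {f : M → N} {W : Set M} (h : IsLocallyNash 𝒜 ℬ f)
    (hW : IsOpen W) : IsLocallyNashOn 𝒜 ℬ f W := by
  rw [isLocallyNash_iff] at h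
  rw [isLocallyNashOn_iff hW]
  exact ⟨h.1.continuousOn, fun a _ => h.2 a⟩

end LocallyNash

/-! ### Simply connected products and lifting -/

section Topology

/-- Homotopy classes of paths in a product are determined by their projections. Needed to lift maps
from squares and cubes of the cover. -/
instance Prod.simplyConnectedSpace {A B : Type*} [TopologicalSpace A] [TopologicalSpace B]
    [SimplyConnectedSpace A] [SimplyConnectedSpace B] : SimplyConnectedSpace (A × B) := by
  rw [simply_connected_iff_paths_homotopic]
  refine ⟨inferInstance, fun x y => ⟨fun p q => ?_⟩⟩
  rw [← Path.Homotopic.prod_projLeft_projRight p, ← Path.Homotopic.prod_projLeft_projRight q]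
  congr 1 <;> exact Subsingleton.elim _ _

lemma IsCoveringMap.exists_lift {A E B : Type*} [TopologicalSpace A] [TopologicalSpace E]
    [TopologicalSpace B] [SimplyConnectedSpace A] [LocallyPathConnectedSpace A] {p : E → B}
    (hp : IsCoveringMap p) {f : A → B} (hf : Continuous f) {a : A} {e : E} (h : p e = f a) :
    ∃ F : A → E, Continuous F ∧ F a = e ∧ ∀ x, p (F x) = f x := by
  obtain ⟨F, ⟨h1, h2⟩, -⟩ := hp.existsUnique_continuousMap_lifts ⟨f, hf⟩ a e h
  exact ⟨F, F.continuous, h1, fun x => congrFun h2 x⟩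

end Topology

/-! ### Sections and lifts along Nash local diffeomorphisms -/

section Manifold

variable {𝕜 : Type*} [RCLike 𝕜] {n : ℕ} {M N X : Type*}
  [TopologicalSpace M] [ChartedSpace (Fin n → 𝕜) M]
  [TopologicalSpace N] [ChartedSpace (Fin n → 𝕜) N]
  [TopologicalSpace X] [ChartedSpace (Fin n → 𝕜) X]
  {𝒜 : Set (OpenPartialHomeomorph M (Fin n → 𝕜))} {ℬ : Set (OpenPartialHomeomorph N (Fin n → 𝕜))}

lemma IsNashAtlas.isNashAt_transition (h : IsNashAtlas 𝒜)
    {φ ψ : OpenPartialHomeomorph M (Fin n → 𝕜)} (hφ : φ ∈ 𝒜) (hψ : ψ ∈ 𝒜) {a : M}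
    (haφ : a ∈ φ.source) (haψ : a ∈ ψ.source) :
    IsNashAt (fun x => ψ (φ.symm x)) (φ a) :=
  have haa : a ∈ φ.source ∩ ψ.source := ⟨haφ, haψ⟩
  ⟨_, mem_image_of_mem φ haa, (h.compatible φ hφ ψ hψ).nash⟩

lemma ContMDiffAt.analyticAt_charts {f : M → N} {a : M}
    (hf : ContMDiffAt 𝓘(𝕜, Fin n → 𝕜) 𝓘(𝕜, Fin n → 𝕜) ω f a)
    {φ : OpenPartialHomeomorph M (Fin n → 𝕜)} {ψ : OpenPartialHomeomorph N (Fin n → 𝕜)}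
    (hφ : φ ∈ IsManifold.maximalAtlas 𝓘(𝕜, Fin n → 𝕜) ω M)
    (hψ : ψ ∈ IsManifold.maximalAtlas 𝓘(𝕜, Fin n → 𝕜) ω N)
    (haφ : a ∈ φ.source) (haψ : f a ∈ ψ.source) :
    AnalyticAt 𝕜 (fun x => ψ (f (φ.symm x))) (φ a) := by
  have h1 : ContMDiffAt 𝓘(𝕜, Fin n → 𝕜) 𝓘(𝕜, Fin n → 𝕜) ω φ.symm (φ a) :=
    contMDiffAt_symm_of_mem_maximalAtlas hφ (φ.map_source haφ)
  have h2 : ContMDiffAt 𝓘(𝕜, Fin n → 𝕜) 𝓘(𝕜, Fin n → 𝕜) ω ψ (f a) :=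
    contMDiffAt_of_mem_maximalAtlas hψ haψ
  have h3 : ContMDiffAt 𝓘(𝕜, Fin n → 𝕜) 𝓘(𝕜, Fin n → 𝕜) ω (fun x => f (φ.symm x)) (φ a) :=
    ContMDiffAt.comp (φ a) (by rwa [φ.left_inv haφ]) h1
  have h4 : ContMDiffAt 𝓘(𝕜, Fin n → 𝕜) 𝓘(𝕜, Fin n → 𝕜) ω (fun x => ψ (f (φ.symm x))) (φ a) :=
    ContMDiffAt.comp (φ a) (by rwa [φ.left_inv haφ]) h3
  exact (contMDiffAt_iff_contDiffAt.1 h4).analyticAt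

/-- An analytic section of a locally Nash local homeomorphism is locally Nash. -/
theorem IsLocallyNash.isLocallyNashOn_section (h𝒜 : IsNashAtlas 𝒜) (hℬ : IsNashAtlas ℬ)
    {π : N → M} (hπl : IsLocalHomeomorph π) (hπ : IsLocallyNash ℬ 𝒜 π) {W : Set M} {s : M → N}
    (hW : IsOpen W) (hs : ContMDiffOn 𝓘(𝕜, Fin n → 𝕜) 𝓘(𝕜, Fin n → 𝕜) ω s W)
    (hsec : ∀ g ∈ W, π (s g) = g) : IsLocallyNashOn 𝒜 ℬ s W := by
  rw [isLocallyNashOn_iff hW]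
  refine ⟨hs.continuousOn, fun a ha ψ hψ haψ => ?_⟩
  obtain ⟨φ, hφ, haφ⟩ := h𝒜.cover a
  have hπa := hsec a ha
  have hsa : ContMDiffAt 𝓘(𝕜, Fin n → 𝕜) 𝓘(𝕜, Fin n → 𝕜) ω s a := hs.contMDiffAt (hW.mem_nhds ha)
  have hπc : Tendsto π (𝓝 (s a)) (𝓝 a) := by simpa [hπa] using hπ.continuous.tendsto (s a)
  refine ⟨φ, hφ, haφ, ?_⟩
  obtain ⟨ψ', hψ', haψ', hN⟩ := (isLocallyNash_iff.1 hπ).2 (s a) φ hφ (by rwa [hπa])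
  -- The definition provides a Nash germ of `π` only in some chart `ψ'`; the transition map carries
  -- it to the given chart `ψ`.
  have hN2 : IsNashAt (fun x => φ (π (ψ.symm x))) (ψ (s a)) :=
    IsNashAt.comp_charts (f := id) haψ haψ' continuousAt_id hN
      (hℬ.isNashAt_transition hψ hψ' haψ haψ')
  have hsymm : Tendsto ψ.symm (𝓝 (ψ (s a))) (𝓝 (s a)) := ψ.tendsto_symm haψ
  have hsymm' : Tendsto φ.symm (𝓝 (φ a)) (𝓝 a) := φ.tendsto_symm haφ
  have hpt : φ (π (ψ.symm (ψ (s a)))) = φ a := by rw [ψ.left_inv haψ, hπa]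
  -- Near `s a` both `x` and `s (π x)` lie in an open set on which `π` is injective, and they have
  -- the same image.
  have hinj : ∀ᶠ x in 𝓝 (s a), s (π x) = x := by
    obtain ⟨e, he, rfl⟩ := hπl (s a)
    have hU := e.open_source.mem_nhds he
    filter_upwards [hU, hπc (hW.mem_nhds ha), (hsa.continuousAt.tendsto.comp hπc) hU]
      with x hx hxW hsx
    exact e.injOn hsx hx (hsec _ hxW)
  have := IsNashAt.inverse (g := fun x => ψ (s (φ.symm x))) hN2
    (by
      simp only [hpt]
      exact hsa.analyticAt_charts (h𝒜.analytic hφ) (hℬ.analytic hψ) haφ haψ)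
    (by
      filter_upwards [hsymm hinj, hsymm (hπc (φ.open_source.mem_nhds haφ)),
        ψ.open_target.mem_nhds (ψ.map_source haψ)] with x hx hx2 hx3
      simp only [φ.left_inv hx2]
      rw [show s (π (ψ.symm x)) = _ from hx, ψ.right_inv hx3])
    (by
      simp only [hpt]
      filter_upwards [hsymm' (hsa.continuousAt.tendsto (ψ.open_source.mem_nhds haψ)),
        hsymm' (hW.mem_nhds ha), φ.open_target.mem_nhds (φ.map_source haφ)] with y hy hy2 hy3
      rw [ψ.left_inv hy, hsec _ hy2, φ.right_inv hy3])
  simpa only [hpt] using this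

/-- A continuous lift of a locally Nash map along a locally Nash local analytic diffeomorphism is
locally Nash. -/
theorem IsLocallyNash.lift {κ : Type*} [Fintype κ] {P : Type*} [TopologicalSpace P]
    {𝒞 : Set (OpenPartialHomeomorph P (κ → 𝕜))} (h𝒜 : IsNashAtlas 𝒜) (hℬ : IsNashAtlas ℬ)
    {π : N → M} (hπd : IsLocalDiffeomorph 𝓘(𝕜, Fin n → 𝕜) 𝓘(𝕜, Fin n → 𝕜) ω π)
    (hπ : IsLocallyNash ℬ 𝒜 π) {f : P → M} (hf : IsLocallyNash 𝒞 𝒜 f) {F : P → N}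
    (hF : Continuous F) (hFf : ∀ x, π (F x) = f x) : IsLocallyNash 𝒞 ℬ F := by
  refine isLocallyNash_of_locally fun a => ?_
  -- Near `a` the lift is `Φ.symm ∘ f`, and `Φ.symm` is an analytic section of `π`, hence Nash.
  obtain ⟨Φ, ha, hΦ⟩ := hπd (F a)
  have hs : IsLocallyNashOn 𝒜 ℬ Φ.symm Φ.target :=
    hπ.isLocallyNashOn_section h𝒜 hℬ hπd.isLocalHomeomorph Φ.open_target Φ.contMDiffOn_invFun
      fun g hg => (hΦ (Φ.map_target hg)).trans (Φ.right_inv hg)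
  refine ⟨F ⁻¹' Φ.source, hF.isOpen_preimage _ Φ.open_source, ha, ?_⟩
  have hm : ∀ x ∈ F ⁻¹' Φ.source, f x = Φ (F x) := fun x hx => by rw [← hFf, hΦ hx]
  have := hs.comp (hF.isOpen_preimage _ Φ.open_source) Φ.open_target
    (hf.isLocallyNashOn (hF.isOpen_preimage _ Φ.open_source))
    (fun x hx => by rw [hm x hx]; exact Φ.map_source hx)
  refine this.congr fun x hx => ?_
  simp only [Function.comp, hm x hx]
  exact Φ.left_inv hx

end Manifold

/-! ### Uniqueness of the structure on the cover -/

section Uniqueness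

variable {𝕜 : Type*} [RCLike 𝕜] {n : ℕ} {G X X' : Type*}
  [TopologicalSpace G] [ChartedSpace (Fin n → 𝕜) G] [Group G]
  [TopologicalSpace X] [ChartedSpace (Fin n → 𝕜) X] [Group X]
  [TopologicalSpace X'] [ChartedSpace (Fin n → 𝕜) X'] [Group X']
  {𝒜 : Set (OpenPartialHomeomorph G (Fin n → 𝕜))}
  {ℬ : Set (OpenPartialHomeomorph X (Fin n → 𝕜))}
  {ℬ' : Set (OpenPartialHomeomorph X' (Fin n → 𝕜))}

/-- Each projection lifts through the other with `1 ↦ 1`. By uniqueness of lifts the two are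
mutually inverse and respect products; as lifts of Nash maps they are Nash. -/
theorem IsAnalyticUniversalCover.exists_mulEquiv (hG : IsLocallyNashGroup 𝒜) {π : X → G}
    {π' : X' → G} (hπ : IsAnalyticUniversalCover 𝕜 n π) (hX : IsLocallyNashGroup ℬ)
    (hπh : IsLocallyNashHom ℬ 𝒜 π) (hπ' : IsAnalyticUniversalCover 𝕜 n π')
    (hX' : IsLocallyNashGroup ℬ') (hπh' : IsLocallyNashHom ℬ' 𝒜 π') :
    ∃ α : X ≃* X', IsLocallyNash ℬ ℬ' α ∧ IsLocallyNash ℬ' ℬ α.symm ∧ ∀ x, π' (α x) = π x := by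
  have := hπ.simplyConnected
  have := hπ'.simplyConnected
  have : LocallyPathConnectedSpace X := ChartedSpace.locallyPathConnectedSpace (Fin n → 𝕜) X
  have : LocallyPathConnectedSpace X' := ChartedSpace.locallyPathConnectedSpace (Fin n → 𝕜) X'
  have h1 : π 1 = 1 := (MonoidHom.mk' π hπh.2).map_one
  have h1' : π' 1 = 1 := (MonoidHom.mk' π' hπh'.2).map_one
  obtain ⟨α, hαc, hα1, hα⟩ := hπ'.isCoveringMap.exists_lift hπh.1.continuous (a := 1) (e := 1)
    (by rw [h1, h1'])
  obtain ⟨β, hβc, hβ1, hβ⟩ := hπ.isCoveringMap.exists_lift hπh'.1.continuous (a := 1) (e := 1)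
    (by rw [h1, h1'])
  have hβα : β ∘ α = id := hπ.isCoveringMap.eq_of_comp_eq (hβc.comp hαc) continuous_id
    (by ext x; simp [hα, hβ]) 1 (by simp [hα1, hβ1])
  have hαβ : α ∘ β = id := hπ'.isCoveringMap.eq_of_comp_eq (hαc.comp hβc) continuous_id
    (by ext x; simp [hα, hβ]) 1 (by simp [hα1, hβ1])
  have hmul : (fun p : X × X => α (p.1 * p.2)) = fun p => α p.1 * α p.2 :=
    hπ'.isCoveringMap.eq_of_comp_eq (hαc.comp hX.mul.continuous)
      (hX'.mul.continuous.comp (hαc.prodMap hαc))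
      (by ext x; simp [hα, hπh.2, hπh'.2]) (1, 1) (by simp [hα1])
  refine ⟨⟨⟨α, β, congrFun hβα, congrFun hαβ⟩, fun x y => congrFun hmul (x, y)⟩, ?_, ?_, hα⟩
  · exact IsLocallyNash.lift hG.atlas hX'.atlas hπ'.isLocalDiffeomorph hπh'.1 hπh.1 hαc hα
  · exact IsLocallyNash.lift hG.atlas hX.atlas hπ.isLocalDiffeomorph hπh.1 hπh'.1 hβc hβ

end Uniqueness

/-! ### Products of locally Nash maps -/

section Products

variable {𝕜 : Type*} [RCLike 𝕜] {ι κ ι' κ' : Type*} [Fintype ι] [Fintype κ] [Fintype ι'] [Fintype κ']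

lemma isNashAt_comp_index (e : κ → ι) (u : ι → 𝕜) : IsNashAt (fun v : ι → 𝕜 => v ∘ e) u :=
  ⟨_, Metric.mem_ball_self one_pos, Metric.isOpen_ball, isSemialgebraic_ball u one_pos,
    analyticOnNhd_pi_iff.2 fun j =>
      (ContinuousLinearMap.proj (R := 𝕜) (φ := fun _ : ι => 𝕜) (e j)).analyticOnNhd _,
    fun j => ⟨Polynomial.X - Polynomial.C (MvPolynomial.X (e j)), by simp, fun u _ => by simp⟩⟩

lemma IsNashAt.sumElim {f : (ι → 𝕜) → (κ → 𝕜)} {g : (ι → 𝕜) → (κ' → 𝕜)} {u : ι → 𝕜}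
    (hf : IsNashAt f u) (hg : IsNashAt g u) :
    IsNashAt (fun x => Sum.elim (f x) (g x)) u := by
  obtain ⟨r, ⟨hf, hg⟩, hr⟩ := ((hf.eventually_isNashOn_ball.and hg.eventually_isNashOn_ball).and
    self_mem_nhdsWithin).exists
  refine ⟨_, Metric.mem_ball_self hr, Metric.isOpen_ball, isSemialgebraic_ball u hr,
    analyticOnNhd_pi_iff.2 ?_, ?_⟩
  · rintro (j | j)
    · exact analyticOnNhd_pi_iff.1 hf.analytic j
    · exact analyticOnNhd_pi_iff.1 hg.analytic j
  · rintro (j | j)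
    · exact hf.algebraic j
    · exact hg.algebraic j

variable {M N M' N' : Type*} [TopologicalSpace M] [TopologicalSpace N] [TopologicalSpace M']
  [TopologicalSpace N'] {𝒜 : Set (OpenPartialHomeomorph M (ι → 𝕜))}
  {𝒜' : Set (OpenPartialHomeomorph M' (ι' → 𝕜))} {ℬ : Set (OpenPartialHomeomorph N (κ → 𝕜))}
  {ℬ' : Set (OpenPartialHomeomorph N' (κ' → 𝕜))}

lemma prodChart_source (φ : OpenPartialHomeomorph M (ι → 𝕜))
    (φ' : OpenPartialHomeomorph M' (ι' → 𝕜)) :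
    (prodChart φ φ').source = φ.source ×ˢ φ'.source := by
  simp [prodChart]

lemma prodChart_apply (φ : OpenPartialHomeomorph M (ι → 𝕜))
    (φ' : OpenPartialHomeomorph M' (ι' → 𝕜)) (p : M × M') :
    prodChart φ φ' p = Sum.elim (φ p.1) (φ' p.2) := rfl

lemma prodChart_symm_apply (φ : OpenPartialHomeomorph M (ι → 𝕜))
    (φ' : OpenPartialHomeomorph M' (ι' → 𝕜)) (u : ι ⊕ ι' → 𝕜) :
    (prodChart φ φ').symm u = (φ.symm (u ∘ Sum.inl), φ'.symm (u ∘ Sum.inr)) := rfl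

lemma IsLocallyNash.prodMap {f : M → N} {g : M' → N'} (hf : IsLocallyNash 𝒜 ℬ f)
    (hg : IsLocallyNash 𝒜' ℬ' g) :
    IsLocallyNash (prodAtlas 𝒜 𝒜') (prodAtlas ℬ ℬ') (Prod.map f g) := by
  rw [isLocallyNash_iff] at *
  refine ⟨hf.1.prodMap hg.1, ?_⟩
  rintro ⟨a, b⟩ _ ⟨ψ, hψ, ψ', hψ', rfl⟩ hab
  rw [prodChart_source] at hab
  obtain ⟨φ, hφ, ha, hN⟩ := hf.2 a ψ hψ hab.1
  obtain ⟨φ', hφ', hb, hN'⟩ := hg.2 b ψ' hψ' hab.2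
  refine ⟨_, mem_image2_of_mem hφ hφ', by rw [prodChart_source]; exact ⟨ha, hb⟩, ?_⟩
  simp only [prodChart_apply, prodChart_symm_apply, Prod.map_apply]
  exact (IsNashAt.comp (u := Sum.elim (φ a) (φ' b)) (g := fun x => ψ (f (φ.symm x)))
      (f := fun u : ι ⊕ ι' → 𝕜 => u ∘ Sum.inl) hN
      (isNashAt_comp_index Sum.inl _)).sumElim
    (IsNashAt.comp (u := Sum.elim (φ a) (φ' b)) (g := fun x => ψ' (g (φ'.symm x)))
      (f := fun u : ι ⊕ ι' → 𝕜 => u ∘ Sum.inr) hN'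
      (isNashAt_comp_index Sum.inr _))

end Products

/-! ### The Nash atlas pulled back along a covering -/

section Pullback

variable {𝕜 : Type*} [RCLike 𝕜] {n : ℕ} {M X : Type*}
  [TopologicalSpace M] [ChartedSpace (Fin n → 𝕜) M]
  [TopologicalSpace X] [ChartedSpace (Fin n → 𝕜) X]
  {𝒜 : Set (OpenPartialHomeomorph M (Fin n → 𝕜))}

/-- The charts of `X` that are of the form `φ ∘ π` with `φ` in the atlas `𝒜`, and have a
semialgebraic image. -/
def pullbackAtlas {𝕜 : Type*} [RCLike 𝕜] {ι M X : Type*} [TopologicalSpace M] [TopologicalSpace X]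
    (𝒜 : Set (OpenPartialHomeomorph M (ι → 𝕜))) (π : X → M) :
    Set (OpenPartialHomeomorph X (ι → 𝕜)) :=
  {c | IsSemialgebraic c.target ∧ ∃ φ ∈ 𝒜, ∀ x ∈ c.source, π x ∈ φ.source ∧ c x = φ (π x)}

variable {π : X → M}

/-- A local homeomorphism representing `π` is followed by `φ` and cut down until its image is a
ball. -/
lemma exists_mem_pullbackAtlas (hπ : IsLocalHomeomorph π) {φ : OpenPartialHomeomorph M (Fin n → 𝕜)}
    (hφ : φ ∈ 𝒜) {x : X} (hx : π x ∈ φ.source) : ∃ c ∈ pullbackAtlas 𝒜 π, x ∈ c.source := by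
  obtain ⟨e, he, rfl⟩ := hπ x
  have hx' : x ∈ (e.trans φ).source := by simpa [he] using hx
  obtain ⟨r, hr, hrV⟩ := Metric.isOpen_iff.1 (e.trans φ).open_target _ ((e.trans φ).map_source hx')
  refine ⟨(e.trans φ).trans (OpenPartialHomeomorph.ofSet _
    (Metric.isOpen_ball (x := e.trans φ x) (ε := r))), ⟨?_, φ, hφ, fun y hy => ?_⟩, ?_⟩
  · have : ((e.trans φ).trans (OpenPartialHomeomorph.ofSet _
        (Metric.isOpen_ball (x := e.trans φ x) (ε := r)))).target = Metric.ball (e.trans φ x) r := by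
      rw [OpenPartialHomeomorph.trans_target]
      simpa using hrV
    rw [this]
    exact isSemialgebraic_ball _ hr
  · rw [OpenPartialHomeomorph.trans_source, OpenPartialHomeomorph.trans_source] at hy
    exact ⟨hy.1.2, rfl⟩
  · rw [OpenPartialHomeomorph.trans_source]
    exact ⟨hx', Metric.mem_ball_self hr⟩

lemma map_symm_of_chart {c : OpenPartialHomeomorph X (Fin n → 𝕜)}
    {φ : OpenPartialHomeomorph M (Fin n → 𝕜)}
    (hc : ∀ x ∈ c.source, π x ∈ φ.source ∧ c x = φ (π x)) {y : Fin n → 𝕜} (hy : y ∈ c.target) :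
    π (c.symm y) ∈ φ.source ∧ π (c.symm y) = φ.symm y ∧ y ∈ φ.target := by
  obtain ⟨h1, h2⟩ := hc _ (c.map_target hy)
  rw [c.right_inv hy] at h2
  refine ⟨h1, ?_, ?_⟩
  · conv_rhs => rw [h2]
    rw [φ.left_inv h1]
  · rw [h2]
    exact φ.map_source h1

lemma mem_maximalAtlas_of_chart [IsManifold 𝓘(𝕜, Fin n → 𝕜) ω X]
    (hπ : IsLocalDiffeomorph 𝓘(𝕜, Fin n → 𝕜) 𝓘(𝕜, Fin n → 𝕜) ω π)
    {c : OpenPartialHomeomorph X (Fin n → 𝕜)} {φ : OpenPartialHomeomorph M (Fin n → 𝕜)}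
    (hφ : φ ∈ IsManifold.maximalAtlas 𝓘(𝕜, Fin n → 𝕜) ω M)
    (hc : ∀ x ∈ c.source, π x ∈ φ.source ∧ c x = φ (π x)) :
    c ∈ IsManifold.maximalAtlas 𝓘(𝕜, Fin n → 𝕜) ω X := by
  refine c.mem_maximalAtlas_of_contMDiffOn ?_ fun y hy => ?_
  · exact ((contMDiffOn_of_mem_maximalAtlas hφ).comp hπ.contMDiff.contMDiffOn
      fun x hx => (hc x hx).1).congr fun x hx => (hc x hx).2
  · obtain ⟨Φ, hΦx, hΦ⟩ := hπ (c.symm y)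
    obtain ⟨h1, h2, h3⟩ := map_symm_of_chart hc hy
    have hsymm : ContMDiffAt 𝓘(𝕜, Fin n → 𝕜) 𝓘(𝕜, Fin n → 𝕜) ω φ.symm y :=
      contMDiffAt_symm_of_mem_maximalAtlas hφ h3
    have hy' : φ.symm y ∈ Φ.target := by
      rw [← h2, hΦ hΦx]
      exact Φ.map_source hΦx
    have hΦs : ContMDiffAt 𝓘(𝕜, Fin n → 𝕜) 𝓘(𝕜, Fin n → 𝕜) ω Φ.symm (φ.symm y) :=
      Φ.contMDiffOn_invFun.contMDiffAt (Φ.open_target.mem_nhds hy')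
    refine ((ContMDiffAt.comp y hΦs hsymm).congr_of_eventuallyEq ?_).contMDiffWithinAt
    filter_upwards [c.open_target.mem_nhds hy, (c.continuousAt_symm hy).preimage_mem_nhds
      (Φ.open_source.mem_nhds hΦx)] with z hz hzΦ
    simp only [Function.comp]
    rw [← (map_symm_of_chart hc hz).2.1, hΦ hzΦ]
    exact (Φ.left_inv hzΦ).symm

/-- Distinct points of one fibre have disjoint neighbourhoods. This makes the agreement locus of two
local lifts relatively closed. -/
lemma IsSeparatedMap.isOpen_ne {A E B : Type*} [TopologicalSpace A] [TopologicalSpace E]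
    [TopologicalSpace B] {p : E → B} (hp : IsSeparatedMap p) {S : Set A} (hS : IsOpen S)
    {f g : A → E} (hf : ContinuousOn f S) (hg : ContinuousOn g S) (h : ∀ a ∈ S, p (f a) = p (g a)) :
    IsOpen {a ∈ S | f a ≠ g a} := by
  rw [isOpen_iff_mem_nhds]
  rintro a ⟨ha, hne⟩
  obtain ⟨s, hs, t, ht, hst⟩ := isSeparatedMap_iff_nhds.1 hp _ _ (h a ha) hne
  filter_upwards [hS.mem_nhds ha, (hf.continuousAt (hS.mem_nhds ha)) hs,
    (hg.continuousAt (hS.mem_nhds ha)) ht] with x hx h1 h2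
  exact ⟨hx, fun he => disjoint_left.1 hst h1 (by rw [he]; exact h2)⟩

/-- The transition map is a restriction of the one below; only its domain needs an argument. That
domain is open and closed in the semialgebraic set `S` of points where the transition below is
defined and ends in the image of `c₂`, hence is semialgebraic. It may be smaller than `S`, since the
two charts can lie on different sheets. -/
theorem nashCompatible_of_charts (hsep : IsSeparatedMap π)
    {c₁ c₂ : OpenPartialHomeomorph X (Fin n → 𝕜)} {φ₁ φ₂ : OpenPartialHomeomorph M (Fin n → 𝕜)}
    (h₁ : IsSemialgebraic c₁.target) (h₂ : IsSemialgebraic c₂.target)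
    (hc₁ : ∀ x ∈ c₁.source, π x ∈ φ₁.source ∧ c₁ x = φ₁ (π x))
    (hc₂ : ∀ x ∈ c₂.source, π x ∈ φ₂.source ∧ c₂ x = φ₂ (π x))
    (h : NashCompatible φ₁ φ₂) : NashCompatible c₁ c₂ := by
  set D := φ₁ '' (φ₁.source ∩ φ₂.source) with hD
  set τ : (Fin n → 𝕜) → (Fin n → 𝕜) := fun x => φ₂ (φ₁.symm x) with hτ
  set S := c₁.target ∩ (D ∩ τ ⁻¹' c₂.target) with hS
  have hτc : ContinuousOn τ D := h.nash.analytic.continuousOn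
  have hSo : IsOpen S :=
    c₁.open_target.inter (hτc.isOpen_inter_preimage h.nash.isOpen c₂.open_target)
  have hSs : IsSemialgebraic S :=
    h₁.inter _ _ (h.nash.isSemialgebraic.inter_preimage h.nash.isOpen hτc h.nash.algebraic h₂)
  -- Over `S` both inverse charts lift the same map to the base; the transition domain is where the
  -- lifts are on the same sheet.
  have hVeq : c₁ '' (c₁.source ∩ c₂.source) = {y ∈ S | c₁.symm y = c₂.symm (τ y)} := by
    ext y
    constructor
    · rintro ⟨x, ⟨hx₁, hx₂⟩, rfl⟩
      have hτx : τ (c₁ x) = c₂ x := by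
        simp only [hτ]
        rw [(hc₁ x hx₁).2, φ₁.left_inv (hc₁ x hx₁).1, (hc₂ x hx₂).2]
      refine ⟨⟨c₁.map_source hx₁, ⟨π x, ⟨(hc₁ x hx₁).1, (hc₂ x hx₂).1⟩, (hc₁ x hx₁).2.symm⟩, ?_⟩, ?_⟩
      · rw [mem_preimage, hτx]
        exact c₂.map_source hx₂
      · rw [hτx, c₁.left_inv hx₁, c₂.left_inv hx₂]
    · rintro ⟨⟨hy₁, -, hy₂⟩, he⟩
      exact ⟨c₁.symm y, ⟨c₁.map_target hy₁, he ▸ c₂.map_target hy₂⟩, c₁.right_inv hy₁⟩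
  have hVo : IsOpen (c₁ '' (c₁.source ∩ c₂.source)) :=
    c₁.isOpen_image_of_subset_source (c₁.open_source.inter c₂.open_source) inter_subset_left
  have hVS : c₁ '' (c₁.source ∩ c₂.source) ⊆ S := hVeq ▸ fun y hy => hy.1
  have hπeq : ∀ y ∈ S, π (c₁.symm y) = π (c₂.symm (τ y)) := by
    rintro y ⟨hy₁, ⟨z, ⟨hz₁, hz₂⟩, rfl⟩, hy₂⟩
    rw [(map_symm_of_chart hc₁ hy₁).2.1, (map_symm_of_chart hc₂ hy₂).2.1]
    simp only [hτ]
    rw [φ₁.left_inv hz₁, φ₂.left_inv hz₂]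
  have hdiff : IsOpen (S \ c₁ '' (c₁.source ∩ c₂.source)) := by
    have : S \ c₁ '' (c₁.source ∩ c₂.source) = {y ∈ S | c₁.symm y ≠ c₂.symm (τ y)} := by
      rw [hVeq]
      ext y
      simp only [Set.mem_sdiff, mem_ofPred_eq]
      tauto
    rw [this]
    exact hsep.isOpen_ne hSo (c₁.continuousOn_symm.mono fun y hy => hy.1)
      (c₂.continuousOn_symm.comp (hτc.mono fun y hy => hy.2.1) fun y hy => hy.2.2) hπeq
  have hVs := hSs.of_isOpen_diff hVS hVo hdiff
  refine ⟨h₁, h₂, (h.nash.mono (fun y hy => (hVS hy).2.1) hVo hVs).congr ?_, ?_⟩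
  · rintro _ ⟨x, ⟨hx₁, hx₂⟩, rfl⟩
    simp only
    rw [c₁.left_inv hx₁, (hc₁ x hx₁).2, φ₁.left_inv (hc₁ x hx₁).1, (hc₂ x hx₂).2]
  · refine (h.analytic_inv.mono ?_).congr
      (c₂.isOpen_image_of_subset_source (c₁.open_source.inter c₂.open_source) inter_subset_right) ?_
    · rintro _ ⟨x, ⟨hx₁, hx₂⟩, rfl⟩
      exact ⟨π x, ⟨(hc₁ x hx₁).1, (hc₂ x hx₂).1⟩, (hc₂ x hx₂).2.symm⟩
    · rintro _ ⟨x, ⟨hx₁, hx₂⟩, rfl⟩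
      simp only
      rw [c₂.left_inv hx₂, (hc₂ x hx₂).2, φ₂.left_inv (hc₂ x hx₂).1, (hc₁ x hx₁).2]

theorem IsNashAtlas.pullbackAtlas [IsManifold 𝓘(𝕜, Fin n → 𝕜) ω X] (h𝒜 : IsNashAtlas 𝒜)
    (hπ : IsLocalDiffeomorph 𝓘(𝕜, Fin n → 𝕜) 𝓘(𝕜, Fin n → 𝕜) ω π) (hsep : IsSeparatedMap π) :
    IsNashAtlas (pullbackAtlas 𝒜 π) where
  analytic := fun _ ⟨_, _, hφ, hc⟩ => mem_maximalAtlas_of_chart hπ (h𝒜.analytic hφ) hc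
  cover x :=
    let ⟨_, hφ, hx⟩ := h𝒜.cover (π x)
    exists_mem_pullbackAtlas hπ.isLocalHomeomorph hφ hx
  compatible := fun _ ⟨h₁, _, hφ₁, hc₁⟩ _ ⟨h₂, _, hφ₂, hc₂⟩ =>
    nashCompatible_of_charts hsep h₁ h₂ hc₁ hc₂ (h𝒜.compatible _ hφ₁ _ hφ₂)

theorem IsNashAtlas.isLocallyNash_pullbackAtlas (h𝒜 : IsNashAtlas 𝒜) (hπ : IsLocalHomeomorph π) :
    IsLocallyNash (_root_.pullbackAtlas 𝒜 π) 𝒜 π := by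
  rw [isLocallyNash_iff]
  refine ⟨hπ.continuous, fun a ψ hψ ha => ?_⟩
  obtain ⟨c, hc, hac⟩ := exists_mem_pullbackAtlas hπ hψ ha
  refine ⟨c, hc, hac, ?_⟩
  obtain ⟨-, φ, hφ, hcφ⟩ := hc
  have := h𝒜.isNashAt_transition hφ hψ (hcφ a hac).1 ha
  rw [← (hcφ a hac).2] at this
  refine this.congr ?_
  filter_upwards [c.open_target.mem_nhds (c.map_source hac)] with y hy
  rw [(map_symm_of_chart hcφ hy).2.1]

end Pullback

/-! ### Existence of the structure on the cover -/

section Existence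

variable {𝕜 : Type*} [RCLike 𝕜] {n : ℕ} {G X : Type*}
  [TopologicalSpace G] [ChartedSpace (Fin n → 𝕜) G] [Group G]
  [TopologicalSpace X] [ChartedSpace (Fin n → 𝕜) X]
  {𝒜 : Set (OpenPartialHomeomorph G (Fin n → 𝕜))}

/-- Along a covering map from a simply connected space, a group structure with continuous operations
can be lifted, with any point over the identity as identity. -/
theorem IsCoveringMap.exists_group [SimplyConnectedSpace X] [LocallyPathConnectedSpace X]
    {π : X → G} (hπ : IsCoveringMap π) (hmul : Continuous fun p : G × G => p.1 * p.2)
    (hinv : Continuous fun g : G => g⁻¹) {e : X} (he : π e = 1) :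
    ∃ _ : Group X, (1 : X) = e ∧ (Continuous fun p : X × X => p.1 * p.2) ∧
      (Continuous fun x : X => x⁻¹) ∧ (∀ x y : X, π (x * y) = π x * π y) ∧
      ∀ x : X, π x⁻¹ = (π x)⁻¹ := by
  have hc := hπ.continuous
  obtain ⟨μ, hμc, hμe, hμ⟩ := hπ.exists_lift (A := X × X)
    (hmul.comp (hc.prodMap hc)) (a := (e, e)) (e := e) (by simp [he])
  obtain ⟨i, hic, hie, hi⟩ := hπ.exists_lift (hinv.comp hc) (a := e) (e := e) (by simp [he])
  simp only [Function.comp, Prod.map_apply'] at hμ hi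
  -- Each group axiom equates two lifts of one map that agree at the base point built from `e`; the
  -- left axioms suffice.
  have hone : (fun x => μ (e, x)) = id := hπ.eq_of_comp_eq (by fun_prop) continuous_id
    (by ext x; simp [hμ, he]) e (by simp [hμe])
  have hassoc : (fun p : X × X × X => μ (μ (p.1, p.2.1), p.2.2)) =
      fun p => μ (p.1, μ (p.2.1, p.2.2)) :=
    hπ.eq_of_comp_eq (by fun_prop) (by fun_prop) (by ext x; simp [hμ, mul_assoc]) (e, e, e)
      (by simp [hμe])
  have hleft : (fun x => μ (i x, x)) = fun _ => e :=
    hπ.eq_of_comp_eq (by fun_prop) continuous_const (by ext x; simp [hμ, hi, he]) e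
      (by simp [hμe, hie])
  let _ : Mul X := ⟨fun x y => μ (x, y)⟩
  let _ : Inv X := ⟨i⟩
  let _ : One X := ⟨e⟩
  exact ⟨Group.ofLeftAxioms (fun x y z => congrFun hassoc (x, y, z)) (congrFun hone)
    (congrFun hleft), rfl, hμc, hic, fun x y => hμ (x, y), hi⟩

/-- With the pulled back atlas `π` is Nash, so the lifted operations are continuous lifts of Nash
maps and hence Nash. -/
theorem IsAnalyticUniversalCover.exists_isLocallyNashGroup (hG : IsLocallyNashGroup 𝒜) {π : X → G}
    (hπ : IsAnalyticUniversalCover 𝕜 n π) {e : X} (he : π e = 1) :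
    ∃ _ : Group X, (1 : X) = e ∧ ∃ ℬ : Set (OpenPartialHomeomorph X (Fin n → 𝕜)),
      IsLocallyNashGroup ℬ ∧ IsLocallyNashHom ℬ 𝒜 π := by
  have := hπ.simplyConnected
  have := hπ.isManifold
  have : LocallyPathConnectedSpace X := ChartedSpace.locallyPathConnectedSpace (Fin n → 𝕜) X
  obtain ⟨hX, h1, hmul, hinv, hπmul, hπinv⟩ :=
    hπ.isCoveringMap.exists_group hG.mul.continuous hG.inv.continuous he
  have hℬ := hG.atlas.pullbackAtlas hπ.isLocalDiffeomorph hπ.isCoveringMap.isSeparatedMap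
  have hN := hG.atlas.isLocallyNash_pullbackAtlas hπ.isLocalDiffeomorph.isLocalHomeomorph
  refine ⟨hX, h1, pullbackAtlas 𝒜 π, ⟨hℬ, ?_, ?_⟩, hN, hπmul⟩
  · exact IsLocallyNash.lift hG.atlas hℬ hπ.isLocalDiffeomorph hN (hG.mul.comp (hN.prodMap hN)) hmul
      fun p => hπmul p.1 p.2
  · exact IsLocallyNash.lift hG.atlas hℬ hπ.isLocalDiffeomorph hN (hG.inv.comp hN) hinv hπinv

end Existence

/-! ### The main theorem -/

theorem mainTheorem11 {𝕜 : Type*} [RCLike 𝕜] {n : ℕ}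
    {G : Type*} [TopologicalSpace G] [ChartedSpace (Fin n → 𝕜) G]
    [IsManifold 𝓘(𝕜, Fin n → 𝕜) ω G] [Group G]
    (𝒜 : Set (OpenPartialHomeomorph G (Fin n → 𝕜))) (hG : IsLocallyNashGroup 𝒜)
    {X : Type*} [TopologicalSpace X] [ChartedSpace (Fin n → 𝕜) X]
    (π : X → G) (hπ : IsAnalyticUniversalCover 𝕜 n π) :
    -- existence, with any point of the fibre over the identity as the identity
    (∀ e : X, π e = 1 → ∃ _ : Group X, (1 : X) = e ∧
      ∃ ℬ : Set (OpenPartialHomeomorph X (Fin n → 𝕜)),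
        IsLocallyNashGroup ℬ ∧ IsLocallyNashHom ℬ 𝒜 π) ∧
    -- uniqueness up to isomorphism (over `G`)
    (∀ [Group X] (ℬ : Set (OpenPartialHomeomorph X (Fin n → 𝕜))),
      IsLocallyNashGroup ℬ → IsLocallyNashHom ℬ 𝒜 π →
      ∀ {X' : Type*} [TopologicalSpace X'] [ChartedSpace (Fin n → 𝕜) X'] [Group X']
        (π' : X' → G) (ℬ' : Set (OpenPartialHomeomorph X' (Fin n → 𝕜))),
        IsAnalyticUniversalCover 𝕜 n π' →
        IsLocallyNashGroup ℬ' → IsLocallyNashHom ℬ' 𝒜 π' →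
        ∃ α : X ≃* X', IsLocallyNash ℬ ℬ' α ∧ IsLocallyNash ℬ' ℬ α.symm ∧ ∀ x, π' (α x) = π x) ∧
    -- analytic local sections are locally Nash
    (∀ [Group X] (ℬ : Set (OpenPartialHomeomorph X (Fin n → 𝕜))),
      IsLocallyNashGroup ℬ → IsLocallyNashHom ℬ 𝒜 π →
      ∀ (W : Set G) (s : G → X), IsOpen W →
        ContMDiffOn 𝓘(𝕜, Fin n → 𝕜) 𝓘(𝕜, Fin n → 𝕜) ω s W → (∀ g ∈ W, π (s g) = g) →
        IsLocallyNashOn 𝒜 ℬ s W) := by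
  refine ⟨fun e he => hπ.exists_isLocallyNashGroup hG he, ?_, ?_⟩
  · intro _ ℬ hX hπh X' _ _ _ π' ℬ' hπ' hX' hπh'
    exact hπ.exists_mulEquiv hG hX hπh hπ' hX' hπh'
  · intro _ ℬ hX hπh W s hW hs hsec
    exact hπh.1.isLocallyNashOn_section hG.atlas hX.atlas hπ.isLocalDiffeomorph.isLocalHomeomorph
      hW hs hsec
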